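/- Let $K$ be a compact connected Lie group of dimension $n$ with Lie algebra $\mathfrak K$, let $(\cdot,\cdot)$ be an $\mathrm{Ad}$-invariant inner product on $\mathfrak K$ with orthonormal basis $X_1,\dots,X_n$, and identify $T^*K$ with $K\times\mathfrak K$. Let $\theta_{(x,Y)}(u,A)=(Y,x^{-1}u)$, $\omega=-d\theta$, $\epsilon=\omega^n/n!$ (which integrates as $dx\,dY$, with $dx$ a Haar measure on $K$, of any fixed normalization, and $dY$ Lebesgue measure on $\mathfrak K$), and $b=(2i)^n(-1)^{n(n-1)/2}$. Let $K_{\mathbb C}$ be the complexification of $K$ and, for $s>0$, let $\psi_s:T^*K\to K_{\mathbb C}$, $\psi_s(x,Y)=xe^{isY}$, and let $J_s$ be the complex structure on $T^*K$ induced by $\psi_s$. Let $\tilde\eta^1_s,\dots,\tilde\eta^n_s$ be the pullbacks under $\psi_s$ of the left invariant holomorphic $1$-forms on $K_{\mathbb C}$ dual to the left invariant extensions of $X_1,\dots,X_n$, let $\Omega_s=\tilde\eta_s^1\wedge\dots\wedge\tilde\eta_s^n$, and let $|\Omega_s|\ge 0$ be defined by $\bar\Omega_s\wedge\Omega_s=|\Omega_s|^2\,b\,\epsilon$.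 The prequantum Hilbert space ${\cal H}_s$ consists of the sections $f\sqrt{\Omega_s}$ with $\int_{T^*K}|f|^2|\Omega_s|\,\epsilon<\infty$, with inner product $\langle f\sqrt{\Omega_s},f'\sqrt{\Omega_s}\rangle=\int_{T^*K}\bar f f'|\Omega_s|\,\epsilon$. The map $f\mapsto \frac{f}{\sqrt{|\Omega_s|}}\sqrt{\Omega_s}$ is a unitary isomorphism $L^2(T^*K,\epsilon)\to{\cal H}_s$ for each $s>0$, and $\delta^{\rm prQ}$ denotes the connection on the bundle $({\cal H}_s)_{s>0}$ that corresponds to the trivial connection on $L^2(T^*K,\epsilon)\times\mathbb R_+$ under these isomorphisms. For $s,s'>0$ the prequantum BKS pairing of $f\sqrt{\Omega_s}\in{\cal H}_s$ and $f'\sqrt{\Omega_{s'}}\in{\cal H}_{s'}$ is $$\langle f\sqrt{\Omega_s},f'\sqrt{\Omega_{s'}}\rangle^{\rm BKS}=\int_{T^*K}\bar f f'\sqrt{\frac{\bar\Omega_s\wedge\Omega_{s'}}{b\,\epsilon}}\;\epsilon .$$ Let $\eta:\mathfrak K\to\mathbb R$ be the $\mathrm{Ad}$-invariant function given on each Cartan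 subalgebra, for any set $R^+$ of positive roots, by $\eta(Y)=\prod_{\alpha\in R^+}\frac{\sinh\alpha(Y)}{\alpha(Y)}$ (a factor with $\alpha(Y)=0$ being $1$), and let $$\phi(s,s',Y)=\left(\frac{s+s'}{2\sqrt{ss'}}\right)^n\frac{\eta^2\left(\frac{s+s'}2Y\right)}{\eta(sY)\,\eta(s'Y)} .$$ **Theorem.** The function $\eta$ is well defined, and for all $s,s'>0$: $\phi(s,s',Y)=\dfrac{|\Omega_{(s+s')/2}|^2}{|\Omega_s||\Omega_{s'}|}$; the integral defining the BKS pairing converges absolutely; the parallel transport ${\cal H}_{s'}\to{\cal H}_s$ of $\delta^{\rm prQ}$ exists and is unique; and there is a unique map $B_{ss'}:{\cal H}_{s'}\to{\cal H}_s$ with $\langle\sigma,\sigma'\rangle^{\rm BKS}=\langle\sigma,B_{ss'}\sigma'\rangle$ for all $\sigma\in{\cal H}_s$, $\sigma'\in{\cal H}_{s'}$. It is bounded and linear, and $$B_{ss'}\left(f'\frac{\sqrt{\Omega_{s'}}}{\sqrt{|\Omega_{s'}|}}\right)=\sqrt{\phi(s,s',\cdot)}\;f'\,\frac{\sqrt{\Omega_s}}{\sqrt{|\Omega_s|}}\qquad\text{for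 all } f'\in L^2(T^*K,\epsilon).$$ If moreover $n\ge1$ and $s\ne s'$, then $B_{ss'}$ does not coincide with the parallel transport of $\delta^{\rm prQ}$, and $B_{ss'}$ is not unitary. -/

import Mathlib

open scoped Manifold ContDiff ComplexConjugate InnerProductSpace
open MeasureTheory

noncomputable section

namespace BKS

/-! ### Lie groups: adjoint action, Lie bracket, exponential map, complexification

A real Lie group `K` is modelled on `𝔨`, so that the tangent space `T_1 K` is `𝔨` itself: `𝔨` is the
Lie algebra of `K`, and the inner product carried by `𝔨` is the inner product fixed on `Lie(K)`. -/

section LieGroups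

variable {𝔨 : Type*} [NormedAddCommGroup 𝔨] [NormedSpace ℝ 𝔨]
variable (K : Type*) [TopologicalSpace K] [ChartedSpace 𝔨 K] [Group K]

/-- The bracket of the Lie algebra `𝔨 = T_1 K` (bracket of left invariant vector fields). -/
def lieBr (Y Z : 𝔨) : 𝔨 :=
  Bracket.bracket (L := GroupLieAlgebra 𝓘(ℝ, 𝔨) K) (M := GroupLieAlgebra 𝓘(ℝ, 𝔨) K) Y Z

variable {K}

/-- The adjoint action of `K` on `𝔨`. -/
def Ad (x : K) : 𝔨 →L[ℝ] 𝔨 :=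
  mfderiv 𝓘(ℝ, 𝔨) 𝓘(ℝ, 𝔨) (fun y : K => x * y * x⁻¹) 1

/-- The left Maurer–Cartan form: `u ∈ T_x K` is sent to the left translate `x⁻¹ u ∈ T_1 K`. -/
def maurerCartan (x : K) : 𝔨 →L[ℝ] 𝔨 :=
  mfderiv 𝓘(ℝ, 𝔨) 𝓘(ℝ, 𝔨) (fun y : K => x⁻¹ * y) x

/-- The left invariant vector field with value `Y` at `1`, evaluated at `x`. -/
def leftInv (x : K) (Y : 𝔨) : 𝔨 :=
  mulInvariantVectorField (I := 𝓘(ℝ, 𝔨)) (G := K) Y x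

/-- `γ` is a one-parameter subgroup with initial velocity `Z`. -/
def IsOneParam (γ : ℝ → K) (Z : 𝔨) : Prop :=
  (∀ s t, γ (s + t) = γ s * γ t) ∧
    HasMFDerivAt 𝓘(ℝ, ℝ) 𝓘(ℝ, 𝔨) γ 0 (ContinuousLinearMap.toSpanSingleton ℝ Z : ℝ →L[ℝ] 𝔨)

variable (K) in
open Classical in
/-- The exponential map: `exp Z = γ 1` for the one-parameter subgroup `γ` with `γ'(0) = Z`. -/
def lieExp (Z : 𝔨) : K :=
  if h : ∃ γ : ℝ → K, IsOneParam γ Z then h.choose 1 else 1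

variable {𝔤 : Type*} [NormedAddCommGroup 𝔤] [NormedSpace ℂ 𝔤]
variable {G : Type*} [TopologicalSpace G] [ChartedSpace 𝔤 G] [Group G]

/-- The differential at `1` of a homomorphism `K → G`. -/
def dHom (ι : K →* G) : 𝔨 →L[ℝ] 𝔤 :=
  mfderiv 𝓘(ℝ, 𝔨) 𝓘(ℝ, 𝔤) (fun x : K => ι x) 1

variable (𝔨 𝔤)

/-- `ψ_s(x, Y) = x e^{isY}`, a map from `T^*K = K × 𝔨` to the complexified group `G`. -/
def psi (ι : K →* G) (s : ℝ) (p : K × 𝔨) : G :=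
  ι p.1 * lieExp G ((Complex.I * (s : ℂ)) • (dHom ι p.2 : 𝔤))

/-- `(G, ι)` is the complexification of the compact group `K`: the complex Lie group `G` contains
`K`, its Lie algebra is `𝔨 ⊕ i𝔨`, and `(x, Y) ↦ x e^{iY}` is a diffeomorphism `K × 𝔨 → G`. -/
structure IsComplexification (ι : K →* G) : Prop where
  smooth : ContMDiff 𝓘(ℝ, 𝔨) 𝓘(ℝ, 𝔤) ∞ (fun x : K => ι x)
  realForm : Function.Bijective (fun p : 𝔨 × 𝔨 => (dHom ι p.1 : 𝔤) + Complex.I • dHom ι p.2)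
  polar : ∃ Φ : Diffeomorph (𝓘(ℝ, 𝔨).prod 𝓘(ℝ, 𝔨)) 𝓘(ℝ, 𝔤) (K × 𝔨) G ∞,
    ∀ x Y, Φ (x, Y) = ι x * lieExp G (Complex.I • (dHom ι Y : 𝔤))

end LieGroups

/-! ### Roots and the function `η` -/

section Roots

variable {𝔨 : Type*} [NormedAddCommGroup 𝔨] [NormedSpace ℝ 𝔨]
variable (K : Type*) [TopologicalSpace K] [ChartedSpace 𝔨 K] [Group K]

/-- Cartan subalgebras of the Lie algebra of a compact group: maximal abelian subalgebras. -/
def IsCartan (𝔱 : Submodule ℝ 𝔨) : Prop :=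
  (∀ H ∈ 𝔱, ∀ H' ∈ 𝔱, lieBr K H H' = 0) ∧
    ∀ Z : 𝔨, (∀ H ∈ 𝔱, lieBr K H Z = 0) → Z ∈ 𝔱

/-- The (real) roots relative to `𝔱`: nonzero functionals `α` on `𝔱` for which some nonzero
`Z = A + iB` in `𝔨 ⊗ ℂ` satisfies `[H, Z] = i α(H) Z` for all `H ∈ 𝔱`. -/
def IsRoot (𝔱 : Submodule ℝ 𝔨) (α : Module.Dual ℝ 𝔱) : Prop :=
  α ≠ 0 ∧ ∃ A B : 𝔨, ¬ (A = 0 ∧ B = 0) ∧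
    ∀ H : 𝔱, lieBr K (H : 𝔨) A = -(α H • B) ∧ lieBr K (H : 𝔨) B = α H • A

/-- A set of positive roots: the roots that are positive on a regular element of `𝔱`. -/
def IsPositiveRoots (𝔱 : Submodule ℝ 𝔨) (R : Set (Module.Dual ℝ 𝔱)) : Prop :=
  ∃ H₀ : 𝔱, (∀ α, IsRoot K 𝔱 α → α H₀ ≠ 0) ∧ R = {α | IsRoot K 𝔱 α ∧ 0 < α H₀}

/-- `sinh t / t`, with its value `1` at `t = 0`. -/
def sinhc (t : ℝ) : ℝ := if t = 0 then 1 else Real.sinh t / t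

/-- The product of `sinh α(Y) / α(Y)` over `α ∈ R`. -/
def etaProd (𝔱 : Submodule ℝ 𝔨) (R : Set (Module.Dual ℝ 𝔱)) (Y : 𝔱) : ℝ :=
  ∏ᶠ α ∈ R, sinhc (α Y)

/-- The function `η` on `𝔨`: its value at `Y` is the product of `sinh α(Y) / α(Y)` over a set of
positive roots of a Cartan subalgebra that contains `Y`. (The theorem also states that the value
does not depend on these choices.) -/
def eta (Y : 𝔨) : ℝ :=
  Classical.epsilon fun v : ℝ => ∃ (𝔱 : Submodule ℝ 𝔨) (R : Set (Module.Dual ℝ 𝔱)) (hY : Y ∈ 𝔱),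
    IsCartan K 𝔱 ∧ IsPositiveRoots K 𝔱 R ∧ v = etaProd 𝔱 R ⟨Y, hY⟩

/-- The explicit function `φ(s, s', Y)`, where `n = dim K`. -/
def phi (n : ℕ) (s s' : ℝ) (Y : 𝔨) : ℝ :=
  ((s + s') / (2 * √(s * s'))) ^ n *
    (eta K (((s + s') / 2) • Y) ^ 2 / (eta K (s • Y) * eta K (s' • Y)))

end Roots

/-! ### Exterior algebra -/

section Forms

variable {V : Type*} [AddCommGroup V] [Module ℝ V]

/-- The wedge product of alternating forms (normalized so that `α ∧ β` is a sum over shuffles). -/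
def wedge {A : Type*} [CommRing A] [Algebra ℝ A] {p q : ℕ}
    (a : V [⋀^Fin p]→ₗ[ℝ] A) (b : V [⋀^Fin q]→ₗ[ℝ] A) : V [⋀^Fin (p + q)]→ₗ[ℝ] A :=
  ((LinearMap.mul' ℝ A).compAlternatingMap (a.domCoprod b)).domDomCongr finSumFinEquiv

/-- `w^k = w ∧ ⋯ ∧ w` for a 2-form `w`. -/
def wedgePow (w : V [⋀^Fin 2]→ₗ[ℝ] ℝ) : (k : ℕ) → V [⋀^Fin (2 * k)]→ₗ[ℝ] ℝ
  | 0 => (AlternatingMap.constOfIsEmpty ℝ V (Fin 0) (1 : ℝ) : V [⋀^Fin 0]→ₗ[ℝ] ℝ)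
  | k + 1 => wedge (wedgePow w k) w

/-- `η^1 ∧ ⋯ ∧ η^n` for complex valued real-linear forms `η^j`, the components of `η`. -/
def wedgeAll {n : ℕ} (η : V →ₗ[ℝ] (Fin n → ℂ)) : V [⋀^Fin n]→ₗ[ℝ] ℂ :=
  { ((Matrix.detRowAlternating (n := Fin n) (R := ℂ)).toMultilinearMap.restrictScalars
      ℝ).compLinearMap (fun _ => η) with
    map_eq_zero_of_eq' := fun v _ _ h hij =>
      (Matrix.detRowAlternating (n := Fin n) (R := ℂ)).map_eq_zero_of_eq (fun k => η (v k))
        (congrArg η h) hij }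

/-- The complex conjugate of a form. -/
def conjForm {k : ℕ} (a : V [⋀^Fin k]→ₗ[ℝ] ℂ) : V [⋀^Fin k]→ₗ[ℝ] ℂ :=
  (Complex.conjAe.toLinearMap).compAlternatingMap a

end Forms

/-! ### The cotangent bundle `T^*K = K × 𝔨`

Tangent vectors at `(x, Y)` are pairs `(u, A)` with `u ∈ T_x K` and `A ∈ 𝔨`. -/

section Cotangent

variable {𝔨 : Type*} [NormedAddCommGroup 𝔨] [InnerProductSpace ℝ 𝔨]
variable {K : Type*} [TopologicalSpace K] [ChartedSpace 𝔨 K] [Group K]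
variable {𝔤 : Type*} [NormedAddCommGroup 𝔤] [NormedSpace ℂ 𝔤]
variable {G : Type*} [TopologicalSpace G] [ChartedSpace 𝔤 G] [Group G]
variable {n : ℕ}

/-- The exterior derivative on the manifold `K × 𝔨`, computed at each point `p` in the chart at `p`
(whose derivative at `p` is the identification of the tangent space at `p` with `𝔨 × 𝔨`). -/
def extD {k : ℕ} (a : K × 𝔨 → (𝔨 × 𝔨) [⋀^Fin k]→L[ℝ] ℝ) (p : K × 𝔨) :
    (𝔨 × 𝔨) [⋀^Fin (k + 1)]→L[ℝ] ℝ :=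
  extDeriv (fun z : 𝔨 × 𝔨 =>
    (a ((extChartAt (𝓘(ℝ, 𝔨).prod 𝓘(ℝ, 𝔨)) p).symm z)).compContinuousLinearMap
      (mfderiv 𝓘(ℝ, 𝔨 × 𝔨) (𝓘(ℝ, 𝔨).prod 𝓘(ℝ, 𝔨))
        (fun z' => (extChartAt (𝓘(ℝ, 𝔨).prod 𝓘(ℝ, 𝔨)) p).symm z') z : (𝔨 × 𝔨) →L[ℝ] (𝔨 × 𝔨)))
    (extChartAt (𝓘(ℝ, 𝔨).prod 𝓘(ℝ, 𝔨)) p p)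

/-- The canonical 1-form `θ = ∑ y^i w^i`, that is `θ(u, A) = ⟨Y, x⁻¹ u⟩` at `(x, Y)`. -/
def theta (p : K × 𝔨) : (𝔨 × 𝔨) [⋀^Fin 1]→L[ℝ] ℝ :=
  ContinuousAlternatingMap.ofSubsingleton ℝ (𝔨 × 𝔨) ℝ (0 : Fin 1)
    ((innerSL ℝ p.2).comp ((maurerCartan p.1).comp (ContinuousLinearMap.fst ℝ 𝔨 𝔨)))

/-- The canonical symplectic form `ω = -dθ`. -/
def omega (p : K × 𝔨) : (𝔨 × 𝔨) [⋀^Fin 2]→L[ℝ] ℝ := -extD theta p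

/-- The Liouville form `ε = ω^n / n!`, a form of degree `2n`. -/
def liouvilleForm (n : ℕ) (p : K × 𝔨) : (𝔨 × 𝔨) [⋀^Fin (n + n)]→ₗ[ℝ] ℝ :=
  ((n.factorial : ℝ)⁻¹ • wedgePow (omega p).toAlternatingMap n).domDomCongr
    (finCongr (two_mul n))

open Classical in
/-- The complex coordinates on `𝔤 = 𝔨 ⊕ i𝔨` with respect to the complex basis `X_1, …, X_n`. -/
def cCoord (ι : K →* G) (X : Fin n → 𝔨) : 𝔤 →ₗ[ℂ] (Fin n → ℂ) :=
  if h : Function.Bijective (Fintype.linearCombination ℂ (fun j => (dHom ι (X j) : 𝔤))) then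
    (LinearEquiv.ofBijective (Fintype.linearCombination ℂ (fun j => (dHom ι (X j) : 𝔤))) h).symm.toLinearMap
  else 0

variable (𝔤)

/-- The left invariant `J_s`-holomorphic 1-forms `η̃_s^1, …, η̃_s^n`, as the components of one form
with values in `ℂ^n`. They are the pullbacks under `ψ_s` of the left invariant holomorphic 1-forms
on `G` dual to the left invariant vector fields `X_{1,ℂ}, …, X_{n,ℂ}`. In other words `η̃_s^j` is
complex linear for the complex structure `J_s` obtained from `ψ_s` and takes the value `δ^j_k` on
the field `X̃_k` with `ψ_{s*} X̃_k = X_{k,ℂ}`. -/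
def etaForm (ι : K →* G) (X : Fin n → 𝔨) (s : ℝ) (p : K × 𝔨) : (𝔨 × 𝔨) →ₗ[ℝ] (Fin n → ℂ) :=
  ((cCoord ι X).restrictScalars ℝ).comp
    (((maurerCartan (psi 𝔨 𝔤 ι s p)).comp
      (mfderiv (𝓘(ℝ, 𝔨).prod 𝓘(ℝ, 𝔨)) 𝓘(ℝ, 𝔤) (psi 𝔨 𝔤 ι s) p : (𝔨 × 𝔨) →L[ℝ] 𝔤) :
        (𝔨 × 𝔨) →L[ℝ] 𝔤) : (𝔨 × 𝔨) →ₗ[ℝ] 𝔤)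

/-- `Ω_s = η̃_s^1 ∧ ⋯ ∧ η̃_s^n`, the trivializing section of the canonical bundle of `J_s`. -/
def Om (ι : K →* G) (X : Fin n → 𝔨) (s : ℝ) (p : K × 𝔨) : (𝔨 × 𝔨) [⋀^Fin n]→ₗ[ℝ] ℂ :=
  wedgeAll (etaForm 𝔤 ι X s p)

/-- The frame `(X_1, 0), …, (X_n, 0), (0, X_1), …, (0, X_n)` of the tangent space at `(x, Y)`,
with `X_i` extended to left invariant vector fields. -/
def frame (X : Fin n → 𝔨) (p : K × 𝔨) : Fin (n + n) → 𝔨 × 𝔨 :=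
  Fin.append (fun i => (leftInv p.1 (X i), 0)) (fun i => (0, X i))

/-- The constant `b = (2i)^n (-1)^{n(n-1)/2}`. -/
def bConst (n : ℕ) : ℂ := (2 * Complex.I) ^ n * (-1) ^ (n * (n - 1) / 2)

/-- The function `(Ω̄_s ∧ Ω_{s'}) / (b ε)`: the quotient of two forms of top degree, which can be
computed on any frame. -/
def ratio (ι : K →* G) (X : Fin n → 𝔨) (s s' : ℝ) (p : K × 𝔨) : ℂ :=
  wedge (conjForm (Om 𝔤 ι X s p)) (Om 𝔤 ι X s' p) (frame X p) /
    (bConst n * (liouvilleForm n p (frame X p) : ℂ))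

/-- `|Ω_s|`, the nonnegative function with `Ω̄_s ∧ Ω_s = |Ω_s|² b ε`. -/
def normOm (ι : K →* G) (X : Fin n → 𝔨) (s : ℝ) (p : K × 𝔨) : ℝ :=
  √((ratio 𝔤 ι X s s p).re)

/-! ### The prequantum Hilbert bundle, its connection and the BKS pairing -/

variable [FiniteDimensional ℝ 𝔨] [MeasurableSpace 𝔨] [BorelSpace 𝔨] [MeasurableSpace K]

/-- The Liouville measure `ε` on `T^*K = K × 𝔨`: the product of a Haar measure `dx` on `K` and of
the Lebesgue measure `dY` of the Euclidean space `𝔨`. (The Liouville form has density `±1` with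
respect to the coframe dual to `frame`, so it integrates as the left invariant Riemannian measure of
`K`, a Haar measure, times `dY`. The normalization of `dx` is left free.) -/
def liouville (μ : Measure K) : Measure (K × 𝔨) := μ.prod volume

/-- The measure `|Ω_s| ε`. -/
def prqMeasure (ι : K →* G) (X : Fin n → 𝔨) (μ : Measure K) (s : ℝ) : Measure (K × 𝔨) :=
  (liouville μ).withDensity fun p => ENNReal.ofReal (normOm 𝔤 ι X s p)

/-- The prequantum Hilbert space `H_s`. The element `f` of `L²(T^*K, |Ω_s| ε)` stands for the section
`f √Ω_s` of `L ⊗ δ_s`; the inner product is `∫ f̄ f' |Ω_s| ε`. -/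
abbrev PrQ (ι : K →* G) (X : Fin n → 𝔨) (μ : Measure K) (s : ℝ) : Type _ :=
  Lp ℂ 2 (prqMeasure 𝔤 ι X μ s)

variable (𝔨) in
/-- The space `L²(T^*K, ε)`. -/
abbrev L2 (μ : Measure K) : Type _ := Lp ℂ 2 (liouville (𝔨 := 𝔨) μ)

open Classical in
/-- The trivialization `f ↦ (f / √|Ω_s|) √Ω_s` from `L²(T^*K, ε)` to `H_s`. -/
def triv (ι : K →* G) (X : Fin n → 𝔨) (μ : Measure K) (s : ℝ) (f : L2 𝔨 μ) : PrQ 𝔤 ι X μ s :=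
  if h : MemLp (fun p => f p / (√(normOm 𝔤 ι X s p) : ℂ)) 2 (prqMeasure 𝔤 ι X μ s) then h.toLp
  else 0

/-- The prequantum connection: `τ` is the covariant derivative at `s` of the section `σ` of the
prequantum bundle over `s > 0`. This is the connection that corresponds to the trivial one under
the trivialization. -/
def HasCovDerivAt (ι : K →* G) (X : Fin n → 𝔨) (μ : Measure K)
    (σ : (s : ℝ) → PrQ 𝔤 ι X μ s) (s : ℝ) (τ : PrQ 𝔤 ι X μ s) : Prop :=
  ∃ g : ℝ → L2 𝔨 μ, (∀ r, 0 < r → σ r = triv 𝔤 ι X μ r (g r)) ∧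
    ∃ g' : L2 𝔨 μ, HasDerivAt g g' s ∧ τ = triv 𝔤 ι X μ s g'

/-- `P : H_{s'} → H_s` is the parallel transport of the prequantum connection: it sends `σ_{s'}` to
`σ_s` for every parallel section `σ`. -/
def IsParallelTransport (ι : K →* G) (X : Fin n → 𝔨) (μ : Measure K) (s s' : ℝ)
    (P : PrQ 𝔤 ι X μ s' → PrQ 𝔤 ι X μ s) : Prop :=
  ∀ σ : (r : ℝ) → PrQ 𝔤 ι X μ r, (∀ r, 0 < r → HasCovDerivAt 𝔤 ι X μ σ r 0) → P (σ s') = σ s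

/-- The integrand of the prequantum BKS pairing of `f √Ω_s` and `f' √Ω_{s'}`. -/
def bksIntegrand (ι : K →* G) (X : Fin n → 𝔨) (s s' : ℝ) (f f' : K × 𝔨 → ℂ) (p : K × 𝔨) : ℂ :=
  conj (f p) * f' p * ratio 𝔤 ι X s s' p ^ (1 / 2 : ℂ)

/-- `B : H_{s'} → H_s` is the prequantum BKS pairing map:
`⟨σ, σ'⟩^BKS = ⟨σ, B σ'⟩^prQ` for all `σ` and `σ'`. -/
def IsBKSMap (ι : K →* G) (X : Fin n → 𝔨) (μ : Measure K) (s s' : ℝ)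
    (B : PrQ 𝔤 ι X μ s' → PrQ 𝔤 ι X μ s) : Prop :=
  ∀ (σ : PrQ 𝔤 ι X μ s) (σ' : PrQ 𝔤 ι X μ s'),
    ∫ p, bksIntegrand 𝔤 ι X s s' σ σ' p ∂(liouville μ) = ⟪σ, B σ'⟫_ℂ

end Cotangent

end BKS

end

/-! Everything reduces to a computation at one point (x, Y), in the frame (X_j, 0), (0, X_j). Let M
be the hermitian matrix of i ad Y in the basis X (`adMat`). After left translation to the identity,
the differential of ψ_s is Ad(e^{-isY}) on the K-directions, and s times the logarithmic derivative
of Y ↦ e^{iY} at sY on the 𝔨-directions. As functions of s, the coordinate matrices W and Q of these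
two parts satisfy W' = -MW, W(0) = 1 and Q' = iW, Q(0) = 0 (`exists_etaForm_eq`), so W(s) = e^{-sM}
and Q(s) = i∫₀ˢ e^{-tM} dt.

M is purely imaginary, so conjugation replaces s by -s in W and Q. The value of Ω̄_s ∧ Ω_{s'} on the
frame is therefore the determinant of a 2×2 block matrix whose blocks are all functions of M. An
eigenvalue l of M contributes i(e^{sl} - e^{-s'l})/l = i e^{(s-s')l/2}(s+s') sinhc((s+s')l/2), and
the exponentials multiply to 1 because M has trace zero. The value of ε on the frame is ±1, with the
sign that cancels the one in b. So the quotient of forms is ((s+s')/2)^n ∏ sinhc((s+s')l_j/2)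
(`det_blocks_eq`, `wedgePow_apply_frame`, `ratio_eq_of_diagonalization`).

For a Cartan subalgebra containing Y, the l_j are values at Y of weights that are zero or roots.
Roots come in pairs ±α, and the root spaces are complex lines
(`IsRootVector.eq_zero_of_orthogonal`), so ∏ sinhc(l_j) = η(Y)² (`etaProd_pos_and_sq`). The same
product is det(sinh M / M), which involves no Cartan subalgebra; this gives well-definedness and
continuity of η.

Hence the quotient for (s, s') equals |Ω_{(s+s')/2}|² > 0, and in the unitary trivializations the
BKS pairing has kernel √φ (`ratio_cpow`). Log-convexity of sinhc gives φ(Y) ≤ φ(0), so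
multiplication by √φ is bounded and is the pairing map. Parallel transport is the identity in these
trivializations. By AM–GM φ(0) > 1 when n ≥ 1 and s ≠ s', so by continuity √φ exceeds a constant
above 1 near Y = 0, and multiplication by it is not isometric. -/

open scoped Topology

noncomputable section

namespace BKS

set_option linter.unusedSectionVars false

/-! ### Derivatives of maps between manifolds, as maps of the model spaces -/

section Calculus

variable {E₁ : Type*} [NormedAddCommGroup E₁] [NormedSpace ℝ E₁]
  {H₁ : Type*} [TopologicalSpace H₁] {I₁ : ModelWithCorners ℝ E₁ H₁}
  {M₁ : Type*} [TopologicalSpace M₁] [ChartedSpace H₁ M₁]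
  {E₂ : Type*} [NormedAddCommGroup E₂] [NormedSpace ℝ E₂]
  {H₂ : Type*} [TopologicalSpace H₂] {I₂ : ModelWithCorners ℝ E₂ H₂}
  {M₂ : Type*} [TopologicalSpace M₂] [ChartedSpace H₂ M₂]
  {E₃ : Type*} [NormedAddCommGroup E₃] [NormedSpace ℝ E₃]
  {H₃ : Type*} [TopologicalSpace H₃] {I₃ : ModelWithCorners ℝ E₃ H₃}
  {M₃ : Type*} [TopologicalSpace M₃] [ChartedSpace H₃ M₃]

variable (I₁ I₂) in
/-- `HasMFDerivAt` with the derivative viewed as a map between the model vector spaces. -/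
def HasD (f : M₁ → M₂) (x : M₁) (L : E₁ →L[ℝ] E₂) : Prop := HasMFDerivAt I₁ I₂ f x L

theorem HasD.mfderiv_eq {f : M₁ → M₂} {x : M₁} {L : E₁ →L[ℝ] E₂} (h : HasD I₁ I₂ f x L) :
    (mfderiv I₁ I₂ f x : E₁ →L[ℝ] E₂) = L := HasMFDerivAt.mfderiv h

theorem hasD_mfderiv {f : M₁ → M₂} {x : M₁} (h : MDifferentiableAt I₁ I₂ f x) :
    HasD I₁ I₂ f x (mfderiv I₁ I₂ f x) := h.hasMFDerivAt

theorem exists_hasD {f : M₁ → M₂} {x : M₁} (h : MDifferentiableAt I₁ I₂ f x) :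
    ∃ L, HasD I₁ I₂ f x L := ⟨_, hasD_mfderiv h⟩

theorem HasD.unique {f : M₁ → M₂} {x : M₁} {L L' : E₁ →L[ℝ] E₂} (h : HasD I₁ I₂ f x L)
    (h' : HasD I₁ I₂ f x L') : L = L' := hasMFDerivAt_unique h h'

theorem HasD.comp {g : M₂ → M₃} {f : M₁ → M₂} {x : M₁} {L' : E₂ →L[ℝ] E₃} {L : E₁ →L[ℝ] E₂}
    (hg : HasD I₂ I₃ g (f x) L') (hf : HasD I₁ I₂ f x L) :
    HasD I₁ I₃ (fun y => g (f y)) x (L'.comp L) := HasMFDerivAt.comp x hg hf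

theorem HasD.comp_of_eq {g : M₂ → M₃} {f : M₁ → M₂} {x : M₁} {y : M₂} {L' : E₂ →L[ℝ] E₃}
    {L : E₁ →L[ℝ] E₂} (hg : HasD I₂ I₃ g y L') (hf : HasD I₁ I₂ f x L) (hy : f x = y) :
    HasD I₁ I₃ (fun z => g (f z)) x (L'.comp L) := by
  subst hy; exact hg.comp hf

theorem HasD.prodMk {f : M₁ → M₂} {g : M₁ → M₃} {x : M₁} {L : E₁ →L[ℝ] E₂} {L' : E₁ →L[ℝ] E₃}
    (hf : HasD I₁ I₂ f x L) (hg : HasD I₁ I₃ g x L') :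
    HasD I₁ (I₂.prod I₃) (fun y => (f y, g y)) x (L.prod L') := HasMFDerivAt.prodMk hf hg

theorem hasD_id (x : M₁) : HasD I₁ I₁ (fun y : M₁ => y) x (ContinuousLinearMap.id ℝ E₁) :=
  hasMFDerivAt_id x

theorem hasD_const (c : M₂) (x : M₁) : HasD I₁ I₂ (fun _ : M₁ => c) x 0 :=
  hasMFDerivAt_const c x

theorem hasD_fst (x : M₁ × M₂) :
    HasD (I₁.prod I₂) I₁ (Prod.fst : M₁ × M₂ → M₁) x (ContinuousLinearMap.fst ℝ E₁ E₂) :=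
  hasMFDerivAt_fst x

theorem hasD_snd (x : M₁ × M₂) :
    HasD (I₁.prod I₂) I₂ (Prod.snd : M₁ × M₂ → M₂) x (ContinuousLinearMap.snd ℝ E₁ E₂) :=
  hasMFDerivAt_snd x

theorem hasD_iff_hasFDerivAt {f : E₁ → E₂} {x : E₁} {L : E₁ →L[ℝ] E₂} :
    HasD 𝓘(ℝ, E₁) 𝓘(ℝ, E₂) f x L ↔ HasFDerivAt f L x := hasMFDerivAt_iff_hasFDerivAt

end Calculus

section Chart

variable {E : Type*} [NormedAddCommGroup E] [NormedSpace ℝ E]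
  {M : Type*} [TopologicalSpace M] [ChartedSpace E M]
  {E' : Type*} [NormedAddCommGroup E'] [NormedSpace ℝ E']
  {M' : Type*} [TopologicalSpace M'] [ChartedSpace E' M']
  {V : Type*} [NormedAddCommGroup V] [NormedSpace ℝ V]

theorem hasD_iff_chart {f : M → M'} {x : M} {L : E →L[ℝ] E'} :
    HasD 𝓘(ℝ, E) 𝓘(ℝ, E') f x L ↔ ContinuousAt f x ∧
      HasFDerivAt (fun w => extChartAt 𝓘(ℝ, E') (f x) (f ((extChartAt 𝓘(ℝ, E) x).symm w))) L
        (extChartAt 𝓘(ℝ, E) x x) := by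
  have h : Set.range 𝓘(ℝ, E) = Set.univ := by simp
  constructor
  · rintro ⟨h1, h2⟩
    refine ⟨h1, ?_⟩
    rw [h] at h2
    exact hasFDerivWithinAt_univ.1 h2
  · rintro ⟨h1, h2⟩
    refine ⟨h1, ?_⟩
    rw [h]
    exact hasFDerivWithinAt_univ.2 h2

theorem hasD_from_space_iff {f : V → M'} {x : V} {L : V →L[ℝ] E'} :
    HasD 𝓘(ℝ, V) 𝓘(ℝ, E') f x L ↔ ContinuousAt f x ∧
      HasFDerivAt (fun w => extChartAt 𝓘(ℝ, E') (f x) (f w)) L x := by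
  rw [hasD_iff_chart]; rfl

theorem hasD_to_space_iff {f : M → V} {x : M} {L : E →L[ℝ] V} :
    HasD 𝓘(ℝ, E) 𝓘(ℝ, V) f x L ↔ ContinuousAt f x ∧
      HasFDerivAt (fun w => f ((extChartAt 𝓘(ℝ, E) x).symm w)) L
        (extChartAt 𝓘(ℝ, E) x x) := by
  rw [hasD_iff_chart]; rfl

end Chart

/-! ### The Maurer–Cartan form and the adjoint action -/

section LieGroups

variable {E : Type*} [NormedAddCommGroup E] [NormedSpace ℝ E]
  {G : Type*} [TopologicalSpace G] [ChartedSpace E G] [Group G] [LieGroup 𝓘(ℝ, E) ∞ G]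
  {E₁ : Type*} [NormedAddCommGroup E₁] [NormedSpace ℝ E₁]
  {H₁ : Type*} [TopologicalSpace H₁] {I₁ : ModelWithCorners ℝ E₁ H₁}
  {M₁ : Type*} [TopologicalSpace M₁] [ChartedSpace H₁ M₁]

theorem hasD_maurerCartan (x : G) :
    HasD 𝓘(ℝ, E) 𝓘(ℝ, E) (fun y : G => x⁻¹ * y) x (maurerCartan x) :=
  hasD_mfderiv ((contMDiff_mul_left (I := 𝓘(ℝ, E)) (n := ∞) (a := x⁻¹)).mdifferentiableAt (by simp))

theorem hasD_leftInv (x : G) : HasD 𝓘(ℝ, E) 𝓘(ℝ, E) (fun y : G => x * y) 1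
    (mfderiv 𝓘(ℝ, E) 𝓘(ℝ, E) (fun y : G => x * y) 1) :=
  hasD_mfderiv ((contMDiff_mul_left (I := 𝓘(ℝ, E)) (n := ∞) (a := x)).mdifferentiableAt (by simp))

theorem leftInv_eq (x : G) (Y : E) :
    leftInv x Y = (mfderiv 𝓘(ℝ, E) 𝓘(ℝ, E) (fun y : G => x * y) 1 : E →L[ℝ] E) Y := rfl

theorem hasD_Ad (x : G) :
    HasD 𝓘(ℝ, E) 𝓘(ℝ, E) (fun y : G => x * y * x⁻¹) 1 (Ad x) :=
  hasD_mfderiv ((ContMDiff.mul (I := 𝓘(ℝ, E)) (n := ∞) (contMDiff_mul_left (a := x))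
    contMDiff_const).mdifferentiableAt (by simp))

theorem maurerCartan_leftInv (x : G) (Y : E) : maurerCartan x (leftInv x Y) = Y := by
  have h := (hasD_maurerCartan (E := E) x).comp_of_eq (hasD_leftInv x) (mul_one x)
  simp only [inv_mul_cancel_left] at h
  have := h.unique (hasD_id (1 : G))
  rw [leftInv_eq]
  exact DFunLike.congr_fun this Y

/-- Two maps into a Lie group with value `1` at `p`: the derivative of the product at `p` is the
sum of the derivatives. -/
theorem HasD.mul_of_eq_one {f g : M₁ → G} {p : M₁} {f' g' : E₁ →L[ℝ] E}
    (hf : HasD I₁ 𝓘(ℝ, E) f p f') (hg : HasD I₁ 𝓘(ℝ, E) g p g') (hf1 : f p = 1) (hg1 : g p = 1) :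
    HasD I₁ 𝓘(ℝ, E) (fun q => f q * g q) p (f' + g') := by
  have hm : MDifferentiableAt (𝓘(ℝ, E).prod 𝓘(ℝ, E)) 𝓘(ℝ, E) (fun q : G × G => q.1 * q.2) (1, 1) :=
    (contMDiff_mul 𝓘(ℝ, E) ∞).mdifferentiableAt (by simp)
  obtain ⟨m, h1⟩ := exists_hasD hm
  -- Multiplication restricts to the identity on `G × {1}` and on `{1} × G`, so its derivative at
  -- `(1, 1)` is addition.
  have hl : m.comp (ContinuousLinearMap.prod (.id ℝ E) 0) = .id ℝ E := by
    have := h1.comp_of_eq ((hasD_id (1 : G)).prodMk (hasD_const (I₂ := 𝓘(ℝ, E)) (1 : G) (1 : G))) rfl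
    simp only [mul_one] at this
    exact this.unique (hasD_id 1)
  have hr : m.comp (ContinuousLinearMap.prod 0 (.id ℝ E)) = .id ℝ E := by
    have := h1.comp_of_eq ((hasD_const (I₂ := 𝓘(ℝ, E)) (1 : G) (1 : G)).prodMk (hasD_id (1 : G))) rfl
    simp only [one_mul] at this
    exact this.unique (hasD_id 1)
  have h2 := h1.comp_of_eq (hf.prodMk hg) (by rw [hf1, hg1])
  convert h2 using 1
  ext v
  have e : (f' v, g' v) = ((f' v, 0) : E × E) + (0, g' v) := by simp
  have hl' := DFunLike.congr_fun hl (f' v)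
  have hr' := DFunLike.congr_fun hr (g' v)
  simp only [ContinuousLinearMap.comp_apply, ContinuousLinearMap.prod_apply,
    ContinuousLinearMap.id_apply, zero_apply] at hl' hr'
  simp only [ContinuousLinearMap.comp_apply, ContinuousLinearMap.prod_apply,
    add_apply]
  rw [e, map_add, hl', hr']

theorem HasD.conj_of_eq_one {f : M₁ → G} {p : M₁} {f' : E₁ →L[ℝ] E} (x : G)
    (hf : HasD I₁ 𝓘(ℝ, E) f p f') (hf1 : f p = 1) :
    HasD I₁ 𝓘(ℝ, E) (fun q => x * f q * x⁻¹) p ((Ad x).comp f') :=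
  (hasD_Ad x).comp_of_eq hf hf1

theorem HasD.maurerCartan_comp {f : M₁ → G} {p : M₁} {f' : E₁ →L[ℝ] E}
    (hf : HasD I₁ 𝓘(ℝ, E) f p f') :
    HasD I₁ 𝓘(ℝ, E) (fun q => (f p)⁻¹ * f q) p ((maurerCartan (f p)).comp f') :=
  (hasD_maurerCartan (f p)).comp hf

theorem Ad_one : Ad (1 : G) = ContinuousLinearMap.id ℝ E := by
  have := hasD_Ad (E := E) (1 : G)
  simp only [one_mul, inv_one, mul_one] at this
  exact this.unique (hasD_id 1)

theorem Ad_mul (x y : G) : Ad (x * y) = (Ad x).comp (Ad y : E →L[ℝ] E) := by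
  have := (hasD_Ad (E := E) y).conj_of_eq_one x (by simp)
  refine (hasD_Ad (x * y)).unique ?_
  convert this using 2
  simp [mul_assoc]

end LieGroups

/-! ### The derivative of Ad is the Lie bracket -/

section LocalGroup

variable {E : Type*} [NormedAddCommGroup E] [NormedSpace ℝ E]

/-- In a local group with multiplication `m` and conjugation `F`, the derivative of the adjoint
action is the bracket of the left invariant vector fields. -/
theorem hasFDerivAt_adjoint_of_local {m F : E × E → E} {e : E} {A : E → E →L[ℝ] E}
    {V : E → E → E}
    (hm : ContDiffAt ℝ 2 m (e, e)) (hF : ContDiffAt ℝ 2 F (e, e))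
    (hm1 : ∀ᶠ a in 𝓝 e, m (a, e) = a) (hm2 : ∀ᶠ a in 𝓝 e, m (e, a) = a)
    (hF1 : ∀ᶠ a in 𝓝 e, F (a, e) = e) (hF2 : ∀ᶠ a in 𝓝 e, F (e, a) = a)
    (hmF : ∀ᶠ q in 𝓝 (e, e), m (F q, q.1) = m q)
    (hA : ∀ᶠ a in 𝓝 e, HasFDerivAt (fun w => F (a, w)) (A a) e)
    (hV : ∀ Z, ∀ᶠ a in 𝓝 e, V Z a = fderiv ℝ m (a, e) (0, Z)) :
    ∃ ad : E →L[ℝ] E →L[ℝ] E, HasFDerivAt A ad e ∧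
      ∀ Y Z, ad Y Z = VectorField.lieBracket ℝ (V Y) (V Z) e := by
  set inr := ContinuousLinearMap.inr ℝ E E
  set inl := ContinuousLinearMap.inl ℝ E E
  have hmd : ∀ᶠ q in 𝓝 (e, e), DifferentiableAt ℝ m q :=
    (hm.eventually (by simp)).mono fun q hq => hq.differentiableAt (by simp)
  have hFd : ∀ᶠ q in 𝓝 (e, e), DifferentiableAt ℝ F q :=
    (hF.eventually (by simp)).mono fun q hq => hq.differentiableAt (by simp)
  have hDm : DifferentiableAt ℝ (fderiv ℝ m) (e, e) :=
    (hm.fderiv_right (m := 1) (by norm_num)).differentiableAt (by simp)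
  have hDF : DifferentiableAt ℝ (fderiv ℝ F) (e, e) :=
    (hF.fderiv_right (m := 1) (by norm_num)).differentiableAt (by simp)
  have c1 : Filter.Tendsto (fun a : E => (a, e)) (𝓝 e) (𝓝 (e, e)) :=
    (Continuous.prodMk_left e).continuousAt.tendsto
  have c2 : Filter.Tendsto (fun a : E => (e, a)) (𝓝 e) (𝓝 (e, e)) :=
    (Continuous.prodMk_right e).continuousAt.tendsto
  have d1 (a : E) : HasFDerivAt (fun a : E => (a, e)) inl a := hasFDerivAt_prodMk_left a e
  have d2 (a b : E) : HasFDerivAt (fun b : E => (a, b)) inr b := hasFDerivAt_prodMk_right a b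
  -- the adjoint action
  have hA' : A =ᶠ[𝓝 e] fun a => (fderiv ℝ F (a, e)).comp inr := by
    filter_upwards [hA, c1.eventually hFd] with a h1 h2
    exact h1.unique (h2.hasFDerivAt.comp e (d2 a e))
  have hAd : DifferentiableAt ℝ A e := by
    refine DifferentiableAt.congr_of_eventuallyEq ?_ hA'
    have : DifferentiableAt ℝ (fun a => fderiv ℝ F (a, e)) e :=
      DifferentiableAt.comp (g := fderiv ℝ F) e hDF (d1 e).differentiableAt
    exact this.clm_comp (differentiableAt_const _)
  refine ⟨fderiv ℝ A e, hAd.hasFDerivAt, fun Y Z => ?_⟩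
  have hAe : A e = .id ℝ E := by
    have h := hA.self_of_nhds
    exact h.unique ((hasFDerivAt_id e).congr_of_eventuallyEq hF2)
  set D2 := fderiv ℝ (fderiv ℝ m) (e, e)
  have hsymm : ∀ v w, D2 v w = D2 w v := (hm.isSymmSndFDerivAt (by simp)).eq
  have hDml : ∀ v, fderiv ℝ m (e, e) (v, 0) = v := by
    have h := HasFDerivAt.comp (g := m) (f := fun a => (a, e)) e hmd.self_of_nhds.hasFDerivAt (d1 e)
    have h' := h.unique ((hasFDerivAt_id e).congr_of_eventuallyEq hm1)
    intro v; exact DFunLike.congr_fun h' v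
  have hDmr : ∀ v, fderiv ℝ m (e, e) (0, v) = v := by
    have h := HasFDerivAt.comp (g := m) e hmd.self_of_nhds.hasFDerivAt (d2 e e)
    have h' := h.unique ((hasFDerivAt_id e).congr_of_eventuallyEq hm2)
    intro v; exact DFunLike.congr_fun h' v
  -- the derivative of the left invariant vector fields
  have hVd (Z W : E) : fderiv ℝ (V Z) e W = D2 (W, 0) (0, Z) := by
    have h1 : HasFDerivAt (fun a => fderiv ℝ m (a, e)) (D2.comp inl) e :=
      HasFDerivAt.comp (g := fderiv ℝ m) e hDm.hasFDerivAt (d1 e)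
    have h2 := h1.clm_apply (hasFDerivAt_const ((0, Z) : E × E) e)
    rw [(h2.congr_of_eventuallyEq (hV Z)).fderiv]
    simp [inl]
  have hVe (Z : E) : V Z e = Z := by rw [(hV Z).self_of_nhds, hDmr]
  simp only [VectorField.lieBracket_eq, hVe, hVd]
  -- differentiate the conjugation identity
  have key : ∀ᶠ a in 𝓝 e, fderiv ℝ m (e, a) (A a Z, 0) = fderiv ℝ m (a, e) (0, Z) := by
    filter_upwards [hmF.curry_nhds, hA, hF1, c1.eventually hmd, c2.eventually hmd]
      with a h1 h2 h3 h4 h5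
    have l : HasFDerivAt (fun w => m (a, w)) ((fderiv ℝ m (a, e)).comp inr) e :=
      h4.hasFDerivAt.comp e (d2 a e)
    have r : HasFDerivAt (fun w => m (F (a, w), a))
        ((fderiv ℝ m (e, a)).comp ((A a).prod 0)) e := by
      have h6 := h2.prodMk (hasFDerivAt_const a e)
      rw [← h3] at h5
      have := HasFDerivAt.comp (g := m) (f := fun w => (F (a, w), a)) e h5.hasFDerivAt h6
      rwa [h3] at this
    have := l.unique (r.congr_of_eventuallyEq (h1.mono fun w hw => hw.symm))
    simpa [inr] using (DFunLike.congr_fun this Z).symm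
  have h1 : HasFDerivAt (fun a => fderiv ℝ m (a, e)) (D2.comp inl) e :=
    HasFDerivAt.comp (g := fderiv ℝ m) e hDm.hasFDerivAt (d1 e)
  have h2 : HasFDerivAt (fun a => fderiv ℝ m (e, a)) (D2.comp inr) e :=
    HasFDerivAt.comp (g := fderiv ℝ m) e hDm.hasFDerivAt (d2 e e)
  have h3 := (hAd.hasFDerivAt.clm_apply (hasFDerivAt_const Z e)).prodMk
    (hasFDerivAt_const (0 : E) e)
  have h4 := h2.clm_apply h3
  have h5 := h1.clm_apply (hasFDerivAt_const ((0, Z) : E × E) e)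
  have h6 := DFunLike.congr_fun (h4.unique (h5.congr_of_eventuallyEq key)) Y
  simp [inl, inr, hAe, hDml] at h6
  -- `h6` reads ad Y Z + D²m((0,Y),(Z,0)) = D²m((Y,0),(0,Z)). Symmetry of D²m turns this into the
  -- coordinate formula for the bracket.
  rw [hsymm (Z, 0) (0, Y), ← h6]
  abel

end LocalGroup

section LieGroups

variable {E : Type*} [NormedAddCommGroup E] [NormedSpace ℝ E]
  {G : Type*} [TopologicalSpace G] [ChartedSpace E G] [Group G] [LieGroup 𝓘(ℝ, E) ∞ G]

variable (E G) in
/-- The multiplication of a Lie group in the chart at `1`. -/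
def chartMul (q : E × E) : E :=
  extChartAt 𝓘(ℝ, E) (1 : G)
    ((extChartAt 𝓘(ℝ, E) (1 : G)).symm q.1 * (extChartAt 𝓘(ℝ, E) (1 : G)).symm q.2)

variable (E G) in
/-- The conjugation of a Lie group in the chart at `1`. -/
def chartConj (q : E × E) : E :=
  extChartAt 𝓘(ℝ, E) (1 : G)
    ((extChartAt 𝓘(ℝ, E) (1 : G)).symm q.1 * (extChartAt 𝓘(ℝ, E) (1 : G)).symm q.2 *
      ((extChartAt 𝓘(ℝ, E) (1 : G)).symm q.1)⁻¹)

theorem contMDiffAt_extChartAt_symm {M : Type*} [TopologicalSpace M] [ChartedSpace E M]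
    [IsManifold 𝓘(ℝ, E) ∞ M] (x : M) {y : E} (hy : y ∈ (extChartAt 𝓘(ℝ, E) x).target) :
    ContMDiffAt 𝓘(ℝ, E) 𝓘(ℝ, E) ∞ (extChartAt 𝓘(ℝ, E) x).symm y :=
  (contMDiffOn_extChartAt_symm x).contMDiffAt (extChartAt_target_mem_nhds' hy)

theorem contMDiffAt_chart_symm_comp {V : Type*} [NormedAddCommGroup V] [NormedSpace ℝ V]
    {f : V → E} {v : V} (hf : ContDiffAt ℝ ∞ f v) (hv : f v = extChartAt 𝓘(ℝ, E) (1 : G) 1) :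
    ContMDiffAt 𝓘(ℝ, V) 𝓘(ℝ, E) ∞ (fun w => (extChartAt 𝓘(ℝ, E) (1 : G)).symm (f w)) v :=
  ContMDiffAt.comp (g := (extChartAt 𝓘(ℝ, E) (1 : G)).symm) v
    (contMDiffAt_extChartAt_symm 1 (by rw [hv]; simp)) hf.contMDiffAt

theorem contDiffAt_chart_comp {V : Type*} [NormedAddCommGroup V] [NormedSpace ℝ V]
    {f : V → G} {v : V} (hf : ContMDiffAt 𝓘(ℝ, V) 𝓘(ℝ, E) ∞ f v) (hv : f v = 1) :
    ContDiffAt ℝ ∞ (fun w => extChartAt 𝓘(ℝ, E) (1 : G) (f w)) v := by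
  rw [← contMDiffAt_iff_contDiffAt]
  refine ContMDiffAt.comp (g := extChartAt 𝓘(ℝ, E) (1 : G)) v ?_ hf
  rw [hv]
  exact contMDiffAt_extChartAt

theorem chart_symm_one : (extChartAt 𝓘(ℝ, E) (1 : G)).symm (extChartAt 𝓘(ℝ, E) (1 : G) 1) = 1 :=
  extChartAt_to_inv (I := 𝓘(ℝ, E)) (1 : G)

theorem contDiffAt_chartMul : ContDiffAt ℝ ∞ (chartMul E G)
    (extChartAt 𝓘(ℝ, E) (1 : G) 1, extChartAt 𝓘(ℝ, E) (1 : G) 1) :=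
  contDiffAt_chart_comp
    ((contMDiffAt_chart_symm_comp contDiffAt_fst rfl).mul
      (contMDiffAt_chart_symm_comp contDiffAt_snd rfl)) (by simp)

theorem contDiffAt_chartConj : ContDiffAt ℝ ∞ (chartConj E G)
    (extChartAt 𝓘(ℝ, E) (1 : G) 1, extChartAt 𝓘(ℝ, E) (1 : G) 1) :=
  contDiffAt_chart_comp
    (((contMDiffAt_chart_symm_comp contDiffAt_fst rfl).mul
      (contMDiffAt_chart_symm_comp contDiffAt_snd rfl)).mul
      (contMDiffAt_chart_symm_comp contDiffAt_fst rfl).inv) (by simp)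

theorem hasD_chart_symm : HasD 𝓘(ℝ, E) 𝓘(ℝ, E) (extChartAt 𝓘(ℝ, E) (1 : G)).symm
    (extChartAt 𝓘(ℝ, E) (1 : G) 1) (.id ℝ E) := by
  rw [hasD_from_space_iff]
  refine ⟨(contMDiffAt_chart_symm_comp contDiffAt_id rfl).continuousAt, ?_⟩
  rw [chart_symm_one]
  refine (hasFDerivAt_id _).congr_of_eventuallyEq ?_
  filter_upwards [extChartAt_target_mem_nhds (I := 𝓘(ℝ, E)) (1 : G)] with w hw
  exact (extChartAt 𝓘(ℝ, E) (1 : G)).right_inv hw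

theorem hasD_chart : HasD 𝓘(ℝ, E) 𝓘(ℝ, E) (extChartAt 𝓘(ℝ, E) (1 : G)) (1 : G) (.id ℝ E) := by
  rw [hasD_to_space_iff]
  refine ⟨continuousAt_extChartAt _, ?_⟩
  refine (hasFDerivAt_id _).congr_of_eventuallyEq ?_
  filter_upwards [extChartAt_target_mem_nhds (I := 𝓘(ℝ, E)) (1 : G)] with w hw
  exact (extChartAt 𝓘(ℝ, E) (1 : G)).right_inv hw

variable (G) in
/-- The left invariant vector field with value `Z` at `1`, in the chart at `1`. -/
def chartLeftInv (Z : E) (a : E) : E :=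
  VectorField.mpullbackWithin 𝓘(ℝ, E) 𝓘(ℝ, E) (extChartAt 𝓘(ℝ, E) (1 : G)).symm
    (mulInvariantVectorField (I := 𝓘(ℝ, E)) (G := G) Z) (Set.range 𝓘(ℝ, E)) a

/-- Pulling back by the inverse chart applies the derivative of the chart. By the chain rule the
result is the derivative of `b ↦ a·b` in coordinates, since the chart at `1` has derivative the
identity there. -/
theorem pullback_leftInv {a : E} (ha : a ∈ (extChartAt 𝓘(ℝ, E) (1 : G)).target)
    (hd : DifferentiableAt ℝ (chartMul E G) (a, extChartAt 𝓘(ℝ, E) (1 : G) 1)) (Z : E) :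
    chartLeftInv G Z a = fderiv ℝ (chartMul E G) (a, extChartAt 𝓘(ℝ, E) (1 : G) 1) (0, Z) := by
  have : IsManifold 𝓘(ℝ, E) 1 G := IsManifold.of_le (n := ∞) (by norm_cast)
  set x := (extChartAt 𝓘(ℝ, E) (1 : G)).symm a
  have hx : x ∈ (chartAt E (1 : G)).source := by
    rw [← extChartAt_source (I := 𝓘(ℝ, E))]
    exact (extChartAt 𝓘(ℝ, E) (1 : G)).map_target ha
  have hi : ((mfderivWithin 𝓘(ℝ, E) 𝓘(ℝ, E) (extChartAt 𝓘(ℝ, E) (1 : G)).symm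
      (Set.range 𝓘(ℝ, E)) a).inverse : E →L[ℝ] E) =
      mfderiv 𝓘(ℝ, E) 𝓘(ℝ, E) (extChartAt 𝓘(ℝ, E) (1 : G)) x :=
    ContinuousLinearMap.inverse_eq
      (mfderivWithin_extChartAt_symm_comp_mfderiv_extChartAt ha)
      (mfderiv_extChartAt_comp_mfderivWithin_extChartAt_symm ha)
  have h1 := hasD_mfderiv (mdifferentiableAt_extChartAt (I := 𝓘(ℝ, E)) hx)
  have h2 := (hasD_leftInv (E := E) x).comp_of_eq hasD_chart_symm chart_symm_one
  have h3 := h1.comp_of_eq h2 (by rw [chart_symm_one, mul_one])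
  rw [hasD_iff_hasFDerivAt] at h3
  have h4 := HasFDerivAt.comp (g := chartMul E G) _ hd.hasFDerivAt
    (hasFDerivAt_prodMk_right (𝕜 := ℝ) a (extChartAt 𝓘(ℝ, E) (1 : G) 1))
  have h5 := DFunLike.congr_fun (h3.unique h4) Z
  have h6 := DFunLike.congr_fun hi (leftInv x Z)
  exact h6.trans h5

/-- The manifold bracket is by definition a vector space bracket in the chart at `1`, transported
back by the derivative of that chart, which is the identity at `1`. -/
theorem lieBr_eq_lieBracket (Y Z : E) :
    lieBr G Y Z = VectorField.lieBracket ℝ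
      (fun a => fderiv ℝ (chartMul E G) (a, extChartAt 𝓘(ℝ, E) (1 : G) 1) (0, Y))
      (fun a => fderiv ℝ (chartMul E G) (a, extChartAt 𝓘(ℝ, E) (1 : G) 1) (0, Z))
      (extChartAt 𝓘(ℝ, E) (1 : G) 1) := by
  have : IsManifold 𝓘(ℝ, E) 1 G := IsManifold.of_le (n := ∞) (by norm_cast)
  have c1 : Filter.Tendsto (fun a : E => (a, extChartAt 𝓘(ℝ, E) (1 : G) 1))
      (𝓝 (extChartAt 𝓘(ℝ, E) (1 : G) 1)) (𝓝 (_, _)) :=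
    (Continuous.prodMk_left _).continuousAt.tendsto
  have hd := c1.eventually ((contDiffAt_chartMul (E := E) (G := G)).of_le
    (m := 1) (by norm_cast) |>.eventually (by simp))
  have hV (Z : E) : chartLeftInv G Z =ᶠ[𝓝 (extChartAt 𝓘(ℝ, E) (1 : G) 1)]
      fun a => fderiv ℝ (chartMul E G) (a, extChartAt 𝓘(ℝ, E) (1 : G) 1) (0, Z) := by
    filter_upwards [hd, extChartAt_target_mem_nhds (I := 𝓘(ℝ, E)) (1 : G)] with a h1 h2
    exact pullback_leftInv h2 (h1.differentiableAt (by simp)) Z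
  rw [← (hV Y).lieBracket_vectorField_eq (hV Z)]
  have h0 : Set.univ ∩ Set.range 𝓘(ℝ, E) = (Set.univ : Set E) := by simp
  obtain ⟨D, hD⟩ : ∃ D : E →L[ℝ] E,
      D = mfderiv 𝓘(ℝ, E) 𝓘(ℝ, E) (extChartAt 𝓘(ℝ, E) (1 : G)) 1 := ⟨_, rfl⟩
  have hDi : D = .id ℝ E := hD.trans (hasD_chart (E := E) (G := G)).mfderiv_eq
  have h1 : lieBr G Y Z = D.inverse (VectorField.lieBracketWithin ℝ (E := E)
      (chartLeftInv G Y) (chartLeftInv G Z)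
      (Set.univ ∩ Set.range 𝓘(ℝ, E)) (extChartAt 𝓘(ℝ, E) (1 : G) 1)) := by
    rw [hD]; rfl
  rw [h1, h0, VectorField.lieBracketWithin_univ, hDi,
    ContinuousLinearMap.inverse_id]
  rfl

/-- The adjoint action is differentiable at `1`, with the Lie bracket as derivative. -/
theorem exists_hasD_Ad : ∃ ad : E →L[ℝ] E →L[ℝ] E,
    HasD 𝓘(ℝ, E) 𝓘(ℝ, E →L[ℝ] E) (fun x : G => (Ad x : E →L[ℝ] E)) 1 ad ∧
      ∀ Y Z, ad Y Z = lieBr G Y Z := by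
  set e := extChartAt 𝓘(ℝ, E) (1 : G) 1 with he
  set ψ := (extChartAt 𝓘(ℝ, E) (1 : G)).symm with hψ
  have hψe : ψ e = 1 := chart_symm_one
  have hψc : ContinuousAt ψ e := (contMDiffAt_chart_symm_comp contDiffAt_id rfl).continuousAt
  have htarget := extChartAt_target_mem_nhds (I := 𝓘(ℝ, E)) (1 : G)
  have hinv : ∀ᶠ a in 𝓝 e, extChartAt 𝓘(ℝ, E) (1 : G) (ψ a) = a := by
    filter_upwards [htarget] with a ha
    exact (extChartAt 𝓘(ℝ, E) (1 : G)).right_inv ha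
  have hA : ∀ a, HasFDerivAt (fun w => chartConj E G (a, w)) (Ad (ψ a) : E →L[ℝ] E) e := by
    intro a
    have h1 := (hasD_Ad (E := E) (ψ a)).comp_of_eq hasD_chart_symm chart_symm_one
    have h2 := (hasD_chart (E := E) (G := G)).comp_of_eq h1 (by simp)
    exact hasD_iff_hasFDerivAt.1 h2
  obtain ⟨ad, h1, h2⟩ := hasFDerivAt_adjoint_of_local (m := chartMul E G) (F := chartConj E G)
    (e := e) (A := fun a => Ad (ψ a))
    (V := fun Z a => fderiv ℝ (chartMul E G) (a, e) (0, Z))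
    (contDiffAt_chartMul.of_le (by norm_cast))
    (contDiffAt_chartConj.of_le (by norm_cast))
    (by filter_upwards [hinv] with a ha; simp only [chartMul, ← hψ, hψe, ha, mul_one])
    (by filter_upwards [hinv] with a ha; simp only [chartMul, ← hψ, hψe, ha, one_mul])
    (by filter_upwards [hinv] with a ha; simp only [chartConj, ← hψ, hψe, ← he, mul_one, mul_inv_cancel])
    (by filter_upwards [hinv] with a ha; simp only [chartConj, ← hψ, hψe, ha, mul_one, one_mul, inv_one])
    (by
      -- The relation `(x y x⁻¹) x = x y` is visible in the chart only where `x y x⁻¹` stays in its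
      -- source, which continuity ensures near `(e, e)`.
      have hc : ContinuousAt (fun q : E × E => ψ q.1 * ψ q.2 * (ψ q.1)⁻¹) (e, e) :=
        (((contMDiffAt_chart_symm_comp contDiffAt_fst rfl).mul
          (contMDiffAt_chart_symm_comp contDiffAt_snd rfl)).mul
          (contMDiffAt_chart_symm_comp contDiffAt_fst rfl).inv :
            ContMDiffAt 𝓘(ℝ, E × E) 𝓘(ℝ, E) ∞ _ _).continuousAt
      have hs : (extChartAt 𝓘(ℝ, E) (1 : G)).source ∈ 𝓝 (ψ e * ψ e * (ψ e)⁻¹) := by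
        simpa [hψe] using extChartAt_source_mem_nhds (I := 𝓘(ℝ, E)) (1 : G)
      filter_upwards [hc.preimage_mem_nhds hs] with q hq
      have h3 : ψ (chartConj E G q) = ψ q.1 * ψ q.2 * (ψ q.1)⁻¹ :=
        (extChartAt 𝓘(ℝ, E) (1 : G)).left_inv hq
      simp only [chartMul, ← hψ, h3, inv_mul_cancel_right])
    (Filter.Eventually.of_forall hA)
    (fun Z => Filter.Eventually.of_forall fun a => rfl)
  refine ⟨ad, ?_, fun Y Z => ?_⟩
  · rw [hasD_to_space_iff]
    refine ⟨?_, h1⟩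
    have h4 : ContinuousAt (fun a => (Ad (ψ a) : E →L[ℝ] E))
        (extChartAt 𝓘(ℝ, E) (1 : G) 1) := h1.continuousAt
    have h5 := ContinuousAt.comp (f := extChartAt 𝓘(ℝ, E) (1 : G)) (x := 1) h4
      (continuousAt_extChartAt (I := 𝓘(ℝ, E)) (1 : G))
    refine h5.congr ?_
    filter_upwards [extChartAt_source_mem_nhds (I := 𝓘(ℝ, E)) (1 : G)] with x hx
    simp only [Function.comp_apply, hψ]
    rw [(extChartAt 𝓘(ℝ, E) (1 : G)).left_inv hx]
  · rw [h2, lieBr_eq_lieBracket]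

end LieGroups

/-! ### Homomorphisms, the Jacobi identity, one-parameter subgroups -/

section LieGroups

variable {E : Type*} [NormedAddCommGroup E] [NormedSpace ℝ E]
  {G : Type*} [TopologicalSpace G] [ChartedSpace E G] [Group G] [LieGroup 𝓘(ℝ, E) ∞ G]
  {E' : Type*} [NormedAddCommGroup E'] [NormedSpace ℝ E']
  {G' : Type*} [TopologicalSpace G'] [ChartedSpace E' G'] [Group G'] [LieGroup 𝓘(ℝ, E') ∞ G']

variable (E G) in
/-- The adjoint representation of the Lie algebra, as a continuous bilinear map. -/
def adL : E →L[ℝ] E →L[ℝ] E := (exists_hasD_Ad (E := E) (G := G)).choose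

theorem hasD_Ad_adL : HasD 𝓘(ℝ, E) 𝓘(ℝ, E →L[ℝ] E) (fun x : G => (Ad x : E →L[ℝ] E)) 1 (adL E G) :=
  (exists_hasD_Ad (E := E) (G := G)).choose_spec.1

theorem adL_apply (Y Z : E) : adL E G Y Z = lieBr G Y Z :=
  (exists_hasD_Ad (E := E) (G := G)).choose_spec.2 Y Z

theorem lieBr_skew (Y Z : E) : lieBr G Y Z = -lieBr G Z Y := by
  rw [lieBr_eq_lieBracket, lieBr_eq_lieBracket, VectorField.lieBracket_swap]

theorem Ad_hom_comp (f : G →* G') {L : E →L[ℝ] E'} (hf : HasD 𝓘(ℝ, E) 𝓘(ℝ, E') f 1 L) (x : G) :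
    L.comp (Ad x) = (Ad (f x)).comp L := by
  have h1 := hf.comp_of_eq (hasD_Ad (E := E) x) (by simp)
  have h2 := hf.conj_of_eq_one (f x) (map_one f)
  simp only [map_mul, map_inv] at h1
  exact h1.unique h2

/-- The differential of a homomorphism of Lie groups is a homomorphism of Lie algebras. -/
theorem map_lieBr (f : G →* G') {L : E →L[ℝ] E'} (hf : HasD 𝓘(ℝ, E) 𝓘(ℝ, E') f 1 L) (Y Z : E) :
    L (lieBr G Y Z) = lieBr G' (L Y) (L Z) := by
  have hl : HasD 𝓘(ℝ, E) 𝓘(ℝ, E') (fun x : G => L ((Ad x : E →L[ℝ] E) Z)) 1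
      ((L.comp (ContinuousLinearMap.apply ℝ E Z)).comp (adL E G)) :=
    HasD.comp (g := fun T : E →L[ℝ] E => L (T Z))
      (hasD_iff_hasFDerivAt.2 (L.comp (ContinuousLinearMap.apply ℝ E Z)).hasFDerivAt) hasD_Ad_adL
  have hr : HasD 𝓘(ℝ, E) 𝓘(ℝ, E') (fun x : G => (Ad (f x) : E' →L[ℝ] E') (L Z)) 1
      ((ContinuousLinearMap.apply ℝ E' (L Z)).comp ((adL E' G').comp L)) :=
    HasD.comp (g := fun T : E' →L[ℝ] E' => T (L Z))
      (hasD_iff_hasFDerivAt.2 (ContinuousLinearMap.apply ℝ E' (L Z)).hasFDerivAt)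
      (hasD_Ad_adL.comp_of_eq hf (map_one f))
  have h : (fun x : G => L ((Ad x : E →L[ℝ] E) Z)) =
      fun x : G => (Ad (f x) : E' →L[ℝ] E') (L Z) :=
    funext fun x => DFunLike.congr_fun (Ad_hom_comp f hf x) Z
  rw [h] at hl
  have := DFunLike.congr_fun (hl.unique hr) Y
  simpa [adL_apply] using this

theorem Ad_lieBr (x : G) (Y Z : E) : Ad x (lieBr G Y Z) = lieBr G (Ad x Y) (Ad x Z) :=
  map_lieBr (MulAut.conj x).toMonoidHom (hasD_Ad x) Y Z

/-- Each `Ad x` is an automorphism of the bracket; differentiating `Ad x [Y, Z] = [Ad x Y, Ad x Z]`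
at `x = 1` in the direction `W` shows that `ad W` is a derivation. -/
theorem lieBr_jacobi (W Y Z : E) :
    lieBr G W (lieBr G Y Z) = lieBr G (lieBr G W Y) Z + lieBr G Y (lieBr G W Z) := by
  have hA := (hasD_to_space_iff.1 (hasD_Ad_adL (E := E) (G := G))).2
  have hY := hA.clm_apply (hasFDerivAt_const Y _)
  have hZ := hA.clm_apply (hasFDerivAt_const Z _)
  have hr := ((adL E G).hasFDerivAt.comp _ hY).clm_apply hZ
  have hl := hA.clm_apply (hasFDerivAt_const (lieBr G Y Z) _)
  have h : (fun w : E => (Ad ((extChartAt 𝓘(ℝ, E) (1 : G)).symm w) : E →L[ℝ] E) (lieBr G Y Z)) =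
      fun w : E => adL E G ((Ad ((extChartAt 𝓘(ℝ, E) (1 : G)).symm w) : E →L[ℝ] E) Y)
        ((Ad ((extChartAt 𝓘(ℝ, E) (1 : G)).symm w) : E →L[ℝ] E) Z) :=
    funext fun w => by rw [Ad_lieBr, adL_apply]
  rw [h] at hl
  have h0 : (Ad ((extChartAt 𝓘(ℝ, E) (1 : G)).symm (extChartAt 𝓘(ℝ, E) (1 : G) 1)) : E →L[ℝ] E) =
      .id ℝ E := by rw [chart_symm_one, Ad_one]
  have := DFunLike.congr_fun (hl.unique hr) W
  simp only [add_apply, ContinuousLinearMap.comp_apply, ContinuousLinearMap.flip_apply, h0,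
    ContinuousLinearMap.id_apply, adL_apply, Function.comp_apply, zero_apply, map_zero,
    zero_add] at this
  rw [this, add_comm]

theorem IsOneParam.hasD {γ : ℝ → G} {Z : E} (h : IsOneParam γ Z) :
    HasD 𝓘(ℝ, ℝ) 𝓘(ℝ, E) γ 0 (ContinuousLinearMap.toSpanSingleton ℝ Z) := h.2

theorem IsOneParam.map_zero {γ : ℝ → G} {Z : E} (h : IsOneParam γ Z) : γ 0 = 1 := by
  have := h.1 0 0
  simpa using this

theorem IsOneParam.map_neg {γ : ℝ → G} {Z : E} (h : IsOneParam γ Z) (t : ℝ) :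
    γ (-t) = (γ t)⁻¹ := by
  have := h.1 (-t) t
  rw [neg_add_cancel, h.map_zero] at this
  exact eq_inv_of_mul_eq_one_left this.symm

/-- Writing `Ad (γ τ) = Ad (γ (τ - t)) ∘ Ad (γ t)` moves the differentiation to the identity, where
the derivative of `Ad` is known. -/
theorem IsOneParam.hasDerivAt_Ad {γ : ℝ → G} {Z : E} (h : IsOneParam γ Z) (v : E) (t : ℝ) :
    HasDerivAt (fun t => (Ad (γ t) : E →L[ℝ] E) v) (lieBr G Z (Ad (γ t) v)) t := by
  have happ (V : E) : HasD 𝓘(ℝ, E) 𝓘(ℝ, E) (fun x : G => (Ad x : E →L[ℝ] E) V) 1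
      ((ContinuousLinearMap.apply ℝ E V).comp (adL E G)) :=
    HasD.comp (g := fun T : E →L[ℝ] E => T V)
      (hasD_iff_hasFDerivAt.2 (ContinuousLinearMap.apply ℝ E V).hasFDerivAt) hasD_Ad_adL
  have h1 := (happ (Ad (γ t) v)).comp_of_eq h.hasD h.map_zero
  have h2 : HasD 𝓘(ℝ, ℝ) 𝓘(ℝ, ℝ) (fun τ : ℝ => τ - t) t (.id ℝ ℝ) :=
    hasD_iff_hasFDerivAt.2 ((hasFDerivAt_id t).sub_const t)
  have h3 := hasD_iff_hasFDerivAt.1 (h1.comp_of_eq h2 (sub_self t))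
  have h4 : (fun τ => (Ad (γ (τ - t)) : E →L[ℝ] E) (Ad (γ t) v)) = fun τ => Ad (γ τ) v := by
    funext τ
    have := DFunLike.congr_fun (Ad_mul (E := E) (γ (τ - t)) (γ t)) v
    rw [← h.1, sub_add_cancel] at this
    exact this.symm
  rw [h4] at h3
  simpa [adL_apply] using h3.hasDerivAt

theorem IsOneParam.hasD_at {γ : ℝ → G} {Z : E} (h : IsOneParam γ Z) (t : ℝ) :
    HasD 𝓘(ℝ, ℝ) 𝓘(ℝ, E) γ t (ContinuousLinearMap.toSpanSingleton ℝ (leftInv (γ t) Z)) := by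
  have h2 : HasD 𝓘(ℝ, ℝ) 𝓘(ℝ, ℝ) (fun τ : ℝ => τ - t) t (.id ℝ ℝ) :=
    hasD_iff_hasFDerivAt.2 ((hasFDerivAt_id t).sub_const t)
  obtain ⟨L, hL, hLe⟩ : ∃ L : E →L[ℝ] E, HasD 𝓘(ℝ, E) 𝓘(ℝ, E) (fun y : G => γ t * y) 1 L ∧
      leftInv (γ t) Z = L Z := ⟨_, hasD_leftInv _, rfl⟩
  have h3 := hL.comp_of_eq
    (h.hasD.comp_of_eq h2 (sub_self t)) (by simp [h.map_zero])
  have h4 : (fun τ => γ t * γ (τ - t)) = γ := by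
    funext τ; rw [← h.1]; congr 1; ring
  rw [h4] at h3
  convert h3 using 1
  ext
  simp [hLe]

theorem IsOneParam.isMIntegralCurve {γ : ℝ → G} {Z : E} (h : IsOneParam γ Z) :
    IsMIntegralCurve γ (mulInvariantVectorField (I := 𝓘(ℝ, E)) (G := G) Z) := by
  intro t
  have h1 := h.hasD_at t
  have h2 : ContinuousLinearMap.toSpanSingleton ℝ (leftInv (γ t) Z) =
      (1 : ℝ →L[ℝ] ℝ).smulRight (leftInv (γ t) Z) := by ext; simp
  rw [h2] at h1
  exact h1

/-- Both curves are integral curves of the same smooth left invariant field through `1`. This is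
what makes the choice inside `lieExp` harmless. -/
theorem IsOneParam.unique [T2Space G] [CompleteSpace E] {γ γ' : ℝ → G} {Z : E}
    (h : IsOneParam γ Z) (h' : IsOneParam γ' Z) : γ = γ' := by
  have : LieGroup 𝓘(ℝ, E) (minSmoothness ℝ 3) G :=
    LieGroup.of_le (n := ∞) (by simp; norm_cast)
  have : IsManifold 𝓘(ℝ, E) 1 G := IsManifold.of_le (n := ∞) (by norm_cast)
  refine isMIntegralCurve_Ioo_eq_of_contMDiff_boundaryless (t₀ := 0) (I := 𝓘(ℝ, E)) ?_
    h.isMIntegralCurve h'.isMIntegralCurve (h.map_zero.trans h'.map_zero.symm)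
  exact (contMDiff_mulInvariantVectorField (I := 𝓘(ℝ, E)) (G := G) Z).of_le (by simp)

theorem IsOneParam.comp_mul {γ : ℝ → G} {Z : E} (h : IsOneParam γ Z) (t : ℝ) :
    IsOneParam (fun r => γ (r * t)) (t • Z) := by
  refine ⟨fun a b => by simp only [add_mul, h.1], ?_⟩
  have h1 : HasD 𝓘(ℝ, ℝ) 𝓘(ℝ, ℝ) (fun r : ℝ => r * t) 0
      (ContinuousLinearMap.toSpanSingleton ℝ t) :=
    hasD_iff_hasFDerivAt.2 (((hasDerivAt_id (0 : ℝ)).mul_const t).hasFDerivAt.congr_fderiv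
      (by ext; simp))
  have h2 := h.hasD.comp_of_eq h1 (zero_mul t)
  have h3 : (ContinuousLinearMap.toSpanSingleton ℝ Z).comp
      (ContinuousLinearMap.toSpanSingleton ℝ t) =
      (ContinuousLinearMap.toSpanSingleton ℝ (t • Z) : ℝ →L[ℝ] E) := by
    ext; simp
  rw [h3] at h2
  exact h2

theorem IsOneParam.lieExp_smul [T2Space G] [CompleteSpace E] {γ : ℝ → G} {Z : E}
    (h : IsOneParam γ Z) (t : ℝ) : lieExp G (t • Z) = γ t := by
  have hex : ∃ γ : ℝ → G, IsOneParam γ (t • Z) := ⟨_, h.comp_mul t⟩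
  have h1 := hex.choose_spec.unique (h.comp_mul t)
  rw [lieExp, dif_pos hex, h1]
  simp only [one_mul]

theorem isOneParam_one : IsOneParam (fun _ : ℝ => (1 : G)) (0 : E) := by
  refine ⟨fun _ _ => by simp, ?_⟩
  have := hasD_const (I₁ := 𝓘(ℝ, ℝ)) (I₂ := 𝓘(ℝ, E)) (1 : G) (0 : ℝ)
  have h3 : (ContinuousLinearMap.toSpanSingleton ℝ (0 : E)) = (0 : ℝ →L[ℝ] E) := by
    ext; simp
  rw [← h3] at this
  exact this

/-! ### The logarithmic derivative of the exponential map -/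

section Exponential

variable {V : Type*} [NormedAddCommGroup V] [NormedSpace ℝ V] {Ex : V → G} {j : V → E}

/-- The logarithmic derivative of the exponential map `Ex` along the line `ℝ Y`. -/
theorem exists_hasD_exp (hEx : ContMDiff 𝓘(ℝ, V) 𝓘(ℝ, E) ∞ Ex) (Y : V) :
    ∃ P : ℝ → V →L[ℝ] E,
      (∀ t, HasD 𝓘(ℝ, V) 𝓘(ℝ, E) (fun B => (Ex (t • Y))⁻¹ * Ex (t • Y + B)) 0 (P t)) ∧
      ContinuousAt P 0 := by
  have hsm : ContMDiff 𝓘(ℝ, ℝ × V) 𝓘(ℝ, E) ∞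
      (fun q : ℝ × V => (Ex (q.1 • Y))⁻¹ * Ex (q.1 • Y + q.2)) := by
    have h1 : ContDiff ℝ ∞ (fun q : ℝ × V => q.1 • Y) := by fun_prop
    have h2 : ContDiff ℝ ∞ (fun q : ℝ × V => q.1 • Y + q.2) := by fun_prop
    exact (hEx.comp h1.contMDiff).inv.mul (hEx.comp h2.contMDiff)
  have hc (t : ℝ) : ContDiffAt ℝ ∞ (fun q : ℝ × V => extChartAt 𝓘(ℝ, E) (1 : G)
      ((Ex (q.1 • Y))⁻¹ * Ex (q.1 • Y + q.2))) (t, 0) :=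
    contDiffAt_chart_comp hsm.contMDiffAt (by simp)
  have hP (t : ℝ) : ∃ L, HasD 𝓘(ℝ, V) 𝓘(ℝ, E)
      (fun B => (Ex (t • Y))⁻¹ * Ex (t • Y + B)) 0 L := by
    refine exists_hasD ?_
    have h3 : ContDiff ℝ ∞ (fun B : V => (t, B)) := by fun_prop
    exact ((hsm.comp h3.contMDiff) 0).mdifferentiableAt (by simp)
  choose P hP using hP
  refine ⟨P, hP, ?_⟩
  have hPe : P = fun t => (fderiv ℝ (fun q : ℝ × V => extChartAt 𝓘(ℝ, E) (1 : G)
      ((Ex (q.1 • Y))⁻¹ * Ex (q.1 • Y + q.2))) (t, 0)).comp (ContinuousLinearMap.inr ℝ ℝ V) := by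
    -- Read in the chart at `1`, `P t` is a partial derivative of a smooth function of `(t, B)`,
    -- hence continuous in `t`.
    funext t
    have h1 := hasD_iff_hasFDerivAt.1 ((hasD_chart (E := E) (G := G)).comp_of_eq (hP t) (by simp))
    rw [ContinuousLinearMap.id_comp] at h1
    exact h1.unique (HasFDerivAt.comp (f := fun B : V => (t, B)) (0 : V)
      ((hc t).differentiableAt (by simp)).hasFDerivAt (hasFDerivAt_prodMk_right t (0 : V)))
  rw [hPe]
  have h4 : ContinuousAt (fderiv ℝ (fun q : ℝ × V => extChartAt 𝓘(ℝ, E) (1 : G)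
      ((Ex (q.1 • Y))⁻¹ * Ex (q.1 • Y + q.2)))) (0, 0) :=
    ((hc 0).fderiv_right (m := 1) (by norm_cast)).continuousAt
  have h5 : ContinuousAt (fun t : ℝ => fderiv ℝ (fun q : ℝ × V => extChartAt 𝓘(ℝ, E) (1 : G)
      ((Ex (q.1 • Y))⁻¹ * Ex (q.1 • Y + q.2))) (t, 0)) 0 :=
    ContinuousAt.comp (f := fun t : ℝ => (t, (0 : V))) h4 (by fun_prop)
  exact h5.clm_comp continuousAt_const

/-- The formula for the derivative of the exponential map, as a differential equation for its
logarithmic derivative along a line. -/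
theorem exists_logDeriv_exp (hEx : ContMDiff 𝓘(ℝ, V) 𝓘(ℝ, E) ∞ Ex)
    (hj : ∀ Y, IsOneParam (fun t : ℝ => Ex (t • Y)) (j Y)) (Y : V) :
    ∃ P : ℝ → V →L[ℝ] E,
      (∀ t, HasD 𝓘(ℝ, V) 𝓘(ℝ, E) (fun B => (Ex (t • Y))⁻¹ * Ex (t • Y + B)) 0 (P t)) ∧
      ∀ A t, HasDerivAt (fun t => t • P t A) (Ad (Ex (t • Y))⁻¹ (j A)) t := by
  obtain ⟨P, hP, hPc⟩ := exists_hasD_exp hEx Y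
  refine ⟨P, hP, fun A t => ?_⟩
  have hadd (Z : V) (a b : ℝ) : Ex ((a + b) • Z) = Ex (a • Z) * Ex (b • Z) := (hj Z).1 a b
  have hEx0 : Ex 0 = 1 := by simpa using (hj 0).map_zero
  -- derivative along lines
  have hline (a : ℝ) : HasD 𝓘(ℝ, ℝ) 𝓘(ℝ, E)
      (fun u : ℝ => (Ex (a • Y))⁻¹ * Ex (a • (Y + u • A))) 0
      (ContinuousLinearMap.toSpanSingleton ℝ (a • P a A)) := by
    have h1 : HasD 𝓘(ℝ, ℝ) 𝓘(ℝ, V) (fun u : ℝ => u • a • A) 0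
        (ContinuousLinearMap.toSpanSingleton ℝ (a • A)) :=
      hasD_iff_hasFDerivAt.2 (ContinuousLinearMap.toSpanSingleton ℝ (a • A)).hasFDerivAt
    have h2 := (hP a).comp_of_eq h1 (zero_smul _ _)
    have h3 : (fun u : ℝ => (Ex (a • Y))⁻¹ * Ex (a • Y + u • a • A)) =
        fun u : ℝ => (Ex (a • Y))⁻¹ * Ex (a • (Y + u • A)) := by
      funext u; rw [smul_add, smul_comm]
    rw [h3] at h2
    convert h2 using 1
    ext; simp
  have hP0 : P 0 A = j A := by
    have h1 : HasD 𝓘(ℝ, ℝ) 𝓘(ℝ, V) (fun u : ℝ => u • A) 0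
        (ContinuousLinearMap.toSpanSingleton ℝ A) :=
      hasD_iff_hasFDerivAt.2 (ContinuousLinearMap.toSpanSingleton ℝ A).hasFDerivAt
    have h2 := (hP 0).comp_of_eq h1 (zero_smul _ _)
    simp only [zero_smul, hEx0, inv_one, one_mul, zero_add] at h2
    have h3 := DFunLike.congr_fun (h2.unique (hj A).hasD) 1
    simpa using h3
  -- Cocycle identity: e^{-(h+t)Y} e^{(h+t)(Y+uA)} is the conjugate by e^{-tY} of e^{-hY}
  -- e^{h(Y+uA)}, times e^{-tY} e^{t(Y+uA)}. It reduces differentiability at `t` to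
  -- differentiability at `0`.
  have hrec (h : ℝ) : (h + t) • P (h + t) A = Ad (Ex (t • Y))⁻¹ (h • P h A) + t • P t A := by
    have h1 := ((hline h).conj_of_eq_one (Ex (t • Y))⁻¹ (by simp)).mul_of_eq_one (hline t)
      (by simp) (by simp)
    have h2 : (fun u : ℝ => (Ex (t • Y))⁻¹ * ((Ex (h • Y))⁻¹ * Ex (h • (Y + u • A))) *
        (Ex (t • Y))⁻¹⁻¹ * ((Ex (t • Y))⁻¹ * Ex (t • (Y + u • A)))) =
        fun u : ℝ => (Ex ((h + t) • Y))⁻¹ * Ex ((h + t) • (Y + u • A)) := by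
      funext u
      rw [hadd, hadd]; group
    rw [h2] at h1
    have h3 := DFunLike.congr_fun ((hline (h + t)).unique h1) 1
    simpa using h3
  -- The difference quotient at `0` is `P h A` itself, so continuity of `P` at `0` is enough.
  have hd0 : HasDerivAt (fun h : ℝ => h • P h A) (j A) 0 := by
    rw [hasDerivAt_iff_tendsto_slope]
    have h1 : Filter.Tendsto (fun h => P h A) (𝓝[≠] 0) (𝓝 (j A)) := by
      rw [← hP0]
      exact ((hPc.clm_apply continuousAt_const).tendsto).mono_left nhdsWithin_le_nhds
    refine h1.congr' ?_
    filter_upwards [self_mem_nhdsWithin] with h hh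
    simp only [slope, sub_zero, zero_smul, vsub_eq_sub]
    rw [smul_smul, inv_mul_cancel₀ hh, one_smul]
  have hd1 := ((Ad (Ex (t • Y))⁻¹ : E →L[ℝ] E).hasFDerivAt.comp_hasDerivAt (0 : ℝ) hd0).add_const
    (t • P t A)
  have hd2 : HasDerivAt (fun h : ℝ => (h + t) • P (h + t) A) (Ad (Ex (t • Y))⁻¹ (j A)) 0 :=
    hd1.congr_of_eventuallyEq (Filter.Eventually.of_forall hrec)
  have hd3 := HasDerivAt.comp_sub_const (f := fun h : ℝ => (h + t) • P (h + t) A) t t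
    (by simpa using hd2)
  simpa using hd3

end Exponential

end LieGroups

/-! ### Complex linearity of Ad and of the bracket -/

section ComplexGroup

variable {𝔤 : Type*} [NormedAddCommGroup 𝔤] [NormedSpace ℂ 𝔤]
  {G : Type*} [TopologicalSpace G] [ChartedSpace 𝔤 G] [Group G]
  [LieGroup 𝓘(ℂ, 𝔤) ω G] [LieGroup 𝓘(ℝ, 𝔤) ∞ G]

theorem hasD_of_complex {f : G → G} {x : G} {L : 𝔤 →L[ℂ] 𝔤}
    (h : HasMFDerivAt 𝓘(ℂ, 𝔤) 𝓘(ℂ, 𝔤) f x L) :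
    HasD 𝓘(ℝ, 𝔤) 𝓘(ℝ, 𝔤) f x (L.restrictScalars ℝ) := by
  rw [hasD_iff_chart]
  refine ⟨h.1, ?_⟩
  have h2 := h.2
  have hr : Set.range 𝓘(ℂ, 𝔤) = Set.univ := by simp
  rw [hr] at h2
  have h3 : HasFDerivAt (𝕜 := ℂ) (writtenInExtChartAt 𝓘(ℂ, 𝔤) 𝓘(ℂ, 𝔤) x f) L
      (extChartAt 𝓘(ℂ, 𝔤) x x) := hasFDerivWithinAt_univ.1 h2
  exact h3.restrictScalars ℝ

/-- Conjugation is holomorphic, so its real derivative is the restriction of scalars of a complex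
linear map. -/
theorem Ad_smul_complex (x : G) (c : ℂ) (v : 𝔤) : Ad x (c • v) = c • (Ad x v : 𝔤) := by
  have h1 : MDifferentiableAt 𝓘(ℂ, 𝔤) 𝓘(ℂ, 𝔤) (fun y : G => x * y * x⁻¹) 1 :=
    (ContMDiff.mul (I := 𝓘(ℂ, 𝔤)) (n := ω) (contMDiff_mul_left (a := x))
      contMDiff_const).mdifferentiableAt (by simp)
  obtain ⟨L, hL⟩ : ∃ L : 𝔤 →L[ℂ] 𝔤, HasMFDerivAt 𝓘(ℂ, 𝔤) 𝓘(ℂ, 𝔤)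
      (fun y : G => x * y * x⁻¹) 1 L := ⟨_, h1.hasMFDerivAt⟩
  have h2 := (hasD_of_complex hL).unique (hasD_Ad x)
  rw [← h2]
  simp

theorem lieBr_smul_right (c : ℂ) (u v : 𝔤) : lieBr G u (c • v) = c • (lieBr G u v : 𝔤) := by
  have hA := (hasD_to_space_iff.1 (hasD_Ad_adL (E := 𝔤) (G := G))).2
  have h1 := hA.clm_apply (hasFDerivAt_const (c • v) _)
  have h2 := (hA.clm_apply (hasFDerivAt_const v _)).const_smul c
  have h : (fun w : 𝔤 => (Ad ((extChartAt 𝓘(ℝ, 𝔤) (1 : G)).symm w) : 𝔤 →L[ℝ] 𝔤) (c • v)) =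
      fun w : 𝔤 => c • (Ad ((extChartAt 𝓘(ℝ, 𝔤) (1 : G)).symm w) : 𝔤 →L[ℝ] 𝔤) v :=
    funext fun w => Ad_smul_complex _ c v
  rw [h] at h1
  have := DFunLike.congr_fun (h1.unique h2) u
  simpa [adL_apply] using this

theorem lieBr_smul_left (c : ℂ) (u v : 𝔤) : lieBr G (c • u) v = c • (lieBr G u v : 𝔤) := by
  rw [lieBr_skew, lieBr_smul_right, lieBr_skew v u, smul_neg, neg_neg]

end ComplexGroup

/-! ### The complexification, and the forms `η̃_s` in the left invariant frame -/

section Complexification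

variable {𝔨 : Type*} [NormedAddCommGroup 𝔨] [InnerProductSpace ℝ 𝔨] [FiniteDimensional ℝ 𝔨]
  {K : Type*} [TopologicalSpace K] [ChartedSpace 𝔨 K] [Group K] [LieGroup 𝓘(ℝ, 𝔨) ∞ K]
  {𝔤 : Type*} [NormedAddCommGroup 𝔤] [NormedSpace ℂ 𝔤] [FiniteDimensional ℂ 𝔤]
  {G : Type*} [TopologicalSpace G] [ChartedSpace 𝔤 G] [Group G] [T2Space G]
  [LieGroup 𝓘(ℂ, 𝔤) ω G] [LieGroup 𝓘(ℝ, 𝔤) ∞ G]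
  {ι : K →* G} {n : ℕ}

/-- The map `Y ↦ e^{iY}`. -/
def polarExp (ι : K →* G) (Y : 𝔨) : G := lieExp G (Complex.I • (dHom ι Y : 𝔤))

theorem psi_eq (s : ℝ) (p : K × 𝔨) :
    psi 𝔨 𝔤 ι s p = ι p.1 * polarExp (𝔤 := 𝔤) ι (s • p.2) := by
  rw [psi, polarExp, map_smul, mul_smul]
  rfl


theorem hasD_dHom (hι : IsComplexification 𝔨 𝔤 ι) : HasD 𝓘(ℝ, 𝔨) 𝓘(ℝ, 𝔤) (fun x : K => ι x) 1 (dHom ι : 𝔨 →L[ℝ] 𝔤) :=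
  hasD_mfderiv (hι.smooth.mdifferentiableAt (by simp))

/-- Smoothness is read off from the polar diffeomorphism restricted to `{1} × 𝔨`; smoothness of
`lieExp` on all of `𝔤` is never needed. -/
theorem contMDiff_polarExp (hι : IsComplexification 𝔨 𝔤 ι) :
    ContMDiff 𝓘(ℝ, 𝔨) 𝓘(ℝ, 𝔤) ∞ (polarExp (𝔨 := 𝔨) (𝔤 := 𝔤) ι) := by
  obtain ⟨Φ, hΦ⟩ := hι.polar
  have h1 : ContMDiff 𝓘(ℝ, 𝔨) (𝓘(ℝ, 𝔨).prod 𝓘(ℝ, 𝔨)) ∞ (fun Y : 𝔨 => ((1 : K), Y)) :=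
    contMDiff_const.prodMk contMDiff_id
  have h2 := Φ.contMDiff_toFun.comp h1
  have h3 : polarExp (𝔨 := 𝔨) (𝔤 := 𝔤) ι = Φ ∘ fun Y : 𝔨 => ((1 : K), Y) := by
    funext Y
    simp [hΦ, polarExp]
  rw [h3]
  exact h2

/-- Existence of the subgroup also comes from the polar decomposition. Without one, `lieExp` would
take its default value `1`, so `(1, Y)` and `(1, 0)` would have the same image; injectivity forces
`Y = 0`, for which the constant subgroup exists. -/
theorem isOneParam_polarExp (hι : IsComplexification 𝔨 𝔤 ι) (Y : 𝔨) :
    IsOneParam (fun t : ℝ => polarExp (𝔤 := 𝔤) ι (t • Y)) (Complex.I • (dHom ι Y : 𝔤)) := by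
  have : CompleteSpace 𝔤 := FiniteDimensional.complete ℂ 𝔤
  have h0 : lieExp G (0 : 𝔤) = 1 := by
    simpa using (isOneParam_one (E := 𝔤) (G := G)).lieExp_smul 0
  have hex : ∃ γ : ℝ → G, IsOneParam γ (Complex.I • (dHom ι Y : 𝔤)) := by
    by_contra hne
    obtain ⟨Φ, hΦ⟩ := hι.polar
    have h1 : lieExp G (Complex.I • (dHom ι Y : 𝔤)) = 1 := by rw [lieExp, dif_neg hne]
    have h2 : Φ ((1 : K), Y) = Φ ((1 : K), (0 : 𝔨)) := by
      rw [hΦ, hΦ, h1, map_zero, smul_zero, h0]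
    have h3 : Y = 0 := (Prod.ext_iff.1 (Φ.injective h2)).2
    subst h3
    refine hne ⟨fun _ => 1, ?_⟩
    rw [map_zero, smul_zero]
    exact isOneParam_one
  obtain ⟨γ, hγ⟩ := hex
  have h1 : (fun t : ℝ => polarExp (𝔤 := 𝔤) ι (t • Y)) = γ := by
    funext t
    rw [polarExp, map_smul, smul_comm]
    exact hγ.lieExp_smul t
  rw [h1]
  exact hγ

/-- Real and imaginary parts of the coefficients are the coordinates of the two summands in `𝔤 = 𝔨 ⊕
i𝔨`. This rules out the default branch of `cCoord`. -/
theorem bijective_linearCombination (hι : IsComplexification 𝔨 𝔤 ι) (X : OrthonormalBasis (Fin n) ℝ 𝔨) :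
    Function.Bijective (Fintype.linearCombination ℂ (fun j => (dHom ι (X j) : 𝔤))) := by
  have key (c : Fin n → ℂ) : Fintype.linearCombination ℂ (fun j => (dHom ι (X j) : 𝔤)) c =
      (dHom ι (∑ j, (c j).re • X j) : 𝔤) + Complex.I • dHom ι (∑ j, (c j).im • X j) := by
    rw [Fintype.linearCombination_apply, map_sum, map_sum, Finset.smul_sum,
      ← Finset.sum_add_distrib]
    refine Finset.sum_congr rfl fun j _ => ?_
    rw [map_smul, map_smul]
    conv_lhs => rw [← Complex.re_add_im (c j)]
    rw [add_smul, mul_comm, mul_smul]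
    rfl
  have hX (A : 𝔨) : ∑ j, ⟪X j, A⟫_ℝ • X j = A := X.sum_repr' A
  constructor
  · intro c d hcd
    rw [key, key] at hcd
    have h := Prod.ext_iff.1 (hι.realForm.1 (a₁ := (_, _)) (a₂ := (_, _)) hcd)
    have h1 : ∀ f g : Fin n → ℝ, ∑ j, f j • X j = ∑ j, g j • X j → f = g := by
      intro f g hfg
      have := X.toBasis.linearIndependent
      rw [Fintype.linearIndependent_iff] at this
      funext i
      have h2 := this (fun i => f i - g i) (by simp [sub_smul, hfg]) i
      exact sub_eq_zero.1 h2
    funext j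
    exact Complex.ext (congrFun (h1 _ _ h.1) j) (congrFun (h1 _ _ h.2) j)
  · intro v
    obtain ⟨⟨A, B⟩, h⟩ := hι.realForm.2 v
    refine ⟨fun j => ⟨⟪X j, A⟫_ℝ, ⟪X j, B⟫_ℝ⟩, ?_⟩
    rw [key]
    simp only [hX]
    exact h

theorem cCoord_linearCombination (hι : IsComplexification 𝔨 𝔤 ι) (X : OrthonormalBasis (Fin n) ℝ 𝔨) (c : Fin n → ℂ) :
    cCoord (𝔤 := 𝔤) ι X (∑ j, c j • (dHom ι (X j) : 𝔤)) = c := by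
  rw [cCoord, dif_pos (bijective_linearCombination hι X), ← Fintype.linearCombination_apply]
  exact (LinearEquiv.ofBijective _ (bijective_linearCombination hι X)).symm_apply_apply c

theorem cCoord_dHom (hι : IsComplexification 𝔨 𝔤 ι) (X : OrthonormalBasis (Fin n) ℝ 𝔨) (A : 𝔨) :
    cCoord (𝔤 := 𝔤) ι X (dHom ι A) = fun i => ((⟪X i, A⟫_ℝ : ℝ) : ℂ) := by
  rw [← cCoord_linearCombination hι X (fun i => ((⟪X i, A⟫_ℝ : ℝ) : ℂ))]
  congr 1
  conv_lhs => rw [← X.sum_repr' A]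
  rw [map_sum]
  refine Finset.sum_congr rfl fun j _ => ?_
  rw [map_smul]
  rfl

theorem sum_cCoord (hι : IsComplexification 𝔨 𝔤 ι) (X : OrthonormalBasis (Fin n) ℝ 𝔨) (v : 𝔤) :
    ∑ j, cCoord ι X v j • (dHom ι (X j) : 𝔤) = v := by
  obtain ⟨c, hc⟩ := (bijective_linearCombination hι X).2 v
  rw [Fintype.linearCombination_apply] at hc
  rw [← hc, cCoord_linearCombination hι]

end Complexification

section AdMatrix

variable {𝔨 : Type*} [NormedAddCommGroup 𝔨] [InnerProductSpace ℝ 𝔨]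
  (K : Type*) [TopologicalSpace K] [ChartedSpace 𝔨 K] [Group K] {n : ℕ}

/-- The hermitian matrix of `i ad Y` in the orthonormal basis `X`. -/
def adMat (X : OrthonormalBasis (Fin n) ℝ 𝔨) (Y : 𝔨) : Matrix (Fin n) (Fin n) ℂ :=
  Matrix.of fun i j => Complex.I * ((⟪X i, lieBr K Y (X j)⟫_ℝ : ℝ) : ℂ)

end AdMatrix

section Complexification

variable {𝔨 : Type*} [NormedAddCommGroup 𝔨] [InnerProductSpace ℝ 𝔨] [FiniteDimensional ℝ 𝔨]
  {K : Type*} [TopologicalSpace K] [ChartedSpace 𝔨 K] [Group K] [LieGroup 𝓘(ℝ, 𝔨) ∞ K]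
  {𝔤 : Type*} [NormedAddCommGroup 𝔤] [NormedSpace ℂ 𝔤] [FiniteDimensional ℂ 𝔤]
  {G : Type*} [TopologicalSpace G] [ChartedSpace 𝔤 G] [Group G] [T2Space G]
  [LieGroup 𝓘(ℂ, 𝔤) ω G] [LieGroup 𝓘(ℝ, 𝔤) ∞ G]
  {ι : K →* G} {n : ℕ}

/-- By complex bilinearity `ad(iY)` is determined by the brackets of `𝔨`, so the group `G`
disappears from the computation here. -/
theorem cCoord_lieBr (hι : IsComplexification 𝔨 𝔤 ι) (X : OrthonormalBasis (Fin n) ℝ 𝔨) (Y : 𝔨) (v : 𝔤) :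
    cCoord ι X (lieBr G (Complex.I • (dHom ι Y : 𝔤)) v) =
      (adMat K X Y).mulVec (cCoord ι X v) := by
  have h1 : lieBr G (Complex.I • (dHom ι Y : 𝔤)) v =
      ∑ j, cCoord ι X v j • Complex.I • (dHom ι (lieBr K Y (X j)) : 𝔤) := by
    conv_lhs => rw [← sum_cCoord hι X v]
    rw [← adL_apply, map_sum]
    refine Finset.sum_congr rfl fun j _ => ?_
    rw [adL_apply, lieBr_smul_right, lieBr_smul_left, map_lieBr ι (hasD_dHom hι)]
  rw [h1, map_sum]
  funext i
  simp only [map_smul, cCoord_dHom hι, Finset.sum_apply, Pi.smul_apply, smul_eq_mul,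
    Matrix.mulVec, dotProduct, adMat, Matrix.of_apply]
  exact Finset.sum_congr rfl fun j _ => by ring

theorem hasDerivAt_cCoord_Ad (hι : IsComplexification 𝔨 𝔤 ι) (X : OrthonormalBasis (Fin n) ℝ 𝔨) (Y : 𝔨) (v : 𝔤) (t : ℝ) :
    HasDerivAt (fun t : ℝ => cCoord ι X (Ad (polarExp (𝔤 := 𝔤) ι (t • Y))⁻¹ v))
      (-(adMat K X Y).mulVec (cCoord ι X (Ad (polarExp (𝔤 := 𝔤) ι (t • Y))⁻¹ v))) t := by
  have h := isOneParam_polarExp hι Y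
  have h1 := h.hasDerivAt_Ad v (-t)
  have h2 := HasDerivAt.scomp t h1 (hasDerivAt_neg t)
  have h3 := (((cCoord (𝔤 := 𝔤) ι X).toContinuousLinearMap.restrictScalars
    ℝ).hasFDerivAt.comp_hasDerivAt t h2)
  have e (r : ℝ) : polarExp (𝔤 := 𝔤) ι ((-r) • Y) = (polarExp (𝔤 := 𝔤) ι (r • Y))⁻¹ := h.map_neg r
  have h4 : HasDerivAt (fun t : ℝ => cCoord ι X (Ad (polarExp (𝔤 := 𝔤) ι ((-t) • Y)) v))
      (cCoord ι X ((-1 : ℝ) • lieBr G (Complex.I • (dHom ι Y : 𝔤))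
        (Ad (polarExp (𝔤 := 𝔤) ι ((-t) • Y)) v))) t := h3
  simp only [e] at h4
  rw [neg_one_smul, map_neg, cCoord_lieBr hι] at h4
  exact h4

/-- `W` records Ad(e^{-isY}) on `𝔨`, and `Q` records `s` times the logarithmic derivative of the
exponential at `sY`. Keeping them as solutions of differential equations in `s` avoids any series
for the derivative of exp. -/
theorem exists_etaForm_eq (hι : IsComplexification 𝔨 𝔤 ι) (X : OrthonormalBasis (Fin n) ℝ 𝔨) (Y : 𝔨) :
    ∃ W Q : ℝ → Matrix (Fin n) (Fin n) ℂ, W 0 = 1 ∧ Q 0 = 0 ∧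
      (∀ t i j, HasDerivAt (fun t => W t i j) (-(adMat K X Y * W t) i j) t) ∧
      (∀ t i j, HasDerivAt (fun t => Q t i j) (Complex.I * W t i j) t) ∧
      (∀ s x i j, etaForm 𝔤 ι X s (x, Y) (leftInv x (X j), 0) i = W s i j) ∧
      (∀ s x i j, etaForm 𝔤 ι X s (x, Y) (0, X j) i = Q s i j) := by
  obtain ⟨P, hP, hPd⟩ := exists_logDeriv_exp (contMDiff_polarExp hι) (isOneParam_polarExp hι) Y
  have h1 : polarExp (𝔤 := 𝔤) ι (0 : 𝔨) = 1 := by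
    simpa using (isOneParam_polarExp hι (0 : 𝔨)).map_zero
  have hform (s : ℝ) (x : K) (u A : 𝔨) : etaForm 𝔤 ι X s (x, Y) (u, A) =
      cCoord ι X (Ad (polarExp (𝔤 := 𝔤) ι (s • Y))⁻¹ (dHom ι (maurerCartan x u) : 𝔤)) +
        cCoord ι X (s • P s A) := by
    have a1 := ((hasD_dHom hι).comp_of_eq (hasD_maurerCartan (E := 𝔨) x)
      (inv_mul_cancel x)).comp_of_eq (hasD_fst (I₁ := 𝓘(ℝ, 𝔨)) (I₂ := 𝓘(ℝ, 𝔨)) (x, Y)) rfl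
    have a2 := a1.conj_of_eq_one (polarExp (𝔤 := 𝔤) ι (s • Y))⁻¹ (by simp)
    have b0 : HasD 𝓘(ℝ, 𝔨) 𝓘(ℝ, 𝔨) (fun Z : 𝔨 => s • (Z - Y)) Y (s • .id ℝ 𝔨) :=
      hasD_iff_hasFDerivAt.2 (((hasFDerivAt_id Y).sub_const Y).const_smul s)
    have b1 := (hP s |>.comp_of_eq b0 (by simp)).comp_of_eq
      (hasD_snd (I₁ := 𝓘(ℝ, 𝔨)) (I₂ := 𝓘(ℝ, 𝔨)) (x, Y)) rfl
    have c := a2.mul_of_eq_one b1 (by simp) (by simp)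
    -- ψ_s(p)⁻¹ ψ_s(q) is factored into two maps equal to `1` at `q = p`, one depending on `q.1`
    -- only and one on `q.2` only; their derivatives then add.
    have c' : (fun q : K × 𝔨 => (polarExp (𝔤 := 𝔤) ι (s • Y))⁻¹ * ι (x⁻¹ * q.1) *
        (polarExp (𝔤 := 𝔤) ι (s • Y))⁻¹⁻¹ * ((polarExp (𝔤 := 𝔤) ι (s • Y))⁻¹ *
          polarExp (𝔤 := 𝔤) ι (s • Y + s • (q.2 - Y)))) =
        fun q => (psi 𝔨 𝔤 ι s (x, Y))⁻¹ * psi 𝔨 𝔤 ι s q := by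
      funext q
      have e : s • Y + s • (q.2 - Y) = s • q.2 := by rw [← smul_add]; congr 1; abel
      simp only [psi_eq (𝔤 := 𝔤) (G := G) (ι := ι), e, map_mul, map_inv]
      group
    rw [c'] at c
    have hd : MDifferentiableAt (𝓘(ℝ, 𝔨).prod 𝓘(ℝ, 𝔨)) 𝓘(ℝ, 𝔤) (psi 𝔨 𝔤 ι s) (x, Y) := by
      have e1 : ContMDiff (𝓘(ℝ, 𝔨).prod 𝓘(ℝ, 𝔨)) 𝓘(ℝ, 𝔤) ∞
          (fun q : K × 𝔨 => ι q.1 * polarExp (𝔤 := 𝔤) ι (s • q.2)) :=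
        (hι.smooth.comp contMDiff_fst).mul ((contMDiff_polarExp hι).comp
          ((contDiff_const_smul s).contMDiff.comp contMDiff_snd))
      have e2 : psi 𝔨 𝔤 ι s = fun q : K × 𝔨 => ι q.1 * polarExp (𝔤 := 𝔤) ι (s • q.2) :=
        funext fun q => psi_eq (𝔤 := 𝔤) (G := G) (ι := ι) s q
      rw [e2]
      exact (e1 (x, Y)).mdifferentiableAt (by simp)
    have d := (hasD_mfderiv hd).maurerCartan_comp
    have e := DFunLike.congr_fun (d.unique c) (u, A)
    have f : etaForm 𝔤 ι X s (x, Y) (u, A) = cCoord ι X ((maurerCartan (psi 𝔨 𝔤 ι s (x, Y)) :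
      𝔤 →L[ℝ] 𝔤) ((mfderiv (𝓘(ℝ, 𝔨).prod 𝓘(ℝ, 𝔨)) 𝓘(ℝ, 𝔤) (psi 𝔨 𝔤 ι s) (x, Y) :
        (𝔨 × 𝔨) →L[ℝ] 𝔤) (u, A))) := rfl
    rw [f, ← map_add]
    congr 1
    refine Eq.trans e ?_
    simp
  refine ⟨fun t => Matrix.of fun i j =>
      cCoord ι X (Ad (polarExp (𝔤 := 𝔤) ι (t • Y))⁻¹ (dHom ι (X j) : 𝔤)) i,
    fun t => Matrix.of fun i j => cCoord ι X (t • P t (X j)) i, ?_, ?_, ?_, ?_, ?_, ?_⟩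
  · ext i j
    simp only [zero_smul, h1, inv_one, Ad_one, Matrix.of_apply, ContinuousLinearMap.id_apply,
      cCoord_dHom hι, Matrix.one_apply]
    rw [orthonormal_iff_ite.1 X.orthonormal]
    split_ifs <;> simp
  · ext i j; simp
  · intro t i j
    have := (hasDerivAt_pi.1 (hasDerivAt_cCoord_Ad hι X Y (dHom ι (X j) : 𝔤) t)) i
    exact this
  · intro t i j
    have h2 := ((cCoord (𝔤 := 𝔤) ι X).toContinuousLinearMap.restrictScalars
      ℝ).hasFDerivAt.comp_hasDerivAt t (hPd (X j) t)
    have h3 := (hasDerivAt_pi.1 h2) i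
    have h4 : (Ad (polarExp (𝔤 := 𝔤) ι (t • Y))⁻¹ (Complex.I • (dHom ι (X j) : 𝔤)) : 𝔤) =
      Complex.I • Ad (polarExp (𝔤 := 𝔤) ι (t • Y))⁻¹ (dHom ι (X j) : 𝔤) :=
        Ad_smul_complex _ _ _
    rw [h4] at h3
    have h5 : ((cCoord (𝔤 := 𝔤) ι X).toContinuousLinearMap.restrictScalars ℝ)
      (Complex.I • Ad (polarExp (𝔤 := 𝔤) ι (t • Y))⁻¹ (dHom ι (X j) : 𝔤)) =
      Complex.I • cCoord ι X (Ad (polarExp (𝔤 := 𝔤) ι (t • Y))⁻¹ (dHom ι (X j) : 𝔤)) :=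
        map_smul (cCoord (𝔤 := 𝔤) ι X) _ _
    rw [h5] at h3
    exact h3
  · intro s x i j
    rw [hform]
    simp [maurerCartan_leftInv]
  · intro s x i j
    rw [hform]
    simp

end Complexification

/-! ### The contribution of a single eigenvalue -/

section Scalar

/-- The solution of `f' = exp (-t l)`, `f 0 = 0`. -/
def expInt (l t : ℝ) : ℝ := if l = 0 then t else (1 - Real.exp (-(t * l))) / l

theorem expInt_zero (l : ℝ) : expInt l 0 = 0 := by
  unfold expInt; split_ifs <;> simp

theorem hasDerivAt_expInt (l t : ℝ) : HasDerivAt (expInt l) (Real.exp (-(t * l))) t := by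
  by_cases hl : l = 0
  · subst hl
    have : expInt 0 = fun t => t := by funext t; simp [expInt]
    rw [this]
    simp only [mul_zero, neg_zero, Real.exp_zero]
    exact hasDerivAt_id' t
  · have : expInt l = fun t => (1 - Real.exp (-(t * l))) / l := by funext t; simp [expInt, hl]
    rw [this]
    have h := (((((hasDerivAt_id t).mul_const l).neg).exp).const_sub 1).div_const l
    refine h.congr_deriv ?_
    simp only [Pi.neg_apply, id_eq]
    field_simp

/-- Up to a factor `i`, the left side is the 2×2 determinant that an eigenvalue `l` of `adMat`
contributes. For `l ≠ 0` it is (e^{sl} - e^{-s'l})/l, and the midpoint of the exponents factors out.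
-/
theorem exp_mul_expInt (l s s' : ℝ) :
    Real.exp (s * l) * expInt l s' - Real.exp (-(s' * l)) * expInt l (-s) =
      Real.exp ((s - s') / 2 * l) * ((s + s') * sinhc ((s + s') / 2 * l)) := by
  by_cases hl : l = 0
  · subst hl; simp [expInt, sinhc]; ring
  · by_cases hs : s + s' = 0
    · have : s' = -s := by linarith
      subst this
      simp [expInt, hl]
    · have h0 : (s + s') / 2 * l ≠ 0 := by positivity
      have e1 : Real.exp (s * l) = Real.exp ((s - s') / 2 * l) * Real.exp ((s + s') / 2 * l) := by
        rw [← Real.exp_add]; ring_nf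
      have e2 : Real.exp (-(s' * l)) =
          Real.exp ((s - s') / 2 * l) * Real.exp (-((s + s') / 2 * l)) := by
        rw [← Real.exp_add]; ring_nf
      have e3 : Real.exp (-(-s * l)) = Real.exp (s * l) := by ring_nf
      simp only [expInt, hl, if_false, sinhc, h0, Real.sinh_eq, e3]
      rw [e1, e2]
      field_simp
      ring

end Scalar

/-! ### The matrix differential equations and the block determinant -/

section MatrixODE

variable {n : ℕ} {M P P' : Matrix (Fin n) (Fin n) ℂ} {l : Fin n → ℝ}

theorem conj_diagonal_eq (hP : M * P = P * Matrix.diagonal fun j => (l j : ℂ)) (h1 : P' * P = 1)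
    (h2 : P * P' = 1) : P' * M = (Matrix.diagonal fun j => (l j : ℂ)) * P' := by
  calc P' * M = P' * (M * P) * P' := by rw [mul_assoc, mul_assoc, h2, mul_one]
    _ = _ := by rw [hP, ← mul_assoc, h1, one_mul]

/-- The solution of the matrix equation `W' = -M W`, `W 0 = 1`, for a diagonalizable `M`. -/
theorem matrix_ode_solution (hP : M * P = P * Matrix.diagonal fun j => (l j : ℂ))
    (h1 : P' * P = 1) (h2 : P * P' = 1) {W : ℝ → Matrix (Fin n) (Fin n) ℂ} (hW0 : W 0 = 1)
    (hW : ∀ t i j, HasDerivAt (fun t => W t i j) (-(M * W t) i j) t) (t : ℝ) :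
    W t = P * (Matrix.diagonal fun j => (Real.exp (-(t * l j)) : ℂ)) * P' := by
  have hU (t : ℝ) (i j : Fin n) : HasDerivAt (fun t => (P' * W t) i j)
      (-(l i : ℂ) * (P' * W t) i j) t := by
    have h3 : HasDerivAt (fun t => ∑ k, P' i k * W t k j) (∑ k, P' i k * -(M * W t) k j) t :=
      HasDerivAt.fun_sum fun k _ => (hW t k j).const_mul (P' i k)
    have h4 : ∑ k, P' i k * -(M * W t) k j = -(l i : ℂ) * (P' * W t) i j := by
      have : (P' * (M * W t)) i j = (l i : ℂ) * (P' * W t) i j := by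
        rw [← mul_assoc, conj_diagonal_eq hP h1 h2, mul_assoc, Matrix.diagonal_mul]
      rw [neg_mul, ← this, Matrix.mul_apply, ← Finset.sum_neg_distrib]
      simp
    rw [h4] at h3
    exact h3
  -- In the eigenbasis the rows decouple, and the integrating factor gives a constant of motion.
  have hconst (i j : Fin n) (t : ℝ) : (Real.exp (t * l i) : ℂ) * (P' * W t) i j = P' i j := by
    have hd (t : ℝ) : HasDerivAt (fun t : ℝ => (Real.exp (t * l i) : ℂ) * (P' * W t) i j) 0 t := by
      have h3 : HasDerivAt (fun t : ℝ => (Real.exp (t * l i) : ℂ))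
          ((Real.exp (t * l i) * l i : ℝ) : ℂ) t := by
        have := (((hasDerivAt_id t).mul_const (l i)).exp).ofReal_comp
        simpa using this
      refine (h3.mul (hU t i j)).congr_deriv ?_
      push_cast; ring
    have := is_const_of_deriv_eq_zero (fun t => (hd t).differentiableAt) (fun t => (hd t).deriv) t 0
    rw [this]
    simp [hW0]
  have h5 : P' * W t = (Matrix.diagonal fun j => (Real.exp (-(t * l j)) : ℂ)) * P' := by
    ext i j
    rw [Matrix.diagonal_mul, ← hconst i j t, ← mul_assoc, ← Complex.ofReal_mul, ← Real.exp_add]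
    simp
  rw [mul_assoc, ← h5, ← mul_assoc, h2, one_mul]

theorem matrix_ode_integral {W Q : ℝ → Matrix (Fin n) (Fin n) ℂ} (hQ0 : Q 0 = 0)
    (hW : ∀ t, W t = P * (Matrix.diagonal fun j => (Real.exp (-(t * l j)) : ℂ)) * P')
    (hQ : ∀ t i j, HasDerivAt (fun t => Q t i j) (Complex.I * W t i j) t) (t : ℝ) :
    Q t = P * (Matrix.diagonal fun j => Complex.I * (expInt (l j) t : ℂ)) * P' := by
  have hR (i j : Fin n) (t : ℝ) : HasDerivAt (fun t => (P * (Matrix.diagonal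
      fun j => Complex.I * (expInt (l j) t : ℂ)) * P') i j) (Complex.I * W t i j) t := by
    simp only [hW, Matrix.mul_apply (M := _ * _), Matrix.mul_diagonal, Finset.mul_sum]
    refine HasDerivAt.fun_sum fun k _ => ?_
    refine (((((hasDerivAt_expInt (l k) t).ofReal_comp).const_mul Complex.I).const_mul
      (P i k)).mul_const (P' k j)).congr_deriv ?_
    ring
  ext i j
  have hd (t : ℝ) := (hQ t i j).sub (hR i j t)
  simp only [sub_self] at hd
  have := is_const_of_deriv_eq_zero (fun t => (hd t).differentiableAt) (fun t => (hd t).deriv) t 0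
  rw [← sub_eq_zero]
  refine this.trans ?_
  simp [hQ0, expInt_zero]

/-- Since conj M = -M, the function `t ↦ conj (W (-t))` solves the same initial value problem as
`W`. -/
theorem matrix_ode_conj (hM : ∀ i j, conj (M i j) = -M i j)
    (hP : M * P = P * Matrix.diagonal fun j => (l j : ℂ))
    (h1 : P' * P = 1) (h2 : P * P' = 1) {W : ℝ → Matrix (Fin n) (Fin n) ℂ} (hW0 : W 0 = 1)
    (hW : ∀ t i j, HasDerivAt (fun t => W t i j) (-(M * W t) i j) t) (t : ℝ) :
    (W t).map conj = W (-t) := by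
  have key (t : ℝ) : (W (-t)).map conj =
      P * (Matrix.diagonal fun j => (Real.exp (-(t * l j)) : ℂ)) * P' := by
    refine matrix_ode_solution hP h1 h2 (W := fun t => (W (-t)).map conj) ?_ ?_ t
    · ext i j; simp [hW0, Matrix.one_apply]
    · intro t i j
      have h3 := HasDerivAt.scomp t (hW (-t) i j) (hasDerivAt_neg t)
      have h4 := Complex.conjCLE.toContinuousLinearMap.hasFDerivAt.comp_hasDerivAt t h3
      refine h4.congr_deriv ?_
      simp [Matrix.mul_apply, hM]
  have h := key (-t)
  rw [neg_neg] at h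
  rw [h, matrix_ode_solution hP h1 h2 hW0 hW]

theorem matrix_ode_integral_conj {W Q : ℝ → Matrix (Fin n) (Fin n) ℂ} (hQ0 : Q 0 = 0)
    (hW : ∀ t, (W t).map conj = W (-t))
    (hQ : ∀ t i j, HasDerivAt (fun t => Q t i j) (Complex.I * W t i j) t) (t : ℝ) :
    (Q t).map conj = Q (-t) := by
  ext i j
  have hd (t : ℝ) : HasDerivAt (fun t => conj (Q t i j) - Q (-t) i j) 0 t := by
    have h3 := HasDerivAt.scomp t (hQ (-t) i j) (hasDerivAt_neg t)
    have h4 := Complex.conjCLE.toContinuousLinearMap.hasFDerivAt.comp_hasDerivAt t (hQ t i j)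
    refine (h4.sub h3).congr_deriv ?_
    have h5 : conj (W t i j) = W (-t) i j := by rw [← hW t]; rfl
    simp [h5]
  have := is_const_of_deriv_eq_zero (fun t => (hd t).differentiableAt) (fun t => (hd t).deriv) t 0
  rw [← sub_eq_zero]
  refine this.trans ?_
  simp [hQ0]

/-- Conjugating by `diag(P, P)` makes all four blocks diagonal; the Schur complement of the first,
invertible by `ha`, gives one 2×2 determinant per index. -/
theorem det_fromBlocks_diagonal (h2 : P * P' = 1) (a b c d : Fin n → ℂ) (ha : ∀ j, a j ≠ 0) :
    (Matrix.fromBlocks (P * Matrix.diagonal a * P') (P * Matrix.diagonal b * P')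
      (P * Matrix.diagonal c * P') (P * Matrix.diagonal d * P')).det =
      ∏ j, (a j * d j - c j * b j) := by
  have h3 : Matrix.fromBlocks (P * Matrix.diagonal a * P') (P * Matrix.diagonal b * P')
      (P * Matrix.diagonal c * P') (P * Matrix.diagonal d * P') =
      Matrix.fromBlocks P 0 0 P * Matrix.fromBlocks (Matrix.diagonal a) (Matrix.diagonal b)
        (Matrix.diagonal c) (Matrix.diagonal d) * Matrix.fromBlocks P' 0 0 P' := by
    simp [Matrix.fromBlocks_multiply]
  have h4 : P.det * P'.det = 1 := by rw [← Matrix.det_mul, h2, Matrix.det_one]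
  have h5 : Matrix.diagonal a * Matrix.diagonal (fun j => (a j)⁻¹) = 1 := by
    rw [Matrix.diagonal_mul_diagonal]
    simp [ha]
  let _ : Invertible (Matrix.diagonal a) := invertibleOfRightInverse _ _ h5
  have h6 : ⅟(Matrix.diagonal a) = Matrix.diagonal fun j => (a j)⁻¹ :=
    invOf_eq_right_inv h5
  rw [h3, Matrix.det_mul, Matrix.det_mul, Matrix.det_fromBlocks_zero₁₂,
    Matrix.det_fromBlocks_zero₁₂, Matrix.det_fromBlocks₁₁, h6, Matrix.diagonal_mul_diagonal,
    Matrix.diagonal_mul_diagonal, Matrix.diagonal_sub, Matrix.det_diagonal, Matrix.det_diagonal,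
    ← Finset.prod_mul_distrib]
  have h7 : ∀ j, a j * (d j - c j * (a j)⁻¹ * b j) = a j * d j - c j * b j := by
    intro j
    have := ha j
    field_simp
  simp only [h7]
  linear_combination (P.det * P'.det + 1) * (∏ j, (a j * d j - c j * b j)) * h4

/-- The determinant of the matrix of `(conj η_s, η_{s'})` in the left invariant frame. -/
theorem det_blocks_eq (hM : ∀ i j, conj (M i j) = -M i j) (htr : M.trace = 0)
    (hP : M * P = P * Matrix.diagonal fun j => (l j : ℂ))
    (h1 : P' * P = 1) (h2 : P * P' = 1) {W Q : ℝ → Matrix (Fin n) (Fin n) ℂ} (hW0 : W 0 = 1)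
    (hQ0 : Q 0 = 0) (hW : ∀ t i j, HasDerivAt (fun t => W t i j) (-(M * W t) i j) t)
    (hQ : ∀ t i j, HasDerivAt (fun t => Q t i j) (Complex.I * W t i j) t) (s s' : ℝ) :
    (Matrix.fromBlocks ((W s).map conj) ((Q s).map conj) (W s') (Q s')).det =
      Complex.I ^ n * (((s + s') ^ n * ∏ j, sinhc ((s + s') / 2 * l j) : ℝ) : ℂ) := by
  have hWs := matrix_ode_solution hP h1 h2 hW0 hW
  have hWc := matrix_ode_conj hM hP h1 h2 hW0 hW
  -- The asymmetric factors e^{(s-s')l_j/2} multiply to 1 because the trace vanishes.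
  have hsum : ∑ j, l j = 0 := by
    have h3 : M = P * (Matrix.diagonal fun j => (l j : ℂ)) * P' := by
      rw [← hP, mul_assoc, h2, mul_one]
    rw [h3, Matrix.trace_mul_comm, ← mul_assoc, h1, one_mul, Matrix.trace_diagonal] at htr
    exact_mod_cast htr
  rw [matrix_ode_integral_conj hQ0 hWc hQ, hWc, matrix_ode_integral hQ0 hWs hQ,
    matrix_ode_integral hQ0 hWs hQ, hWs, hWs, det_fromBlocks_diagonal h2 _ _ _ _ (fun j => by
      exact_mod_cast (Real.exp_pos _).ne')]
  have h4 (j : Fin n) : (Real.exp (-(-s * l j)) : ℂ) * (Complex.I * (expInt (l j) s' : ℂ)) -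
      (Real.exp (-(s' * l j)) : ℂ) * (Complex.I * (expInt (l j) (-s) : ℂ)) =
      Complex.I * ((Real.exp ((s - s') / 2 * l j) *
        ((s + s') * sinhc ((s + s') / 2 * l j)) : ℝ) : ℂ) := by
    rw [← exp_mul_expInt]
    push_cast
    ring_nf
  simp only [h4]
  rw [Finset.prod_mul_distrib, ← Complex.ofReal_prod, Finset.prod_mul_distrib,
    Finset.prod_mul_distrib, ← Real.exp_sum, ← Finset.mul_sum, hsum]
  simp

end MatrixODE

/-! ### Wedge products of one-forms as determinants -/

section Wedge

variable {V : Type*} [AddCommGroup V] [Module ℝ V] {A : Type*} [CommRing A] [Algebra ℝ A]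
  {p q n : ℕ}

/-- The form `η^1 ∧ ⋯ ∧ η^n` for the components `η^j` of `η`. -/
def detForm (η : V →ₗ[ℝ] (Fin n → A)) : V [⋀^Fin n]→ₗ[ℝ] A :=
  MultilinearMap.alternatization
    ((MultilinearMap.mkPiAlgebra ℝ (Fin n) A).compLinearMap fun i => (LinearMap.proj i).comp η)

theorem detForm_apply (η : V →ₗ[ℝ] (Fin n → A)) (v : Fin n → V) :
    detForm η v = (Matrix.of fun k => η (v k)).det := by
  rw [detForm, MultilinearMap.alternatization_apply, Matrix.det_apply]
  refine Finset.sum_congr rfl fun σ _ => ?_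
  simp

theorem wedgeAll_eq_detForm (η : V →ₗ[ℝ] (Fin n → ℂ)) : wedgeAll η = detForm η := by
  ext v
  rw [detForm_apply]
  rfl

/-- The shuffle product of two alternatizations is the alternatization of the plain product, whose
signed sum is the Leibniz formula; no shuffles need counting. -/
theorem wedge_detForm (η : V →ₗ[ℝ] (Fin p → A)) (ξ : V →ₗ[ℝ] (Fin q → A)) (v : Fin (p + q) → V) :
    wedge (detForm η) (detForm ξ) v = (Matrix.of fun k : Fin p ⊕ Fin q =>
      (Sum.elim (η (v (finSumFinEquiv k))) (ξ (v (finSumFinEquiv k))) : Fin p ⊕ Fin q → A)).det := by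
  rw [wedge, detForm, detForm, ← MultilinearMap.domCoprod_alternization,
    ← LinearMap.compMultilinearMap_alternatization, AlternatingMap.domDomCongr_apply,
    MultilinearMap.alternatization_apply, Matrix.det_apply]
  refine Finset.sum_congr rfl fun σ _ => ?_
  simp [MultilinearMap.domCoprod_apply]

theorem conjForm_detForm (η : V →ₗ[ℝ] (Fin n → ℂ)) :
    conjForm (detForm η) =
      detForm (LinearMap.pi fun i => (Complex.conjAe.toLinearMap.comp (LinearMap.proj i)).comp η) := by
  ext v
  rw [detForm_apply]
  have : conjForm (detForm η) v = conj (detForm η v) := rfl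
  rw [this, detForm_apply, RingHom.map_det]
  rfl

end Wedge

/-! ### Powers of a symplectic form -/

section WedgePow

variable {V : Type*} [AddCommGroup V] [Module ℝ V] {p q n : ℕ}

/-- The wedge product as a linear map on the tensor product. -/
def wedgeLin (V : Type*) [AddCommGroup V] [Module ℝ V] (p q : ℕ) :
    TensorProduct ℝ (V [⋀^Fin p]→ₗ[ℝ] ℝ) (V [⋀^Fin q]→ₗ[ℝ] ℝ) →ₗ[ℝ] V [⋀^Fin (p + q)]→ₗ[ℝ] ℝ :=
  (AlternatingMap.domDomCongrₗ ℝ finSumFinEquiv).toLinearMap.comp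
    ((LinearMap.compAlternatingMapₗ ℝ (LinearMap.mul' ℝ ℝ)).comp AlternatingMap.domCoprod')

theorem sum_alternating_apply {κ : Type*} (t : Finset κ) (f : κ → V [⋀^Fin p]→ₗ[ℝ] ℝ)
    (v : Fin p → V) : (∑ i ∈ t, f i) v = ∑ i ∈ t, f i v :=
  map_sum ({ toFun := fun g => g v, map_zero' := rfl, map_add' := fun _ _ => rfl } :
    (V [⋀^Fin p]→ₗ[ℝ] ℝ) →+ ℝ) f t

theorem wedge_eq_wedgeLin (a : V [⋀^Fin p]→ₗ[ℝ] ℝ) (b : V [⋀^Fin q]→ₗ[ℝ] ℝ) :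
    wedge a b = wedgeLin V p q (a ⊗ₜ b) := rfl

/-- The map with components `a (i 0), …, a (i (k - 1)), b (i 0), …, b (i (k - 1))`. -/
def pairMap {k : ℕ} (a b : Fin n → V →ₗ[ℝ] ℝ) (i : Fin k → Fin n) : V →ₗ[ℝ] (Fin (2 * k) → ℝ) :=
  LinearMap.pi fun c => if h : (c : ℕ) < k then a (i ⟨c, h⟩) else b (i ⟨c - k, by omega⟩)

/-- The new factor `a j` has to move left past the `k` old factors `b (i ·)`, which costs `(-1)^k`;
`b j` is already in last place. -/
theorem wedge_pairMap {k : ℕ} (a b : Fin n → V →ₗ[ℝ] ℝ) (i : Fin k → Fin n) (j : Fin n) :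
    wedge (detForm (pairMap a b i)) (detForm (LinearMap.pi ![a j, b j])) =
      (-1 : ℝ) ^ k • detForm (pairMap a b (Fin.snoc (α := fun _ => Fin n) i j)) := by
  ext v
  rw [wedge_detForm, AlternatingMap.smul_apply, detForm_apply]
  -- `x` is the column where `a j` belongs and `y` the one where it starts.
  let x : Fin (2 * k + 2) := ⟨k, by omega⟩
  let y : Fin (2 * k + 2) := ⟨2 * k, by omega⟩
  have hxy : x ≤ y := by simp only [x, y, Fin.mk_le_mk]; omega
  have hs := Fin.sign_cycleIcc_of_le hxy
  have h1 := Matrix.det_permute' (Fin.cycleIcc x y)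
    (Matrix.of fun r : Fin (2 * k + 2) =>
      pairMap a b (Fin.snoc (α := fun _ => Fin n) i j) (v r) : Matrix _ _ ℝ)
  have h2 : ((Equiv.Perm.sign (Fin.cycleIcc x y) : ℤˣ) : ℝ) = (-1) ^ k := by
    rw [hs]
    have : 2 * k - k = k := by omega
    simp [x, y, this]
  rw [h2] at h1
  refine Eq.trans ?_ h1
  rw [← Matrix.det_submatrix_equiv_self finSumFinEquiv]
  congr 1
  ext r c
  simp only [Matrix.of_apply, Matrix.submatrix_apply, id]
  generalize v (finSumFinEquiv r) = z
  rcases c with c | c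
  · simp only [Sum.elim_inl, finSumFinEquiv_apply_left, pairMap, LinearMap.pi_apply]
    by_cases hc : (c : ℕ) < k
    · have h3 : Fin.cycleIcc x y (Fin.castAdd 2 c) = Fin.castAdd 2 c :=
        Fin.cycleIcc_of_lt (by simp only [x, Fin.lt_def, Fin.val_castAdd]; omega)
      have h4 : (c : ℕ) < k + 1 := by omega
      rw [h3]
      simp only [Fin.val_castAdd, hc, h4, dif_pos]
      congr 2
      exact (Fin.snoc_castSucc (α := fun _ => Fin n) j i ⟨c, hc⟩).symm
    · have h3 : Fin.cycleIcc x y (Fin.castAdd 2 c) = Fin.castAdd 2 c + 1 :=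
        Fin.cycleIcc_of_ge_of_lt (by simp only [x, Fin.le_def, Fin.val_castAdd]; omega)
          (by simp only [y, Fin.lt_def, Fin.val_castAdd]; omega)
      have h4 : ((Fin.castAdd 2 c + 1 : Fin (2 * k + 2)) : ℕ) = c + 1 := by
        rw [Fin.val_add_one_of_lt]
        · rfl
        · rw [Fin.lt_def]; simp
      have h5 : ¬ ((c : ℕ) + 1 < k + 1) := by omega
      rw [h3]
      simp only [h4, hc, h5, dif_neg, not_false_eq_true]
      congr 2
      have h6 : (c : ℕ) - k < k := by omega
      have h7 : (⟨(c : ℕ) + 1 - (k + 1), by omega⟩ : Fin (k + 1)) = Fin.castSucc ⟨c - k, h6⟩ := by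
        ext; simp
      rw [h7, Fin.snoc_castSucc]
  · simp only [Sum.elim_inr, finSumFinEquiv_apply_right, pairMap, LinearMap.pi_apply]
    fin_cases c
    · have h3 : Fin.cycleIcc x y (Fin.natAdd (2 * k) 0) = x := by
        have : (Fin.natAdd (2 * k) 0 : Fin (2 * k + 2)) = y := by ext; simp [y]
        rw [this]
        exact Fin.cycleIcc_of_last hxy
      have h4 : (x : ℕ) < k + 1 := by simp [x]
      simp only [Fin.zero_eta, h3, h4, dif_pos, Matrix.cons_val_zero]
      congr 2
      exact (Fin.snoc_last (α := fun _ => Fin n) j i).symm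
    · have h3 : Fin.cycleIcc x y (Fin.natAdd (2 * k) 1) = Fin.natAdd (2 * k) 1 :=
        Fin.cycleIcc_of_gt (by simp [y, Fin.lt_def])
      have h4 : ¬ (2 * k + 1 < k + 1 ) ∨ k = 0 := by omega
      have h5 : ¬ (2 * k + 1 < k + 1) := by omega
      simp only [Fin.mk_one, h3, Fin.val_natAdd, Fin.val_one, h5, dif_neg, not_false_eq_true,
        Matrix.cons_val_one, Matrix.cons_val_fin_one]
      congr 2
      have h7 : (⟨2 * k + 1 - (k + 1), by omega⟩ : Fin (k + 1)) = Fin.last k := by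
        ext; simp; omega
      rw [h7, Fin.snoc_last]

/-- The exponent of the sign is 0 + 1 + ⋯ + (k-1). The sum runs over all index functions; those with
a repetition contribute zero and need not be removed. -/
theorem wedgePow_eq_sum {w : V [⋀^Fin 2]→ₗ[ℝ] ℝ} {a b : Fin n → V →ₗ[ℝ] ℝ}
    (hw : w = ∑ i, detForm (LinearMap.pi ![a i, b i])) (k : ℕ) :
    wedgePow w k = (-1 : ℝ) ^ (k * (k - 1) / 2) • ∑ i : Fin k → Fin n, detForm (pairMap a b i) := by
  induction k with
  | zero =>
    ext v
    rw [wedgePow, AlternatingMap.smul_apply, sum_alternating_apply]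
    simp [detForm_apply]
  | succ k ih =>
    have h1 : (k + 1) * (k + 1 - 1) / 2 = k * (k - 1) / 2 + k := by
      have := Nat.triangle_succ k
      simpa [mul_comm] using this
    rw [wedgePow, ih, hw, wedge_eq_wedgeLin, ← TensorProduct.smul_tmul', map_smul,
      TensorProduct.sum_tmul, map_sum, h1, pow_add, mul_smul]
    congr 1
    simp only [TensorProduct.tmul_sum, map_sum, ← wedge_eq_wedgeLin, wedge_pairMap]
    rw [Finset.smul_sum, ← Fintype.sum_prod_type']
    exact Fintype.sum_equiv ((Equiv.prodComm _ _).trans (Fin.snocEquiv fun _ => Fin n)) _ _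
      fun x => rfl

/-- The value of `w^n` on a symplectic frame. -/
theorem wedgePow_apply_frame (B : Module.Basis (Fin n ⊕ Fin n) ℝ V) (w : V [⋀^Fin 2]→ₗ[ℝ] ℝ)
    (h1 : ∀ i j, w ![B (.inl i), B (.inr j)] = if i = j then 1 else 0)
    (h2 : ∀ i j, w ![B (.inr i), B (.inr j)] = 0) (v : Fin (2 * n) → V)
    (hv : ∀ r, v (finCongr (two_mul n).symm (finSumFinEquiv r)) = B r) :
    wedgePow w n v = (-1) ^ (n * (n - 1) / 2) * n.factorial := by
  classical
  set a : Fin n → V →ₗ[ℝ] ℝ := fun i => B.coord (.inl i) with ha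
  -- A Darboux coframe: `w` need not vanish on the first half of the basis, and half of its values
  -- there are absorbed into `b`, so that `w = ∑ a i ∧ b i`.
  set b : Fin n → V →ₗ[ℝ] ℝ := fun i =>
    B.coord (.inr i) + ∑ j, (w ![B (.inl i), B (.inl j)] / 2) • B.coord (.inl j) with hb
  have hal (i j) : a i (B (.inl j)) = if i = j then 1 else 0 := by
    simp [ha, Finsupp.single_apply, eq_comm]
  have har (i j) : a i (B (.inr j)) = 0 := by simp [ha]
  have hbr (i j) : b i (B (.inr j)) = if i = j then 1 else 0 := by
    simp [hb, Finsupp.single_apply, eq_comm]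
  have hbl (i j) : b i (B (.inl j)) = w ![B (.inl i), B (.inl j)] / 2 := by
    simp [hb, Finsupp.single_apply]
  have hsw (x y : V) : w ![x, y] = -w ![y, x] := by
    have := w.map_swap ![y, x] (i := 0) (j := 1) (by simp)
    rw [← this]
    congr 1
    ext i; fin_cases i <;> rfl
  have hw : w = ∑ i, detForm (LinearMap.pi ![a i, b i]) := by
    refine Module.Basis.ext_alternating B fun v _ => ?_
    have hv' : (fun i => B (v i)) = ![B (v 0), B (v 1)] := by
      ext i; fin_cases i <;> rfl
    rw [hv', sum_alternating_apply]
    simp only [detForm_apply, Matrix.det_fin_two, Matrix.of_apply, LinearMap.pi_apply,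
      Matrix.cons_val_zero, Matrix.cons_val_one, Matrix.cons_val_fin_one]
    rcases v 0 with i | i <;> rcases v 1 with j | j <;>
      simp only [hal, har, hbl, hbr, h1, h2, Finset.sum_sub_distrib, ite_mul, mul_ite, one_mul,
        zero_mul, mul_zero, mul_one, Finset.sum_ite_eq', Finset.mem_univ,
        if_true, sub_zero, zero_sub]
    · rw [hsw (B (.inl j)) (B (.inl i))]; ring
    · simp only [eq_comm]
    · rw [hsw, h1]
      simp [Finset.sum_neg_distrib]
  rw [wedgePow_eq_sum hw, AlternatingMap.smul_apply, sum_alternating_apply, smul_eq_mul]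
  congr 1
  -- The matrix is block triangular with the same 0-1 block twice on the diagonal. Its determinant
  -- is a square, which loses the sign of the permutation, so exactly the `n!` bijections count,
  -- each with value 1.
  have hdet (i : Fin n → Fin n) : detForm (pairMap a b i) v =
      if Function.Bijective i then 1 else 0 := by
    set C : Matrix (Fin n) (Fin n) ℝ := Matrix.of fun r c => if i c = r then 1 else 0
    have hC : C.det ^ 2 = if Function.Bijective i then 1 else 0 := by
      split_ifs with hi
      · have : C = (Equiv.Perm.permMatrix ℝ (Equiv.ofBijective i hi)⁻¹) := by
          ext r c
          simp only [C, Matrix.of_apply, Equiv.Perm.permMatrix, Equiv.toPEquiv_apply,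
            PEquiv.toMatrix_apply, Option.mem_def, Option.some.injEq]
          congr 1
          rw [Equiv.Perm.inv_eq_iff_eq]
          simp [eq_comm]
        rw [this, Matrix.det_permutation]
        rcases Int.units_eq_one_or (Equiv.Perm.sign (Equiv.ofBijective i hi)⁻¹) with h | h <;>
          simp [h]
      · have hni : ¬ Function.Injective i := fun h => hi (Finite.injective_iff_bijective.1 h)
        rw [Function.Injective] at hni
        push Not at hni
        obtain ⟨c, c', hcc, hne⟩ := hni
        rw [Matrix.det_zero_of_column_eq hne (by intro r; simp [C, hcc])]
        simp
    rw [detForm_apply, ← hC,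
      ← Matrix.det_submatrix_equiv_self (finSumFinEquiv.trans (finCongr (two_mul n).symm))]
    have : (Matrix.of fun r => pairMap a b i (v r)).submatrix
        (finSumFinEquiv.trans (finCongr (two_mul n).symm))
        (finSumFinEquiv.trans (finCongr (two_mul n).symm)) =
        Matrix.fromBlocks C (Matrix.of fun r c => b (i c) (B (.inl r))) 0 C := by
      ext r c
      simp only [Matrix.submatrix_apply, Equiv.trans_apply, Matrix.of_apply, hv]
      rcases c with c | c
      · have hc : ((finCongr (two_mul n).symm (finSumFinEquiv (Sum.inl c)) : Fin (2 * n)) : ℕ) < n := by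
          simp
        simp only [pairMap, LinearMap.pi_apply, hc, dif_pos]
        rcases r with r | r <;> simp [hal, har, C]
      · have hc : ¬ ((finCongr (two_mul n).symm (finSumFinEquiv (Sum.inr c)) : Fin (2 * n)) : ℕ) < n := by
          simp
        simp only [pairMap, LinearMap.pi_apply, hc, dif_neg, not_false_eq_true]
        rcases r with r | r <;> simp [hbr, C]
    rw [this, Matrix.det_fromBlocks_zero₂₁, sq]
  simp only [hdet, Finset.sum_boole]
  norm_cast
  rw [← Fintype.card_subtype, ← Fintype.card_fin n, ← Fintype.card_perm, Fintype.card_fin]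
  exact Fintype.card_congr (Equiv.ofBijective
    (fun i : {i : Fin n → Fin n // Function.Bijective i} => Equiv.ofBijective i.1 i.2)
    ⟨fun i j h => Subtype.ext (funext fun x => DFunLike.congr_fun h x),
      fun σ => ⟨⟨σ, σ.bijective⟩, by ext; rfl⟩⟩)

end WedgePow

/-! ### The symplectic form `ω = -dθ` -/

section Symplectic

theorem extDeriv_ofSubsingleton_apply {V : Type*} [NormedAddCommGroup V] [NormedSpace ℝ V]
    {c : V → V →L[ℝ] ℝ} {c' : V →L[ℝ] V →L[ℝ] ℝ} {z : V} (hc : HasFDerivAt c c' z) (v w : V) :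
    extDeriv (fun z => ContinuousAlternatingMap.ofSubsingleton ℝ V ℝ (0 : Fin 1) (c z)) z ![v, w] =
      c' v w - c' w v := by
  have h := (ContinuousAlternatingMap.ofSubsingletonLIE (𝕜 := ℝ) (E := V) (F := ℝ)
    (0 : Fin 1)).toContinuousLinearEquiv.toContinuousLinearMap.hasFDerivAt.comp z hc
  have h1 : HasFDerivAt (fun z => ContinuousAlternatingMap.ofSubsingleton ℝ V ℝ (0 : Fin 1) (c z))
    _ z := h
  rw [extDeriv, h1.fderiv, ContinuousAlternatingMap.alternatizeUncurryFin_apply, Fin.sum_univ_two]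
  simp [sub_eq_add_neg]
  rfl

theorem hasD_extChartAt_symm {E M : Type*} [NormedAddCommGroup E] [NormedSpace ℝ E]
    [TopologicalSpace M] [ChartedSpace E M] [IsManifold 𝓘(ℝ, E) ∞ M] (x : M) :
    HasD 𝓘(ℝ, E) 𝓘(ℝ, E) (extChartAt 𝓘(ℝ, E) x).symm (extChartAt 𝓘(ℝ, E) x x) (.id ℝ E) := by
  rw [hasD_from_space_iff]
  refine ⟨(contMDiffAt_extChartAt_symm x (mem_extChartAt_target x)).continuousAt, ?_⟩
  rw [extChartAt_to_inv]
  refine (hasFDerivAt_id _).congr_of_eventuallyEq ?_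
  filter_upwards [extChartAt_target_mem_nhds (I := 𝓘(ℝ, E)) x] with w hw
  exact (extChartAt 𝓘(ℝ, E) x).right_inv hw

variable {E : Type*} [NormedAddCommGroup E] [NormedSpace ℝ E]
  {K : Type*} [TopologicalSpace K] [ChartedSpace E K] [Group K] [LieGroup 𝓘(ℝ, E) ∞ K]

/-- In the chart at `x`, the left Maurer–Cartan form is a differentiable function. -/
theorem exists_maurerCartan_chart (x : K) : ∃ c : E → E →L[ℝ] E,
    DifferentiableAt ℝ c (extChartAt 𝓘(ℝ, E) x x) ∧
    c (extChartAt 𝓘(ℝ, E) x x) = maurerCartan x ∧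
    ∀ᶠ a in 𝓝 (extChartAt 𝓘(ℝ, E) x x), ∃ L : E →L[ℝ] E,
      HasD 𝓘(ℝ, E) 𝓘(ℝ, E) (extChartAt 𝓘(ℝ, E) x).symm a L ∧
      c a = (maurerCartan ((extChartAt 𝓘(ℝ, E) x).symm a)).comp L := by
  have : IsManifold 𝓘(ℝ, E) ∞ K := inferInstance
  set e := extChartAt 𝓘(ℝ, E) x x with he
  set ψ := (extChartAt 𝓘(ℝ, E) x).symm with hψ
  have hψe : ψ e = x := extChartAt_to_inv (I := 𝓘(ℝ, E)) x
  have hψs {a : E} (ha : a ∈ (extChartAt 𝓘(ℝ, E) x).target) :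
      ContMDiffAt 𝓘(ℝ, E) 𝓘(ℝ, E) ∞ ψ a := contMDiffAt_extChartAt_symm x ha
  -- The derivative of `g` in its second variable along the diagonal is the Maurer–Cartan form in
  -- coordinates, so smoothness of `g` gives differentiability of the form.
  set g : E × E → E := fun q => extChartAt 𝓘(ℝ, E) (1 : K) ((ψ q.1)⁻¹ * ψ q.2) with hg
  have hgd {a : E} (ha : a ∈ (extChartAt 𝓘(ℝ, E) x).target) : ContDiffAt ℝ ∞ g (a, a) := by
    refine contDiffAt_chart_comp ?_ (by simp)
    exact (ContMDiffAt.comp (g := ψ) (f := Prod.fst) (a, a) (hψs ha)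
      contDiffAt_fst.contMDiffAt).inv.mul
      (ContMDiffAt.comp (g := ψ) (f := Prod.snd) (a, a) (hψs ha) contDiffAt_snd.contMDiffAt)
  have hc (a : E) (ha : a ∈ (extChartAt 𝓘(ℝ, E) x).target) (L : E →L[ℝ] E)
      (hL : HasD 𝓘(ℝ, E) 𝓘(ℝ, E) ψ a L) :
      (fderiv ℝ g (a, a)).comp (.inr ℝ E E) = (maurerCartan (ψ a)).comp L := by
    have h1 := hL.maurerCartan_comp
    have h2 := (hasD_chart (E := E) (G := K)).comp_of_eq h1 (by simp)
    rw [ContinuousLinearMap.id_comp, hasD_iff_hasFDerivAt] at h2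
    have h3 := HasFDerivAt.comp (g := g) (f := fun b : E => (a, b)) a
      ((hgd ha).differentiableAt (by simp)).hasFDerivAt (hasFDerivAt_prodMk_right a a)
    exact h3.unique h2
  refine ⟨fun a => (fderiv ℝ g (a, a)).comp (.inr ℝ E E), ?_, ?_, ?_⟩
  · have h1 : DifferentiableAt ℝ (fderiv ℝ g) (e, e) :=
      ((hgd (mem_extChartAt_target x)).fderiv_right (m := 1) (by norm_cast)).differentiableAt
        (by simp)
    have h2 : DifferentiableAt ℝ (fun a => fderiv ℝ g (a, a)) e :=
      DifferentiableAt.comp (g := fderiv ℝ g) (f := fun a : E => (a, a)) e h1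
        (differentiableAt_id.prodMk differentiableAt_id)
    exact h2.clm_comp (differentiableAt_const _)
  · have h1 := hc e (mem_extChartAt_target x) _ (hasD_extChartAt_symm x)
    rw [hψe] at h1
    exact h1
  · filter_upwards [extChartAt_target_mem_nhds (I := 𝓘(ℝ, E)) x] with a ha
    obtain ⟨L, hL⟩ := exists_hasD ((hψs ha).mdifferentiableAt (by simp))
    exact ⟨L, hL, hc a ha L hL⟩

variable {𝔨 : Type*} [NormedAddCommGroup 𝔨] [InnerProductSpace ℝ 𝔨]
  {K : Type*} [TopologicalSpace K] [ChartedSpace 𝔨 K] [Group K] [LieGroup 𝓘(ℝ, 𝔨) ∞ K]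

/-- Product rule for ⟨Y, c(z)v⟩, where `c` is the Maurer–Cartan form in the chart. Its derivative
`c'` is left unspecified, because it pairs only the two `K`-components and drops out as soon as one
vector is vertical. -/
theorem exists_omega_eq (p : K × 𝔨) : ∃ c' : 𝔨 →L[ℝ] 𝔨 →L[ℝ] 𝔨, ∀ v w : 𝔨 × 𝔨,
    omega p ![v, w] = (⟪w.2, maurerCartan p.1 v.1⟫_ℝ + ⟪p.2, c' w.1 v.1⟫_ℝ) -
      (⟪v.2, maurerCartan p.1 w.1⟫_ℝ + ⟪p.2, c' v.1 w.1⟫_ℝ) := by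
  obtain ⟨x, Y⟩ := p
  obtain ⟨c, hc, hcx, hcL⟩ := exists_maurerCartan_chart (E := 𝔨) x
  refine ⟨fderiv ℝ c (extChartAt 𝓘(ℝ, 𝔨) x x), fun v w => ?_⟩
  have hz : extChartAt (𝓘(ℝ, 𝔨).prod 𝓘(ℝ, 𝔨)) (x, Y) (x, Y) = (extChartAt 𝓘(ℝ, 𝔨) x x, Y) := by
    rw [extChartAt_prod, extChartAt_model_space_eq_id]; rfl
  have hs (z : 𝔨 × 𝔨) : (extChartAt (𝓘(ℝ, 𝔨).prod 𝓘(ℝ, 𝔨)) (x, Y)).symm z =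
      ((extChartAt 𝓘(ℝ, 𝔨) x).symm z.1, z.2) := by
    rw [extChartAt_prod, extChartAt_model_space_eq_id]; rfl
  have hf : HasFDerivAt (fun z : 𝔨 × 𝔨 => (innerSL ℝ z.2).comp ((c z.1).comp
      (ContinuousLinearMap.fst ℝ 𝔨 𝔨))) _ (extChartAt 𝓘(ℝ, 𝔨) x x, Y) :=
    ((innerSL ℝ (E := 𝔨)).hasFDerivAt.comp (extChartAt 𝓘(ℝ, 𝔨) x x, Y) hasFDerivAt_snd).clm_comp
      ((HasFDerivAt.comp (g := c) (extChartAt 𝓘(ℝ, 𝔨) x x, Y) hc.hasFDerivAt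
        hasFDerivAt_fst).clm_comp (hasFDerivAt_const (ContinuousLinearMap.fst ℝ 𝔨 𝔨) _))
  have key : omega (x, Y) = -extDeriv (fun z : 𝔨 × 𝔨 => ContinuousAlternatingMap.ofSubsingleton ℝ
      (𝔨 × 𝔨) ℝ (0 : Fin 1) ((innerSL ℝ z.2).comp ((c z.1).comp
        (ContinuousLinearMap.fst ℝ 𝔨 𝔨)))) (extChartAt 𝓘(ℝ, 𝔨) x x, Y) := by
    rw [omega, extD, hz]
    congr 1
    refine Filter.EventuallyEq.extDeriv_eq ?_
    have h1 := (continuous_fst.tendsto (extChartAt 𝓘(ℝ, 𝔨) x x, Y)).eventually hcL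
    filter_upwards [h1] with z hzL
    obtain ⟨L, hL, hcz⟩ := hzL
    have hD : HasD 𝓘(ℝ, 𝔨 × 𝔨) (𝓘(ℝ, 𝔨).prod 𝓘(ℝ, 𝔨))
        (fun z' => (extChartAt (𝓘(ℝ, 𝔨).prod 𝓘(ℝ, 𝔨)) (x, Y)).symm z') z
        ((L.comp (.fst ℝ 𝔨 𝔨)).prod (.snd ℝ 𝔨 𝔨)) := by
      simp only [hs]
      exact (hL.comp_of_eq (hasD_iff_hasFDerivAt.2 hasFDerivAt_fst) rfl).prodMk
        (hasD_iff_hasFDerivAt.2 hasFDerivAt_snd)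
    rw [hD.mfderiv_eq, hs]
    ext t
    simp [theta, hcz]
  rw [key, ContinuousAlternatingMap.neg_apply, extDeriv_ofSubsingleton_apply hf]
  simp only [ContinuousLinearMap.comp_zero, zero_add, add_apply, ContinuousLinearMap.comp_apply,
    ContinuousLinearMap.flip_apply, ContinuousLinearMap.compL_apply, Function.comp_apply, hcx,
    ContinuousLinearMap.coe_fst', ContinuousLinearMap.coe_snd']
  have h (a b c d : ℝ) : -(a + b - (c + d)) = d + c - (b + a) := by ring
  exact h _ _ _ _

theorem omega_vertical_right (p : K × 𝔨) (u A : 𝔨) :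
    omega p ![(u, 0), (0, A)] = ⟪A, maurerCartan p.1 u⟫_ℝ := by
  obtain ⟨c, hc⟩ := exists_omega_eq p
  rw [hc]; simp

theorem omega_vertical (p : K × 𝔨) (A B : 𝔨) : omega p ![((0 : 𝔨), A), (0, B)] = 0 := by
  obtain ⟨c, hc⟩ := exists_omega_eq p
  rw [hc]; simp

end Symplectic

/-! ### The Liouville form on the frame and the quotient of top forms -/

section Frame

variable {𝔨 : Type*} [NormedAddCommGroup 𝔨] [InnerProductSpace ℝ 𝔨] [FiniteDimensional ℝ 𝔨]
  {K : Type*} [TopologicalSpace K] [ChartedSpace 𝔨 K] [Group K] [LieGroup 𝓘(ℝ, 𝔨) ∞ K]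
  {n : ℕ}

/-- Left translation `T_1 K → T_x K`. -/
def leftInvEquiv (x : K) : 𝔨 ≃ₗ[ℝ] 𝔨 :=
  LinearEquiv.ofInjectiveEndo
    (mfderiv 𝓘(ℝ, 𝔨) 𝓘(ℝ, 𝔨) (fun y : K => x * y) 1 : 𝔨 →L[ℝ] 𝔨).toLinearMap
    (Function.LeftInverse.injective (g := maurerCartan x) (maurerCartan_leftInv x))

theorem leftInvEquiv_apply (x : K) (Y : 𝔨) : leftInvEquiv x Y = leftInv x Y := rfl

/-- The frame at `p`, as a basis of the tangent space. -/
def frameBasis (X : OrthonormalBasis (Fin n) ℝ 𝔨) (p : K × 𝔨) :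
    Module.Basis (Fin n ⊕ Fin n) ℝ (𝔨 × 𝔨) :=
  (X.toBasis.map (leftInvEquiv p.1)).prod X.toBasis

theorem frameBasis_inl (X : OrthonormalBasis (Fin n) ℝ 𝔨) (p : K × 𝔨) (i : Fin n) :
    frameBasis X p (.inl i) = (leftInv p.1 (X i), 0) := by
  simp [frameBasis, leftInvEquiv_apply]

theorem frameBasis_inr (X : OrthonormalBasis (Fin n) ℝ 𝔨) (p : K × 𝔨) (i : Fin n) :
    frameBasis X p (.inr i) = (0, X i) := by
  simp [frameBasis]

theorem frame_finSumFinEquiv (X : OrthonormalBasis (Fin n) ℝ 𝔨) (p : K × 𝔨) (r : Fin n ⊕ Fin n) :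
    frame X p (finSumFinEquiv r) = frameBasis X p r := by
  rcases r with i | i
  · simp [frame, frameBasis_inl]
  · rw [finSumFinEquiv_apply_right, frame, Fin.append_right, frameBasis_inr]

theorem liouvilleForm_frame (X : OrthonormalBasis (Fin n) ℝ 𝔨) (p : K × 𝔨) :
    liouvilleForm n p (frame X p) = (-1) ^ (n * (n - 1) / 2) := by
  have h := wedgePow_apply_frame (frameBasis X p) (omega p).toAlternatingMap
    (fun i j => by
      rw [frameBasis_inl, frameBasis_inr]
      refine (omega_vertical_right p _ _).trans ?_
      rw [maurerCartan_leftInv, orthonormal_iff_ite.1 X.orthonormal]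
      simp only [eq_comm])
    (fun i j => by
      rw [frameBasis_inr, frameBasis_inr]
      exact omega_vertical p _ _)
    (fun i => frame X p (finCongr (two_mul n) i))
    (fun r => by
      rw [← frame_finSumFinEquiv]
      congr 1)
  have h0 : liouvilleForm n p (frame X p) = (n.factorial : ℝ)⁻¹ *
    wedgePow (omega p).toAlternatingMap n (fun i => frame X p (finCongr (two_mul n) i)) := rfl
  rw [h0, h]
  field_simp

theorem abs_liouvilleForm_frame (X : OrthonormalBasis (Fin n) ℝ 𝔨) (p : K × 𝔨) :
    |liouvilleForm n p (frame X p)| = 1 := by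
  rw [liouvilleForm_frame]; simp

theorem bConst_mul_liouvilleForm (X : OrthonormalBasis (Fin n) ℝ 𝔨) (p : K × 𝔨) :
    bConst n * (liouvilleForm n p (frame X p) : ℂ) = (2 * Complex.I) ^ n := by
  rw [liouvilleForm_frame, bConst]
  push_cast
  rw [mul_assoc, ← mul_pow]
  simp

variable {𝔤 : Type*} [NormedAddCommGroup 𝔤] [NormedSpace ℂ 𝔤] [FiniteDimensional ℂ 𝔤]
  {G : Type*} [TopologicalSpace G] [ChartedSpace 𝔤 G] [Group G] [T2Space G]
  [LieGroup 𝓘(ℂ, 𝔤) ω G] [LieGroup 𝓘(ℝ, 𝔤) ∞ G]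
  {ι : K →* G}

theorem adMat_conj (X : OrthonormalBasis (Fin n) ℝ 𝔨) (Y : 𝔨) (i j : Fin n) :
    conj (adMat K X Y i j) = -adMat K X Y i j := by
  simp [adMat]

/-- The numerator is the transposed block determinant of `det_blocks_eq`, equal to iⁿ(s+s')ⁿ times
the sinhc product; the denominator is (2i)ⁿ. -/
theorem ratio_eq_of_diagonalization (hι : IsComplexification 𝔨 𝔤 ι)
    (X : OrthonormalBasis (Fin n) ℝ 𝔨) {Y : 𝔨} (htr : (adMat K X Y).trace = 0)
    {P P' : Matrix (Fin n) (Fin n) ℂ} {l : Fin n → ℝ}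
    (hP : adMat K X Y * P = P * Matrix.diagonal fun j => (l j : ℂ))
    (h1 : P' * P = 1) (h2 : P * P' = 1) (s s' : ℝ) (x : K) :
    ratio 𝔤 ι X s s' (x, Y) =
      ((((s + s') / 2) ^ n * ∏ j, sinhc ((s + s') / 2 * l j) : ℝ) : ℂ) := by
  obtain ⟨W, Q, hW0, hQ0, hW, hQ, hfW, hfQ⟩ := exists_etaForm_eq hι X Y
  have hdet := det_blocks_eq (adMat_conj X Y) htr hP h1 h2 hW0 hQ0 hW hQ s s'
  have hM : (Matrix.of fun k : Fin n ⊕ Fin n => (Sum.elim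
      ((LinearMap.pi fun i => (Complex.conjAe.toLinearMap.comp (LinearMap.proj i)).comp
        (etaForm 𝔤 ι X s (x, Y))) (frame X (x, Y) (finSumFinEquiv k)))
      (etaForm 𝔤 ι X s' (x, Y) (frame X (x, Y) (finSumFinEquiv k))) : Fin n ⊕ Fin n → ℂ)) =
      (Matrix.fromBlocks ((W s).map conj) ((Q s).map conj) (W s') (Q s')).transpose := by
    ext k j
    rw [Matrix.of_apply, frame_finSumFinEquiv, Matrix.transpose_apply]
    rcases k with k | k <;> rcases j with j | j
    · rw [frameBasis_inl]
      simp only [Sum.elim_inl, Matrix.fromBlocks_apply₁₁, Matrix.map_apply, ← hfW s x]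
      rfl
    · rw [frameBasis_inl]
      simp only [Sum.elim_inr, Matrix.fromBlocks_apply₂₁, ← hfW s' x]
    · rw [frameBasis_inr]
      simp only [Sum.elim_inl, Matrix.fromBlocks_apply₁₂, Matrix.map_apply, ← hfQ s x]
      rfl
    · rw [frameBasis_inr]
      simp only [Sum.elim_inr, Matrix.fromBlocks_apply₂₂, ← hfQ s' x]
  rw [ratio, bConst_mul_liouvilleForm, Om, Om, wedgeAll_eq_detForm, wedgeAll_eq_detForm,
    conjForm_detForm, wedge_detForm, hM, Matrix.det_transpose, hdet]
  push_cast
  rw [div_pow, mul_pow]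
  have := Complex.I_ne_zero
  field_simp

end Frame

/-! ### Consequences of the invariance of the inner product -/

section Invariance

variable {𝔨 : Type*} [NormedAddCommGroup 𝔨] [InnerProductSpace ℝ 𝔨] [FiniteDimensional ℝ 𝔨]
  {K : Type*} [TopologicalSpace K] [ChartedSpace 𝔨 K] [Group K] [LieGroup 𝓘(ℝ, 𝔨) ∞ K]
  {n : ℕ}

/-- Derivative at `x = 1` of the constant function ⟨Ad x Z, Ad x W⟩. Skewness of `ad Y` makes
`adMat` hermitian and traceless. -/
theorem inner_lieBr_left (hAd : ∀ (x : K) (Y Z : 𝔨), ⟪Ad x Y, Ad x Z⟫_ℝ = ⟪Y, Z⟫_ℝ) (Y Z W : 𝔨) :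
    ⟪lieBr K Y Z, W⟫_ℝ = -⟪Z, lieBr K Y W⟫_ℝ := by
  have h := (hasD_to_space_iff.1 (hasD_Ad_adL (E := 𝔨) (G := K))).2
  have h1 := ((h.clm_apply (hasFDerivAt_const Z _)).inner ℝ (h.clm_apply (hasFDerivAt_const W _)))
  simp only [hAd] at h1
  have h2 := DFunLike.congr_fun (h1.unique (hasFDerivAt_const _ _)) Y
  simp [adL_apply, Ad_one] at h2
  linarith

theorem adMat_trace (hAd : ∀ (x : K) (Y Z : 𝔨), ⟪Ad x Y, Ad x Z⟫_ℝ = ⟪Y, Z⟫_ℝ)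
    (X : OrthonormalBasis (Fin n) ℝ 𝔨) (Y : 𝔨) : (adMat K X Y).trace = 0 := by
  refine Finset.sum_eq_zero fun i _ => ?_
  have h := inner_lieBr_left hAd Y (X i) (X i)
  rw [real_inner_comm] at h
  have h' : ⟪X i, lieBr K Y (X i)⟫_ℝ = 0 := by linarith
  simp [adMat, h']

theorem adMat_isHermitian (hAd : ∀ (x : K) (Y Z : 𝔨), ⟪Ad x Y, Ad x Z⟫_ℝ = ⟪Y, Z⟫_ℝ)
    (X : OrthonormalBasis (Fin n) ℝ 𝔨) (Y : 𝔨) : (adMat K X Y).IsHermitian := by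
  ext i j
  have h := inner_lieBr_left hAd Y (X i) (X j)
  rw [real_inner_comm] at h
  simp [adMat, h]

end Invariance

/-! ### The determinant of `sinh M / M` -/

section SinhcDet

variable {n : ℕ}

theorem integral_exp_mul_div_two (l : ℝ) :
    ∫ r in (-1 : ℝ)..1, Complex.exp (r * l) / 2 = (sinhc l : ℂ) := by
  by_cases hl : l = 0
  · subst hl; norm_num [sinhc]
  · have hl' : (l : ℂ) ≠ 0 := by exact_mod_cast hl
    simp only [mul_comm _ (l : ℂ)]
    rw [intervalIntegral.integral_div, integral_exp_mul_complex hl', sinhc, if_neg hl]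
    push_cast
    rw [Complex.sinh]
    simp only [mul_one, mul_neg]
    field_simp

/-- The determinant of `sinh M / M`, where `sinh M / M = ½ ∫_{-1}^1 exp (r M) dr`. -/
def sinhcDet (M : Matrix (Fin n) (Fin n) ℂ) : ℂ :=
  (Matrix.of fun i j => ∫ r in (-1 : ℝ)..1, NormedSpace.exp ((r : ℂ) • M) i j / 2).det

theorem sinhcDet_eq {M P P' : Matrix (Fin n) (Fin n) ℂ} {l : Fin n → ℝ}
    (hP : M * P = P * Matrix.diagonal fun j => (l j : ℂ)) (h1 : P' * P = 1) (h2 : P * P' = 1) :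
    sinhcDet M = ((∏ j, sinhc (l j) : ℝ) : ℂ) := by
  have hP' : P' = P⁻¹ := (Matrix.inv_eq_left_inv h1).symm
  have hU : IsUnit P := ⟨⟨P, P', h2, h1⟩, rfl⟩
  have hM : M = P * (Matrix.diagonal fun j => (l j : ℂ)) * P' := by
    rw [← hP, mul_assoc, h2, mul_one]
  have hexp (r : ℝ) : NormedSpace.exp ((r : ℂ) • M) =
      P * (Matrix.diagonal fun j => Complex.exp (r * l j)) * P' := by
    rw [hM, ← smul_mul_assoc, ← mul_smul_comm, hP', Matrix.exp_conj _ _ hU, ← Matrix.diagonal_smul,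
      Matrix.exp_diagonal]
    congr 3
    funext j
    rw [Pi.coe_exp, Complex.exp_eq_exp_ℂ]
    rfl
  have hint : (Matrix.of fun i j => ∫ r in (-1 : ℝ)..1, NormedSpace.exp ((r : ℂ) • M) i j / 2) =
      P * (Matrix.diagonal fun j => (sinhc (l j) : ℂ)) * P' := by
    ext i j
    simp only [hexp, Matrix.of_apply]
    simp only [Matrix.mul_apply (M := _ * _), Matrix.mul_diagonal, Finset.sum_div]
    rw [intervalIntegral.integral_finsetSum]
    · refine Finset.sum_congr rfl fun k _ => ?_
      rw [← integral_exp_mul_div_two, ← intervalIntegral.integral_const_mul,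
        ← intervalIntegral.integral_mul_const]
      refine intervalIntegral.integral_congr fun r _ => ?_
      ring
    · intro k _
      refine Continuous.intervalIntegrable ?_ _ _
      fun_prop
  rw [sinhcDet, hint, Matrix.det_mul, Matrix.det_mul, Matrix.det_diagonal, mul_right_comm,
    ← Matrix.det_mul, h2, Matrix.det_one, one_mul]
  push_cast
  rfl

section
open scoped Matrix.Norms.Operator

theorem continuous_matrix_exp :
    Continuous (NormedSpace.exp : Matrix (Fin n) (Fin n) ℂ → Matrix (Fin n) (Fin n) ℂ) :=
  NormedSpace.exp_continuous

end

/-- The integral of matrix exponentials depends continuously on the matrix, so continuity of `η`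
follows without following eigenvalues or Cartan subalgebras. -/
theorem continuous_sinhcDet : Continuous (sinhcDet (n := n)) := by
  refine Continuous.matrix_det ?_
  refine continuous_matrix fun i j => ?_
  refine intervalIntegral.continuous_parametric_intervalIntegral_of_continuous' ?_ _ _
  refine Continuous.div_const ?_ _
  refine Continuous.matrix_elem ?_ i j
  refine continuous_matrix_exp.comp ?_
  exact (Complex.continuous_ofReal.comp continuous_snd).smul continuous_fst

end SinhcDet

/-! ### Simultaneous diagonalization -/

section JointDiagonalization

variable {n : ℕ}

/-- Commuting hermitian matrices are simultaneously diagonalizable. -/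
theorem exists_joint_diagonalization {ι : Type*} (T : ι → Matrix (Fin n) (Fin n) ℂ)
    (hT : ∀ i, (T i).IsHermitian) (hc : ∀ i j, Commute (T i) (T j)) :
    ∃ (P P' : Matrix (Fin n) (Fin n) ℂ) (χ : Fin n → ι → ℝ), P' * P = 1 ∧ P * P' = 1 ∧
      ∀ i, T i * P = P * Matrix.diagonal fun j => (χ j i : ℂ) := by
  set T' : ι → EuclideanSpace ℂ (Fin n) →ₗ[ℂ] EuclideanSpace ℂ (Fin n) :=
    fun i => Matrix.toEuclideanLin (T i) with hT'
  have hsym (i : ι) : (T' i).IsSymmetric := Matrix.isSymmetric_toEuclideanLin_iff.2 (hT i)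
  have hcomm : Pairwise (Function.onFun Commute T') := by
    intro i j _
    refine LinearMap.ext fun v => ?_
    have h := congrArg (fun A : Matrix (Fin n) (Fin n) ℂ => A.mulVec v.ofLp) (hc i j).eq
    simp only [← Matrix.mulVec_mulVec] at h
    simp [hT', Matrix.toLpLin_apply, h]
  -- Joint eigenvectors span, so a basis can be extracted from them; its vectors become the columns
  -- of `P`.
  set S : Set (EuclideanSpace ℂ (Fin n)) := {v | ∃ χ : ι → ℂ, ∀ i, T' i v = χ i • v} with hS
  have hspan : ⊤ ≤ Submodule.span ℂ S := by
    rw [← LinearMap.IsSymmetric.iSup_iInf_eq_top_of_commute hsym hcomm]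
    refine iSup_le fun χ v hv => Submodule.subset_span ⟨χ, fun i => ?_⟩
    exact Module.End.mem_eigenspace_iff.1 ((Submodule.mem_iInf _).1 hv i)
  set b₀ := Module.Basis.ofSpan hspan
  set c := (EuclideanSpace.basisFun (Fin n) ℂ).toBasis with hc
  set b := b₀.reindex (b₀.indexEquiv c)
  have hb (j : Fin n) : ∃ χ : ι → ℝ, ∀ i, T' i (b j) = (χ i : ℂ) • b j := by
    have h1 : b j ∈ S := by
      refine Module.Basis.ofSpan_subset hspan ?_
      rw [Module.Basis.reindex_apply]
      exact Set.mem_range_self _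
    obtain ⟨χ, hχ⟩ := h1
    refine ⟨fun i => (χ i).re, fun i => ?_⟩
    have h2 : Module.End.HasEigenvalue (T' i) (χ i) :=
      Module.End.hasEigenvalue_of_hasEigenvector
        ⟨Module.End.mem_eigenspace_iff.2 (hχ i), b.ne_zero j⟩
    have h3 := (hsym i).conj_eigenvalue_eq_self h2
    rw [hχ i, Complex.conj_eq_iff_re.1 h3]
  choose χ hχ using hb
  refine ⟨c.toMatrix b, b.toMatrix c, χ, Module.Basis.toMatrix_mul_toMatrix_flip _ _,
    Module.Basis.toMatrix_mul_toMatrix_flip _ _, fun i => ?_⟩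
  ext r j
  have h := congrArg (fun v : EuclideanSpace ℂ (Fin n) => v r) (hχ j i)
  simp only [Matrix.mul_diagonal]
  rw [mul_comm]
  exact h

end JointDiagonalization

/-! ### Complex vectors `A + iB` and the action of `i ad Y` -/

section AdMatrix

variable {𝔨 : Type*} [NormedAddCommGroup 𝔨] [InnerProductSpace ℝ 𝔨] [FiniteDimensional ℝ 𝔨]
  {K : Type*} [TopologicalSpace K] [ChartedSpace 𝔨 K] [Group K] [LieGroup 𝓘(ℝ, 𝔨) ∞ K]
  {n : ℕ}

theorem lieBr_add_left (Y Y' Z : 𝔨) : lieBr K (Y + Y') Z = lieBr K Y Z + lieBr K Y' Z := by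
  simp [← adL_apply]

theorem lieBr_real_smul_left (a : ℝ) (Y Z : 𝔨) : lieBr K (a • Y) Z = a • lieBr K Y Z := by
  simp [← adL_apply]

theorem lieBr_add_right (Y Z Z' : 𝔨) : lieBr K Y (Z + Z') = lieBr K Y Z + lieBr K Y Z' := by
  simp [← adL_apply]

theorem lieBr_sub_right (Y Z Z' : 𝔨) : lieBr K Y (Z - Z') = lieBr K Y Z - lieBr K Y Z' := by
  simp [← adL_apply]

theorem lieBr_neg_left (Y Z : 𝔨) : lieBr K (-Y) Z = -lieBr K Y Z := by
  simp [← adL_apply]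

theorem lieBr_neg_right (Y Z : 𝔨) : lieBr K Y (-Z) = -lieBr K Y Z := by
  simp [← adL_apply]

theorem lieBr_real_smul_right (a : ℝ) (Y Z : 𝔨) : lieBr K Y (a • Z) = a • lieBr K Y Z := by
  simp [← adL_apply]

theorem lieBr_self (Y : 𝔨) : lieBr K Y Y = 0 := by
  have h := lieBr_skew (G := K) Y Y
  have h2 : (2 : ℝ) • lieBr K Y Y = 0 := by
    rw [two_smul]; nth_rewrite 1 [h]; simp
  exact (smul_eq_zero.1 h2).resolve_left (by norm_num)

theorem adMat_add (X : OrthonormalBasis (Fin n) ℝ 𝔨) (Y Y' : 𝔨) :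
    adMat K X (Y + Y') = adMat K X Y + adMat K X Y' := by
  ext i j
  simp [adMat, lieBr_add_left, inner_add_right, mul_add]

theorem adMat_smul (X : OrthonormalBasis (Fin n) ℝ 𝔨) (a : ℝ) (Y : 𝔨) :
    adMat K X (a • Y) = (a : ℂ) • adMat K X Y := by
  ext i j
  simp [adMat, lieBr_real_smul_left, inner_smul_right]
  ring

/-- The complex coordinates of `A + iB`. -/
def cvec (X : OrthonormalBasis (Fin n) ℝ 𝔨) (A B : 𝔨) : Fin n → ℂ :=
  fun j => ⟨⟪X j, A⟫_ℝ, ⟪X j, B⟫_ℝ⟩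

theorem eq_of_inner_basis_eq (X : OrthonormalBasis (Fin n) ℝ 𝔨) {A B : 𝔨}
    (h : ∀ j, ⟪X j, A⟫_ℝ = ⟪X j, B⟫_ℝ) : A = B := by
  rw [← X.sum_repr' A, ← X.sum_repr' B]
  simp only [h]

theorem cvec_inj (X : OrthonormalBasis (Fin n) ℝ 𝔨) {A B A' B' : 𝔨}
    (h : cvec X A B = cvec X A' B') : A = A' ∧ B = B' :=
  ⟨eq_of_inner_basis_eq X fun j => congrArg Complex.re (congrFun h j),
    eq_of_inner_basis_eq X fun j => congrArg Complex.im (congrFun h j)⟩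

theorem exists_cvec_eq (X : OrthonormalBasis (Fin n) ℝ 𝔨) (v : Fin n → ℂ) :
    ∃ A B : 𝔨, cvec X A B = v := by
  refine ⟨∑ j, (v j).re • X j, ∑ j, (v j).im • X j, ?_⟩
  funext i
  simp [cvec, inner_sum, inner_smul_right, orthonormal_iff_ite.1 X.orthonormal]

theorem cvec_zero (X : OrthonormalBasis (Fin n) ℝ 𝔨) : cvec X (0 : 𝔨) 0 = 0 := by
  funext i; simp [cvec]; rfl

theorem sum_inner_mul_lieBr (X : OrthonormalBasis (Fin n) ℝ 𝔨) (Y A : 𝔨) (i : Fin n) :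
    ∑ j, ⟪X i, lieBr K Y (X j)⟫_ℝ * ⟪X j, A⟫_ℝ = ⟪X i, lieBr K Y A⟫_ℝ := by
  conv_rhs => rw [← X.sum_repr' A, ← adL_apply, map_sum, inner_sum]
  refine Finset.sum_congr rfl fun j _ => ?_
  rw [map_smul, inner_smul_right, adL_apply]
  ring

theorem adMat_mulVec_cvec (X : OrthonormalBasis (Fin n) ℝ 𝔨) (Y A B : 𝔨) :
    (adMat K X Y).mulVec (cvec X A B) = cvec X (-lieBr K Y B) (lieBr K Y A) := by
  funext i
  simp only [Matrix.mulVec, dotProduct, adMat, Matrix.of_apply, cvec]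
  apply Complex.ext
  · rw [Complex.re_sum]
    simp only [inner_neg_right, ← sum_inner_mul_lieBr X Y B, ← Finset.sum_neg_distrib]
    exact Finset.sum_congr rfl fun j _ => by simp
  · rw [Complex.im_sum]
    simp only [← sum_inner_mul_lieBr X Y A]
    exact Finset.sum_congr rfl fun j _ => by simp

theorem smul_cvec (X : OrthonormalBasis (Fin n) ℝ 𝔨) (a : ℝ) (A B : 𝔨) :
    (a : ℂ) • cvec X A B = cvec X (a • A) (a • B) := by
  funext i
  apply Complex.ext <;> simp [cvec, inner_smul_right]

theorem adMat_mulVec_cvec_eq_iff (X : OrthonormalBasis (Fin n) ℝ 𝔨) (Y A B : 𝔨) (a : ℝ) :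
    (adMat K X Y).mulVec (cvec X A B) = (a : ℂ) • cvec X A B ↔
      lieBr K Y A = a • B ∧ lieBr K Y B = -(a • A) := by
  rw [adMat_mulVec_cvec, smul_cvec]
  constructor
  · intro h
    have h' := cvec_inj X h
    exact ⟨h'.2, neg_eq_iff_eq_neg.1 h'.1⟩
  · rintro ⟨h1, h2⟩
    rw [h1, h2, neg_neg]

theorem adMat_commute (X : OrthonormalBasis (Fin n) ℝ 𝔨) {Y Z : 𝔨} (h : lieBr K Y Z = 0) :
    Commute (adMat K X Y) (adMat K X Z) := by
  refine Matrix.mulVec_injective.eq_iff.1 (funext fun v => ?_)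
  obtain ⟨A, B, rfl⟩ := exists_cvec_eq X v
  rw [← Matrix.mulVec_mulVec, ← Matrix.mulVec_mulVec]
  simp only [adMat_mulVec_cvec, lieBr_neg_right]
  have hj (W : 𝔨) : lieBr K Y (lieBr K Z W) = lieBr K Z (lieBr K Y W) := by
    have h0 : lieBr K (0 : 𝔨) W = 0 := by simp [← adL_apply]
    rw [lieBr_jacobi, h, h0, zero_add]
  rw [hj, hj]

end AdMatrix

/-! ### Roots and root spaces -/

section Roots

variable {𝔨 : Type*} [NormedAddCommGroup 𝔨] [InnerProductSpace ℝ 𝔨] [FiniteDimensional ℝ 𝔨]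
  {K : Type*} [TopologicalSpace K] [ChartedSpace 𝔨 K] [Group K] [LieGroup 𝓘(ℝ, 𝔨) ∞ K]
  {n : ℕ}

variable (K) in
/-- `A + iB` is a root vector for the functional `α` on `𝔱`. -/
def IsRootVector (𝔱 : Submodule ℝ 𝔨) (α : Module.Dual ℝ 𝔱) (A B : 𝔨) : Prop :=
  ∀ H : 𝔱, lieBr K (H : 𝔨) A = -(α H • B) ∧ lieBr K (H : 𝔨) B = α H • A

theorem IsRootVector.neg {𝔱 : Submodule ℝ 𝔨} {α : Module.Dual ℝ 𝔱} {A B : 𝔨}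
    (h : IsRootVector K 𝔱 α A B) : IsRootVector K 𝔱 (-α) A (-B) := by
  intro H
  simp [lieBr_neg_right, h H]

theorem IsRoot.neg {𝔱 : Submodule ℝ 𝔨} {α : Module.Dual ℝ 𝔱} (h : IsRoot K 𝔱 α) :
    IsRoot K 𝔱 (-α) := by
  obtain ⟨h0, A, B, hAB, h⟩ := h
  exact ⟨neg_ne_zero.2 h0, A, -B, by simpa using hAB, IsRootVector.neg h⟩

/-- Multiplying [H, Z] = iα(H)Z by `i` gives the eigenvalue -α(H); hence the sign changes between
weights of `adMat` and roots below. -/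
theorem isRootVector_iff (X : OrthonormalBasis (Fin n) ℝ 𝔨) {𝔱 : Submodule ℝ 𝔨}
    {α : Module.Dual ℝ 𝔱} {A B : 𝔨} : IsRootVector K 𝔱 α A B ↔
      ∀ H : 𝔱, (adMat K X H).mulVec (cvec X A B) = ((-α H : ℝ) : ℂ) • cvec X A B := by
  refine forall_congr' fun H => ?_
  rw [adMat_mulVec_cvec_eq_iff]
  simp

/-- Orthogonality to a root vector `A + iB` for the hermitian inner product, among the root vectors
for the same root, forces vanishing: the root spaces are complex lines. -/
theorem IsRootVector.eq_zero_of_orthogonal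
    (hAd : ∀ (x : K) (Y Z : 𝔨), ⟪Ad x Y, Ad x Z⟫_ℝ = ⟪Y, Z⟫_ℝ) {𝔱 : Submodule ℝ 𝔨}
    (hc : IsCartan K 𝔱) {α : Module.Dual ℝ 𝔱} (hα : α ≠ 0) {A B A' B' : 𝔨}
    (h : IsRootVector K 𝔱 α A B) (hAB : ¬ (A = 0 ∧ B = 0)) (h' : IsRootVector K 𝔱 α A' B')
    (h1 : ⟪A, A'⟫_ℝ + ⟪B, B'⟫_ℝ = 0) (h2 : ⟪A, B'⟫_ℝ - ⟪B, A'⟫_ℝ = 0) : A' = 0 ∧ B' = 0 := by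
  have hsk (Y Z W : 𝔨) : ⟪lieBr K Y Z, W⟫_ℝ = -⟪Z, lieBr K Y W⟫_ℝ := inner_lieBr_left hAd Y Z W
  have hsk' (Y Z W : 𝔨) : ⟪lieBr K Y Z, W⟫_ℝ = ⟪Z, lieBr K W Y⟫_ℝ := by
    rw [hsk, lieBr_skew W Y, inner_neg_right]
  have hzero (Z : 𝔨) (hZ : ∀ H : 𝔱, lieBr K (H : 𝔨) Z = 0) (hZ' : ∀ H : 𝔱, ⟪Z, (H : 𝔨)⟫_ℝ = 0) :
      Z = 0 := by
    have hm : Z ∈ 𝔱 := hc.2 Z fun H hH => hZ ⟨H, hH⟩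
    exact inner_self_eq_zero.1 (hZ' ⟨Z, hm⟩)
  -- With Z = A + iB and Z' = A' + iB', `e1` and `e2` are the real and imaginary parts of [Z̄, Z'] =
  -- 0. The bracket has weight -α + α = 0, so it lies in 𝔱 ⊗ ℂ, and it is orthogonal to 𝔱 because Z
  -- and Z' are orthogonal.
  have e1 : lieBr K A A' + lieBr K B B' = 0 := by
    refine hzero _ (fun H => ?_) (fun H => ?_)
    · rw [lieBr_add_right, lieBr_jacobi (H : 𝔨) A A', lieBr_jacobi (H : 𝔨) B B', (h H).1, (h H).2, (h' H).1, (h' H).2]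
      simp only [lieBr_neg_left, lieBr_neg_right, lieBr_real_smul_left, lieBr_real_smul_right]
      abel
    · rw [inner_add_left, hsk', hsk', (h H).1, (h H).2, inner_neg_right, inner_smul_right,
        inner_smul_right, real_inner_comm B A', real_inner_comm A B']
      linear_combination (α H) * h2
  have e2 : lieBr K A B' - lieBr K B A' = 0 := by
    refine hzero _ (fun H => ?_) (fun H => ?_)
    · rw [lieBr_sub_right, lieBr_jacobi (H : 𝔨) A B', lieBr_jacobi (H : 𝔨) B A', (h H).1, (h H).2, (h' H).1, (h' H).2]
      simp only [lieBr_neg_left, lieBr_neg_right, lieBr_real_smul_left, lieBr_real_smul_right]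
      abel
    · rw [inner_sub_left, hsk', hsk', (h H).1, (h H).2, inner_neg_right, inner_smul_right,
        inner_smul_right, real_inner_comm B B', real_inner_comm A A']
      linear_combination -(α H) * h1
  -- `T` is, up to a factor, [Z̄, Z]. It is a nonzero element of 𝔱 representing a negative multiple
  -- of `α`, so `α T < 0`.
  set T := lieBr K A B with hT
  have hT0 (H : 𝔱) : lieBr K (H : 𝔨) T = 0 := by
    rw [hT, lieBr_jacobi, (h H).1, (h H).2, lieBr_neg_left, lieBr_real_smul_left,
      lieBr_real_smul_right, lieBr_self, lieBr_self]
    simp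
  have hTm : T ∈ 𝔱 := hc.2 T fun H hH => hT0 ⟨H, hH⟩
  have hTi (H : 𝔱) : ⟪T, (H : 𝔨)⟫_ℝ = -(α H * ⟪B, B⟫_ℝ) := by
    rw [hT, hsk', (h H).1, inner_neg_right, inner_smul_right]
  obtain ⟨H₁, hH₁⟩ : ∃ H, α H ≠ 0 := by
    by_contra hne
    push Not at hne
    exact hα (LinearMap.ext hne)
  have hTpos : 0 < ⟪T, T⟫_ℝ := by
    refine lt_of_le_of_ne real_inner_self_nonneg fun h0 => hAB ?_
    have hT00 : T = 0 := inner_self_eq_zero.1 h0.symm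
    have h3 := hTi H₁
    rw [hT00, inner_zero_left] at h3
    have hB : B = 0 := by
      have : ⟪B, B⟫_ℝ = 0 := by
        rcases mul_eq_zero.1 (neg_eq_zero.1 h3.symm) with h4 | h4
        · exact absurd h4 hH₁
        · exact h4
      exact inner_self_eq_zero.1 this
    refine ⟨?_, hB⟩
    have h4 := (h H₁).2
    rw [hB] at h4
    have h5 : lieBr K (H₁ : 𝔨) (0 : 𝔨) = 0 := by simp [← adL_apply]
    rw [h5] at h4
    exact (smul_eq_zero.1 h4.symm).resolve_left hH₁
  have hαT : α ⟨T, hTm⟩ < 0 := by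
    have h3 := hTi ⟨T, hTm⟩
    simp only at h3
    rw [h3] at hTpos
    have h4 : 0 ≤ ⟪B, B⟫_ℝ := real_inner_self_nonneg
    by_contra h5
    push Not at h5
    nlinarith [mul_nonneg h5 h4]
  have hj := lieBr_jacobi (G := K) A B A'
  -- By Jacobi this quantity is at most 0, whereas the root relation makes it -α(T)|B'|² ≥ 0; hence
  -- `B' = 0`.
  have h3 : ⟪lieBr K T A', B'⟫_ℝ = -(⟪lieBr K A B', lieBr K A B'⟫_ℝ +
      ⟪lieBr K A A', lieBr K A A'⟫_ℝ) := by
    have h4 : lieBr K T A' = lieBr K A (lieBr K B A') - lieBr K B (lieBr K A A') := by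
      rw [hj, hT]; abel
    rw [h4, inner_sub_left, hsk A (lieBr K B A'), hsk B (lieBr K A A'), ← sub_eq_zero.1 e2, eq_neg_of_add_eq_zero_right e1,
      inner_neg_right]
    ring
  have h4 := (h' ⟨T, hTm⟩).1
  simp only at h4
  rw [h4, inner_neg_left, inner_smul_left] at h3
  simp only [conj_trivial] at h3
  have hB' : B' = 0 := by
    have h5 : 0 ≤ ⟪lieBr K A B', lieBr K A B'⟫_ℝ := real_inner_self_nonneg
    have h6 : 0 ≤ ⟪lieBr K A A', lieBr K A A'⟫_ℝ := real_inner_self_nonneg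
    have h7 : 0 ≤ ⟪B', B'⟫_ℝ := real_inner_self_nonneg
    have h8 : ⟪B', B'⟫_ℝ = 0 := by nlinarith
    exact inner_self_eq_zero.1 h8
  refine ⟨?_, hB'⟩
  have h5 := (h' H₁).2
  have h6 : lieBr K (H₁ : 𝔨) (0 : 𝔨) = 0 := by simp [← adL_apply]
  rw [hB', h6] at h5
  exact (smul_eq_zero.1 h5.symm).resolve_left hH₁

/-- Simultaneous diagonalization of `i ad H`, `H ∈ 𝔱`, for an abelian subalgebra `𝔱`. -/
theorem exists_weights (hAd : ∀ (x : K) (Y Z : 𝔨), ⟪Ad x Y, Ad x Z⟫_ℝ = ⟪Y, Z⟫_ℝ)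
    (X : OrthonormalBasis (Fin n) ℝ 𝔨) {𝔱 : Submodule ℝ 𝔨}
    (hc : ∀ H ∈ 𝔱, ∀ H' ∈ 𝔱, lieBr K H H' = 0) :
    ∃ (P P' : Matrix (Fin n) (Fin n) ℂ) (w : Fin n → Module.Dual ℝ 𝔱), P' * P = 1 ∧ P * P' = 1 ∧
      ∀ H : 𝔱, adMat K X H * P = P * Matrix.diagonal fun j => (w j H : ℂ) := by
  obtain ⟨P, P', χ, h1, h2, h⟩ := exists_joint_diagonalization (fun H : 𝔱 => adMat K X (H : 𝔨))
    (fun H => adMat_isHermitian hAd X _)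
    (fun H H' => adMat_commute X (hc H H.2 H' H'.2))
  -- The right side is linear in `H`, so the eigenvalues, so far mere functions of `H`, are linear
  -- functionals.
  have hcol (H : 𝔱) : Matrix.diagonal (fun j => (χ j H : ℂ)) = P' * adMat K X H * P := by
    rw [mul_assoc, h, ← mul_assoc, h1, one_mul]
  refine ⟨P, P', fun j => { toFun := χ j, map_add' := fun H H' => ?_, map_smul' := fun a H => ?_ },
    h1, h2, h⟩
  · have h3 := congrFun (congrFun (hcol (H + H')) j) j
    rw [Submodule.coe_add, adMat_add, mul_add, add_mul, ← hcol, ← hcol] at h3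
    simp only [Matrix.add_apply, Matrix.diagonal_apply_eq] at h3
    exact_mod_cast h3
  · have h3 := congrFun (congrFun (hcol (a • H)) j) j
    rw [Submodule.coe_smul, adMat_smul, mul_smul_comm, smul_mul_assoc, ← hcol] at h3
    simp only [Matrix.smul_apply, Matrix.diagonal_apply_eq, smul_eq_mul] at h3
    exact_mod_cast h3

end Roots

section Sinhc

theorem sinhc_zero : sinhc 0 = 1 := by simp [sinhc]

theorem sinhc_neg (t : ℝ) : sinhc (-t) = sinhc t := by
  simp [sinhc, Real.sinh_neg, neg_div_neg_eq]

theorem sinhc_pos (t : ℝ) : 0 < sinhc t := by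
  unfold sinhc
  split_ifs with h
  · norm_num
  · rcases lt_or_gt_of_ne h with h | h
    · exact div_pos_of_neg_of_neg (Real.sinh_neg_iff.2 h) h
    · exact div_pos (Real.sinh_pos_iff.2 h) h

end Sinhc

/-! ### Weights, positive roots and `η²` -/

section Weights

variable {𝔨 : Type*} [NormedAddCommGroup 𝔨] [InnerProductSpace ℝ 𝔨] [FiniteDimensional ℝ 𝔨]
  {K : Type*} [TopologicalSpace K] [ChartedSpace 𝔨 K] [Group K] [LieGroup 𝓘(ℝ, 𝔨) ∞ K]
  {n : ℕ} {X : OrthonormalBasis (Fin n) ℝ 𝔨} {𝔱 : Submodule ℝ 𝔨}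
  {P P' : Matrix (Fin n) (Fin n) ℂ} {w : Fin n → Module.Dual ℝ 𝔱}

theorem mulVec_transpose_of_mul_eq {M : Matrix (Fin n) (Fin n) ℂ} {d : Fin n → ℂ}
    (h : M * P = P * Matrix.diagonal d) (j : Fin n) : M.mulVec (P.transpose j) =
      d j • P.transpose j := by
  funext i
  have h1 := congrFun (congrFun h i) j
  rw [Matrix.mul_diagonal, mul_comm] at h1
  exact h1

theorem mulVec_transpose_of_mul_eq_one (h1 : P' * P = 1) (j : Fin n) :
    P'.mulVec (P.transpose j) = Pi.single j 1 := by
  funext i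
  have h2 := congrFun (congrFun h1 i) j
  rw [Matrix.one_apply, ← Pi.single_apply j (1 : ℂ) i] at h2
  exact h2

theorem cvec_ne_zero {A B : 𝔨} (h : cvec X A B ≠ 0) : ¬ (A = 0 ∧ B = 0) := by
  rintro ⟨rfl, rfl⟩
  exact h (cvec_zero X)

theorem star_cvec_dotProduct (A B A' B' : 𝔨) : star (cvec X A B) ⬝ᵥ cvec X A' B' =
    ⟨⟪A, A'⟫_ℝ + ⟪B, B'⟫_ℝ, ⟪A, B'⟫_ℝ - ⟪B, A'⟫_ℝ⟩ := by
  have h (Y Z : 𝔨) : ⟪Y, Z⟫_ℝ = ∑ i, ⟪X i, Y⟫_ℝ * ⟪X i, Z⟫_ℝ := by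
    rw [← X.sum_inner_mul_inner]
    exact Finset.sum_congr rfl fun i _ => by rw [real_inner_comm]
  rw [dotProduct]
  apply Complex.ext
  · rw [Complex.re_sum]
    simp only [h A, h B, ← Finset.sum_add_distrib]
    exact Finset.sum_congr rfl fun j _ => by simp [cvec]
  · rw [Complex.im_sum]
    simp only [h A, h B, ← Finset.sum_sub_distrib]
    exact Finset.sum_congr rfl fun j _ => by simp [cvec]; ring

theorem isRoot_weight (h1 : P' * P = 1)
    (h : ∀ H : 𝔱, adMat K X H * P = P * Matrix.diagonal fun j => (w j H : ℂ)) {j : Fin n}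
    (hj : w j ≠ 0) : IsRoot K 𝔱 (w j) := by
  obtain ⟨A, B, hAB⟩ := exists_cvec_eq X (P.transpose j)
  have hr : IsRootVector K 𝔱 (-w j) A B := by
    rw [isRootVector_iff X]
    intro H
    rw [hAB, mulVec_transpose_of_mul_eq (h H)]
    simp
  have h0 : cvec X A B ≠ 0 := by
    rw [hAB]
    intro h0
    have h2 := congrFun (mulVec_transpose_of_mul_eq_one h1 j) j
    rw [h0] at h2
    simp at h2
  rw [← neg_neg (w j)]
  exact IsRoot.neg ⟨neg_ne_zero.2 hj, A, B, cvec_ne_zero h0, hr⟩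

/-- A root vector for `-α` has a nonzero coordinate in the eigenbasis, and comparing eigenvalues
there identifies `α` with that weight. -/
theorem exists_weight_eq (h1 : P' * P = 1) (h2 : P * P' = 1)
    (h : ∀ H : 𝔱, adMat K X H * P = P * Matrix.diagonal fun j => (w j H : ℂ))
    {α : Module.Dual ℝ 𝔱} (hα : IsRoot K 𝔱 α) : ∃ j, w j = α := by
  obtain ⟨-, A, B, hAB, hr⟩ := hα.neg
  have hr' := (isRootVector_iff X).1 hr
  obtain ⟨j, hj⟩ : ∃ j, P'.mulVec (cvec X A B) j ≠ 0 := by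
    by_contra hne
    push Not at hne
    have h3 : cvec X A B = cvec X 0 0 := by
      rw [cvec_zero, ← Matrix.one_mulVec (cvec X A B), ← h2, ← Matrix.mulVec_mulVec]
      rw [show P'.mulVec (cvec X A B) = 0 from funext hne, Matrix.mulVec_zero]
    exact hAB (cvec_inj X h3)
  refine ⟨j, LinearMap.ext fun H => ?_⟩
  have h3 := congrArg P'.mulVec (hr' H)
  rw [Matrix.mulVec_mulVec, conj_diagonal_eq (h H) h1 h2, ← Matrix.mulVec_mulVec,
    Matrix.mulVec_smul] at h3
  have h4 := congrFun h3 j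
  rw [Matrix.mulVec_diagonal, Pi.smul_apply, smul_eq_mul] at h4
  have h5 := mul_right_cancel₀ hj h4
  rw [LinearMap.neg_apply, neg_neg] at h5
  exact_mod_cast h5

/-- If two columns of `P` had the same nonzero weight, subtracting from one its projection on the
other would give an orthogonal root vector for the same root. That vector is zero, against
independence of the columns. -/
theorem weight_injective (hAd : ∀ (x : K) (Y Z : 𝔨), ⟪Ad x Y, Ad x Z⟫_ℝ = ⟪Y, Z⟫_ℝ)
    (hc : IsCartan K 𝔱) (h1 : P' * P = 1)
    (h : ∀ H : 𝔱, adMat K X H * P = P * Matrix.diagonal fun j => (w j H : ℂ)) {j k : Fin n}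
    (hj : w j ≠ 0) (hjk : w j = w k) : j = k := by
  by_contra hne
  set v := P.transpose j with hv
  set u := P.transpose k with hu
  have hPv := mulVec_transpose_of_mul_eq_one h1 j
  have hPu := mulVec_transpose_of_mul_eq_one h1 k
  have hv0 : v ≠ 0 := by
    intro h0
    rw [← hv, h0] at hPv
    simpa using congrFun hPv j
  have hvv : star v ⬝ᵥ v ≠ 0 := by
    intro h0
    open scoped ComplexOrder in exact hv0 (dotProduct_star_self_eq_zero.1 h0)
  set c := (star v ⬝ᵥ u) / (star v ⬝ᵥ v) with hcdef
  have hort : star v ⬝ᵥ (u - c • v) = 0 := by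
    rw [dotProduct_sub, dotProduct_smul, hcdef, smul_eq_mul, div_mul_cancel₀ _ hvv, sub_self]
  obtain ⟨A, B, hAB⟩ := exists_cvec_eq X v
  obtain ⟨A', B', hAB'⟩ := exists_cvec_eq X (u - c • v)
  have hr : IsRootVector K 𝔱 (-w j) A B := by
    rw [isRootVector_iff X]
    intro H
    rw [hAB, mulVec_transpose_of_mul_eq (h H)]
    simp [hv]
  have hr' : IsRootVector K 𝔱 (-w j) A' B' := by
    rw [isRootVector_iff X]
    intro H
    rw [hAB', Matrix.mulVec_sub, Matrix.mulVec_smul, mulVec_transpose_of_mul_eq (h H),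
      mulVec_transpose_of_mul_eq (h H), ← hjk, smul_comm c, ← smul_sub]
    simp [hv, hu]
  rw [← hAB', ← hAB, star_cvec_dotProduct] at hort
  obtain ⟨rfl, rfl⟩ := hr.eq_zero_of_orthogonal hAd hc (neg_ne_zero.2 hj)
    (cvec_ne_zero (by rwa [hAB])) hr' (congrArg Complex.re hort) (congrArg Complex.im hort)
  rw [cvec_zero] at hAB'
  have h3 : u = c • v := sub_eq_zero.1 hAB'.symm
  rw [← hu, h3, Matrix.mulVec_smul, hPv] at hPu
  have h4 := congrFun hPu k
  simp [Ne.symm hne] at h4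

theorem IsPositiveRoots.finite (h1 : P' * P = 1) (h2 : P * P' = 1)
    (h : ∀ H : 𝔱, adMat K X H * P = P * Matrix.diagonal fun j => (w j H : ℂ))
    {R : Set (Module.Dual ℝ 𝔱)} (hR : IsPositiveRoots K 𝔱 R) : R.Finite := by
  obtain ⟨H₀, -, rfl⟩ := hR
  refine (Set.finite_range w).subset fun α hα => ?_
  exact exists_weight_eq h1 h2 h hα.1

/-- Weights positive at `H₀` are in bijection with `R`, those negative at `H₀` with `-R`. As sinhc
is even, each group gives one copy of the product over `R`. -/
theorem etaProd_pos_and_sq (hAd : ∀ (x : K) (Y Z : 𝔨), ⟪Ad x Y, Ad x Z⟫_ℝ = ⟪Y, Z⟫_ℝ)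
    (hc : IsCartan K 𝔱) (h1 : P' * P = 1) (h2 : P * P' = 1)
    (h : ∀ H : 𝔱, adMat K X H * P = P * Matrix.diagonal fun j => (w j H : ℂ))
    {R : Set (Module.Dual ℝ 𝔱)} (hR : IsPositiveRoots K 𝔱 R) (Y : 𝔱) :
    0 < etaProd 𝔱 R Y ∧ etaProd 𝔱 R Y ^ 2 = ∏ j, sinhc (w j Y) := by
  classical
  obtain ⟨H₀, hreg, rfl⟩ := hR
  have hne {j : Fin n} (hj : w j H₀ ≠ 0) : w j ≠ 0 := fun h0 => hj (by rw [h0]; rfl)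
  have hpos : etaProd 𝔱 {α | IsRoot K 𝔱 α ∧ 0 < α H₀} Y =
      ∏ j ∈ Finset.univ.filter (fun j => 0 < w j H₀), sinhc (w j Y) := by
    rw [etaProd, ← finprod_mem_coe_finset]
    symm
    refine finprod_mem_eq_of_bijOn w ⟨?_, ?_, ?_⟩ fun _ _ => rfl
    · intro j hj
      simp only [Finset.coe_filter, Finset.mem_univ, true_and, Set.mem_ofPred_eq] at hj
      exact ⟨isRoot_weight h1 h (hne hj.ne'), hj⟩
    · intro j hj k _ hjk
      simp only [Finset.coe_filter, Finset.mem_univ, true_and, Set.mem_ofPred_eq] at hj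
      exact weight_injective hAd hc h1 h (hne hj.ne') hjk
    · rintro α ⟨hα, hα0⟩
      obtain ⟨j, rfl⟩ := exists_weight_eq h1 h2 h hα
      exact ⟨j, by simpa using hα0, rfl⟩
  have hneg : etaProd 𝔱 {α | IsRoot K 𝔱 α ∧ 0 < α H₀} Y =
      ∏ j ∈ Finset.univ.filter (fun j => w j H₀ < 0), sinhc (w j Y) := by
    rw [etaProd, ← finprod_mem_coe_finset]
    symm
    refine finprod_mem_eq_of_bijOn (fun j => -w j) ⟨?_, ?_, ?_⟩ fun j _ => by
      rw [LinearMap.neg_apply, sinhc_neg]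
    · intro j hj
      simp only [Finset.coe_filter, Finset.mem_univ, true_and, Set.mem_ofPred_eq] at hj
      exact ⟨(isRoot_weight h1 h (hne hj.ne)).neg, by simpa using hj⟩
    · intro j hj k _ hjk
      simp only [Finset.coe_filter, Finset.mem_univ, true_and, Set.mem_ofPred_eq] at hj
      exact weight_injective hAd hc h1 h (hne hj.ne) (neg_injective hjk)
    · rintro α ⟨hα, hα0⟩
      obtain ⟨j, hj⟩ := exists_weight_eq h1 h2 h hα.neg
      exact ⟨j, by simpa [hj] using hα0, by simp [hj]⟩
  refine ⟨hpos ▸ Finset.prod_pos fun j _ => sinhc_pos _, ?_⟩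
  -- A weight vanishing at the regular element `H₀` is zero, and contributes sinhc 0 = 1.
  have hrest : ∏ j ∈ Finset.univ.filter (fun j => ¬ 0 < w j H₀), sinhc (w j Y) =
      ∏ j ∈ Finset.univ.filter (fun j => w j H₀ < 0), sinhc (w j Y) := by
    symm
    refine Finset.prod_subset (fun j hj => ?_) fun j hj hj' => ?_
    · simp only [Finset.mem_filter, Finset.mem_univ, true_and, not_lt] at hj ⊢
      exact hj.le
    · simp only [Finset.mem_filter, Finset.mem_univ, true_and, not_lt] at hj hj'
      have h0 : w j = 0 := by
        by_contra h0
        exact hreg _ (isRoot_weight h1 h h0) (le_antisymm hj hj')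
      rw [h0, LinearMap.zero_apply, sinhc_zero]
  rw [← Finset.prod_filter_mul_prod_filter_not Finset.univ (fun j => 0 < w j H₀), hrest, ← hpos,
    ← hneg, sq]

/-- A Cartan subalgebra has a regular element. -/
theorem exists_isPositiveRoots (h1 : P' * P = 1) (h2 : P * P' = 1)
    (h : ∀ H : 𝔱, adMat K X H * P = P * Matrix.diagonal fun j => (w j H : ℂ)) :
    ∃ R, IsPositiveRoots K 𝔱 R := by
  obtain ⟨H₀, hH₀⟩ := Module.Dual.exists_forall_ne_zero_of_forall_exists
    (fun j : {j // w j ≠ 0} => w j) (fun j => by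
      by_contra hne
      push Not at hne
      exact j.2 (LinearMap.ext hne))
  refine ⟨_, H₀, fun α hα => ?_, rfl⟩
  obtain ⟨j, rfl⟩ := exists_weight_eq h1 h2 h hα
  exact hH₀ ⟨j, hα.1⟩

/-- Every element of the Lie algebra lies in a Cartan subalgebra. -/
theorem exists_isCartan_mem (Y : 𝔨) : ∃ 𝔱 : Submodule ℝ 𝔨, Y ∈ 𝔱 ∧ IsCartan K 𝔱 := by
  have hs0 (Z : 𝔨) : lieBr K Z 0 = 0 := by simp [← adL_apply]
  have h0s (Z : 𝔨) : lieBr K 0 Z = 0 := by simp [← adL_apply]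
  let S : Set (Submodule ℝ 𝔨) := {𝔱 | Y ∈ 𝔱 ∧ ∀ H ∈ 𝔱, ∀ H' ∈ 𝔱, lieBr K H H' = 0}
  have hne : S.Nonempty := by
    refine ⟨Submodule.span ℝ {Y}, Submodule.mem_span_singleton_self Y, fun H hH H' hH' => ?_⟩
    obtain ⟨a, rfl⟩ := Submodule.mem_span_singleton.1 hH
    obtain ⟨b, rfl⟩ := Submodule.mem_span_singleton.1 hH'
    rw [lieBr_real_smul_left, lieBr_real_smul_right, lieBr_self, smul_zero, smul_zero]
  -- A maximal abelian subspace containing `Y`; an element commuting with it could be adjoined.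
  obtain ⟨𝔱, ⟨hY, hab⟩, hmax⟩ := WellFounded.has_min
    (IsWellFounded.wf : WellFounded ((· > ·) : Submodule ℝ 𝔨 → Submodule ℝ 𝔨 → Prop)) S hne
  refine ⟨𝔱, hY, hab, fun Z hZ => ?_⟩
  by_contra hZt
  refine hmax (𝔱 ⊔ Submodule.span ℝ {Z}) ⟨Submodule.mem_sup_left hY, ?_⟩ ?_
  · intro H hH H' hH'
    obtain ⟨A, hA, B, hB, rfl⟩ := Submodule.mem_sup.1 hH
    obtain ⟨A', hA', B', hB', rfl⟩ := Submodule.mem_sup.1 hH'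
    obtain ⟨a, rfl⟩ := Submodule.mem_span_singleton.1 hB
    obtain ⟨b, rfl⟩ := Submodule.mem_span_singleton.1 hB'
    rw [lieBr_add_left, lieBr_add_right, lieBr_add_right, hab A hA A' hA', lieBr_real_smul_right,
      hZ A hA, lieBr_real_smul_left, lieBr_skew Z A', hZ A' hA', lieBr_real_smul_left,
      lieBr_real_smul_right, lieBr_self]
    simp
  · refine lt_of_le_of_ne le_sup_left fun heq => hZt ?_
    rw [heq]
    exact Submodule.mem_sup_right (Submodule.mem_span_singleton_self Z)

end Weights

/-! ### Log-convexity of `sinh t / t` -/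

section Sinhc

theorem sinh_mul_le {c x : ℝ} (hc0 : 0 ≤ c) (hc1 : c ≤ 1) (hx : 0 ≤ x) :
    Real.sinh (c * x) ≤ c * Real.sinh x := by
  have hd (t : ℝ) : HasDerivAt (fun t => c * Real.sinh t - Real.sinh (c * t))
      (c * Real.cosh t - Real.cosh (c * t) * c) t := by
    refine ((Real.hasDerivAt_sinh t).const_mul c).sub ?_
    refine (((hasDerivAt_id t).const_mul c).sinh).congr_deriv ?_
    simp
  have hm : MonotoneOn (fun t => c * Real.sinh t - Real.sinh (c * t)) (Set.Ici 0) := by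
    refine monotoneOn_of_deriv_nonneg (convex_Ici 0)
      (fun t _ => (hd t).continuousAt.continuousWithinAt)
      (fun t _ => (hd t).differentiableAt.differentiableWithinAt) fun t ht => ?_
    rw [interior_Ici] at ht
    have ht' : 0 < t := ht
    rw [(hd t).deriv, mul_comm _ c, ← mul_sub]
    refine mul_nonneg hc0 (sub_nonneg.2 (Real.cosh_le_cosh.2 ?_))
    rw [abs_of_nonneg (by positivity), abs_of_pos ht']
    nlinarith
  have h := hm (Set.mem_Ici.2 le_rfl) (Set.mem_Ici.2 hx) hx
  simp at h
  linarith

/-- With m and d half the sum and half the difference, sinh a sinh b = sinh² m - sinh² d and ab = m²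
- d². The claim becomes m sinh d ≤ d sinh m, which is `sinh_mul_le` with c = d/m. -/
theorem sinhc_sq_le_of_pos {a b : ℝ} (ha : 0 < a) (hb : 0 < b) :
    sinhc ((a + b) / 2) ^ 2 ≤ sinhc a * sinhc b := by
  wlog hab : b ≤ a generalizing a b
  · rw [add_comm, mul_comm]
    exact this hb ha (le_of_not_ge hab)
  obtain ⟨m, hm⟩ : ∃ m, m = (a + b) / 2 := ⟨_, rfl⟩
  obtain ⟨d, hd⟩ : ∃ d, d = (a - b) / 2 := ⟨_, rfl⟩
  have hm0 : 0 < m := by rw [hm]; linarith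
  have hd0 : 0 ≤ d := by rw [hd]; linarith
  have hdm : d ≤ m := by rw [hm, hd]; linarith
  have hs : Real.sinh d * m ≤ d * Real.sinh m := by
    have h := sinh_mul_le (c := d / m) (x := m) (by positivity) ((div_le_one hm0).2 hdm) hm0.le
    rw [div_mul_cancel₀ _ hm0.ne', div_mul_eq_mul_div, le_div_iff₀ hm0] at h
    exact h
  have hs0 : 0 ≤ Real.sinh d := Real.sinh_nonneg_iff.2 hd0
  have hprod : Real.sinh a * Real.sinh b = Real.sinh m ^ 2 - Real.sinh d ^ 2 := by
    have ea : a = m + d := by rw [hm, hd]; ring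
    have eb : b = m - d := by rw [hm, hd]; ring
    rw [ea, eb, Real.sinh_add, Real.sinh_sub]
    have h1 := Real.cosh_sq m
    have h2 := Real.cosh_sq d
    linear_combination Real.sinh m ^ 2 * h2 - Real.sinh d ^ 2 * h1
  have hab' : a * b = m ^ 2 - d ^ 2 := by rw [hm, hd]; ring
  rw [← hm, sinhc, sinhc, sinhc, if_neg hm0.ne', if_neg ha.ne', if_neg hb.ne', div_pow,
    div_mul_div_comm, div_le_div_iff₀ (by positivity) (by positivity), hprod, hab']
  have h3 : (Real.sinh d * m) ^ 2 ≤ (d * Real.sinh m) ^ 2 :=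
    pow_le_pow_left₀ (by positivity) hs 2
  nlinarith

theorem sinhc_sq_le {s s' : ℝ} (hs : 0 < s) (hs' : 0 < s') (l : ℝ) :
    sinhc ((s + s') / 2 * l) ^ 2 ≤ sinhc (s * l) * sinhc (s' * l) := by
  have key {l : ℝ} (hl : 0 < l) :
      sinhc ((s + s') / 2 * l) ^ 2 ≤ sinhc (s * l) * sinhc (s' * l) := by
    have h := sinhc_sq_le_of_pos (mul_pos hs hl) (mul_pos hs' hl)
    rwa [← add_mul, mul_div_right_comm] at h
  rcases lt_trichotomy l 0 with h | rfl | h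
  · have h1 := key (neg_pos.2 h)
    simpa only [mul_neg, sinhc_neg] using h1
  · simp [sinhc_zero]
  · exact key h

end Sinhc

/-! ### Properties of `η` and `φ`, and the norm of `Ω_s` -/

section Eta

variable {𝔨 : Type*} [NormedAddCommGroup 𝔨] [InnerProductSpace ℝ 𝔨] [FiniteDimensional ℝ 𝔨]
  {K : Type*} [TopologicalSpace K] [ChartedSpace 𝔨 K] [Group K] [LieGroup 𝓘(ℝ, 𝔨) ∞ K]
  {n : ℕ}

theorem exists_diagonalization_adMat
    (hAd : ∀ (x : K) (Y Z : 𝔨), ⟪Ad x Y, Ad x Z⟫_ℝ = ⟪Y, Z⟫_ℝ)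
    (X : OrthonormalBasis (Fin n) ℝ 𝔨) (Y : 𝔨) :
    ∃ (P P' : Matrix (Fin n) (Fin n) ℂ) (l : Fin n → ℝ), P' * P = 1 ∧ P * P' = 1 ∧
      ∀ s : ℝ, adMat K X (s • Y) * P = P * Matrix.diagonal fun j => ((s * l j : ℝ) : ℂ) := by
  obtain ⟨P, P', χ, h1, h2, h⟩ := exists_joint_diagonalization (fun _ : Unit => adMat K X Y)
    (fun _ => adMat_isHermitian hAd X _) (fun _ _ => Commute.refl _)
  refine ⟨P, P', fun j => χ j (), h1, h2, fun s => ?_⟩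
  rw [adMat_smul, smul_mul_assoc, h (), ← mul_smul_comm, ← Matrix.diagonal_smul]
  congr 2
  funext j
  simp

/-- Neither 𝔱 nor R occurs on the right: this is the independence of choices in the definition of
`η`. -/
theorem etaProd_eq_sqrt (hAd : ∀ (x : K) (Y Z : 𝔨), ⟪Ad x Y, Ad x Z⟫_ℝ = ⟪Y, Z⟫_ℝ)
    (X : OrthonormalBasis (Fin n) ℝ 𝔨) {𝔱 : Submodule ℝ 𝔨} {R : Set (Module.Dual ℝ 𝔱)}
    (hc : IsCartan K 𝔱) (hR : IsPositiveRoots K 𝔱 R) (Y : 𝔱) :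
    etaProd 𝔱 R Y = √((sinhcDet (adMat K X Y)).re) := by
  obtain ⟨P, P', w, h1, h2, h⟩ := exists_weights hAd X hc.1
  obtain ⟨h3, h4⟩ := etaProd_pos_and_sq hAd hc h1 h2 h hR Y
  rw [sinhcDet_eq (h Y) h1 h2, Complex.ofReal_re, ← h4, Real.sqrt_sq h3.le]

theorem exists_cartan_positiveRoots
    (hAd : ∀ (x : K) (Y Z : 𝔨), ⟪Ad x Y, Ad x Z⟫_ℝ = ⟪Y, Z⟫_ℝ)
    (X : OrthonormalBasis (Fin n) ℝ 𝔨) (Y : 𝔨) :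
    ∃ (𝔱 : Submodule ℝ 𝔨) (R : Set (Module.Dual ℝ 𝔱)),
      Y ∈ 𝔱 ∧ IsCartan K 𝔱 ∧ IsPositiveRoots K 𝔱 R := by
  obtain ⟨𝔱, hY, hc⟩ := exists_isCartan_mem (K := K) Y
  obtain ⟨P, P', w, h1, h2, h⟩ := exists_weights hAd X hc.1
  obtain ⟨R, hR⟩ := exists_isPositiveRoots h1 h2 h
  exact ⟨𝔱, R, hY, hc, hR⟩

theorem eta_eq_sqrt (hAd : ∀ (x : K) (Y Z : 𝔨), ⟪Ad x Y, Ad x Z⟫_ℝ = ⟪Y, Z⟫_ℝ)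
    (X : OrthonormalBasis (Fin n) ℝ 𝔨) (Y : 𝔨) :
    eta K Y = √((sinhcDet (adMat K X Y)).re) := by
  obtain ⟨𝔱, R, hY, hc, hR⟩ := exists_cartan_positiveRoots hAd X Y
  obtain ⟨𝔱', R', hY', hc', hR', hv⟩ := Classical.epsilon_spec
    (p := fun v : ℝ => ∃ (𝔱 : Submodule ℝ 𝔨) (R : Set (Module.Dual ℝ 𝔱)) (hY : Y ∈ 𝔱),
      IsCartan K 𝔱 ∧ IsPositiveRoots K 𝔱 R ∧ v = etaProd 𝔱 R ⟨Y, hY⟩) ⟨_, 𝔱, R, hY, hc, hR, rfl⟩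
  exact hv.trans (etaProd_eq_sqrt hAd X hc' hR' ⟨Y, hY'⟩)

theorem eta_pos_and_sq (hAd : ∀ (x : K) (Y Z : 𝔨), ⟪Ad x Y, Ad x Z⟫_ℝ = ⟪Y, Z⟫_ℝ)
    (X : OrthonormalBasis (Fin n) ℝ 𝔨) {Y : 𝔨} {P P' : Matrix (Fin n) (Fin n) ℂ} {l : Fin n → ℝ}
    (hP : adMat K X Y * P = P * Matrix.diagonal fun j => (l j : ℂ))
    (h1 : P' * P = 1) (h2 : P * P' = 1) :
    0 < eta K Y ∧ eta K Y ^ 2 = ∏ j, sinhc (l j) := by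
  have h : 0 < ∏ j, sinhc (l j) := Finset.prod_pos fun j _ => sinhc_pos _
  rw [eta_eq_sqrt hAd X, sinhcDet_eq hP h1 h2, Complex.ofReal_re]
  exact ⟨Real.sqrt_pos.2 h, Real.sq_sqrt h.le⟩

theorem eta_pos (hAd : ∀ (x : K) (Y Z : 𝔨), ⟪Ad x Y, Ad x Z⟫_ℝ = ⟪Y, Z⟫_ℝ)
    (X : OrthonormalBasis (Fin n) ℝ 𝔨) (Y : 𝔨) : 0 < eta K Y := by
  obtain ⟨P, P', l, h1, h2, h⟩ := exists_diagonalization_adMat hAd X Y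
  have h' := h 1
  rw [one_smul] at h'
  exact (eta_pos_and_sq hAd X h' h1 h2).1

theorem eta_zero (hAd : ∀ (x : K) (Y Z : 𝔨), ⟪Ad x Y, Ad x Z⟫_ℝ = ⟪Y, Z⟫_ℝ)
    (X : OrthonormalBasis (Fin n) ℝ 𝔨) : eta K (0 : 𝔨) = 1 := by
  obtain ⟨P, P', l, h1, h2, h⟩ := exists_diagonalization_adMat hAd X (0 : 𝔨)
  have h' := h 0
  rw [zero_smul] at h'
  obtain ⟨h3, h4⟩ := eta_pos_and_sq hAd X h' h1 h2
  simp only [zero_mul, sinhc_zero, Finset.prod_const_one] at h4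
  exact (pow_eq_one_iff_of_nonneg h3.le two_ne_zero).1 h4

theorem continuous_eta (hAd : ∀ (x : K) (Y Z : 𝔨), ⟪Ad x Y, Ad x Z⟫_ℝ = ⟪Y, Z⟫_ℝ)
    (X : OrthonormalBasis (Fin n) ℝ 𝔨) : Continuous (eta K : 𝔨 → ℝ) := by
  rw [show (eta K : 𝔨 → ℝ) = _ from funext (eta_eq_sqrt hAd X)]
  refine Real.continuous_sqrt.comp (Complex.continuous_re.comp (continuous_sinhcDet.comp ?_))
  refine continuous_matrix fun i j => ?_
  simp only [adMat, Matrix.of_apply, ← adL_apply]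
  fun_prop

/-- The matrix of `Ad x` conjugates `adMat` at `Y` into `adMat` at `Ad x Y`. The eigenvalues, hence
η², agree, and `η` is positive. -/
theorem eta_Ad (hAd : ∀ (x : K) (Y Z : 𝔨), ⟪Ad x Y, Ad x Z⟫_ℝ = ⟪Y, Z⟫_ℝ)
    (X : OrthonormalBasis (Fin n) ℝ 𝔨) (x : K) (Y : 𝔨) : eta K (Ad x Y) = eta K Y := by
  obtain ⟨P, P', l, h1, h2, h⟩ := exists_diagonalization_adMat hAd X Y
  have h' := h 1
  simp only [one_smul, one_mul] at h'
  let O : K → Matrix (Fin n) (Fin n) ℂ := fun x => Matrix.of fun i j => ((⟪X i, Ad x (X j)⟫_ℝ : ℝ) : ℂ)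
  have hO (x : K) (A B : 𝔨) : (O x).mulVec (cvec X A B) = cvec X (Ad x A) (Ad x B) := by
    have hs (A : 𝔨) (i : Fin n) : ∑ j, ⟪X i, Ad x (X j)⟫_ℝ * ⟪X j, A⟫_ℝ = ⟪X i, Ad x A⟫_ℝ := by
      conv_rhs => rw [← X.sum_repr' A, map_sum, inner_sum]
      refine Finset.sum_congr rfl fun j _ => ?_
      rw [map_smul, inner_smul_right, mul_comm]
    funext i
    apply Complex.ext
    · refine Eq.trans ?_ (hs A i)
      rw [Matrix.mulVec, dotProduct, Complex.re_sum]
      exact Finset.sum_congr rfl fun j _ => by simp [O, cvec]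
    · refine Eq.trans ?_ (hs B i)
      rw [Matrix.mulVec, dotProduct, Complex.im_sum]
      exact Finset.sum_congr rfl fun j _ => by simp [O, cvec]
  have hmul (x y : K) (hxy : x * y = 1) : O x * O y = 1 := by
    refine Matrix.mulVec_injective.eq_iff.1 (funext fun v => ?_)
    obtain ⟨A, B, rfl⟩ := exists_cvec_eq X v
    have h3 (Z : 𝔨) : Ad x (Ad y Z) = Z := by
      have := DFunLike.congr_fun (Ad_mul (E := 𝔨) x y) Z
      rw [hxy, Ad_one] at this
      exact this.symm
    rw [← Matrix.mulVec_mulVec, hO, hO, Matrix.one_mulVec, h3, h3]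
  have hcomm : adMat K X (Ad x Y) * O x = O x * adMat K X Y := by
    refine Matrix.mulVec_injective.eq_iff.1 (funext fun v => ?_)
    obtain ⟨A, B, rfl⟩ := exists_cvec_eq X v
    rw [← Matrix.mulVec_mulVec, ← Matrix.mulVec_mulVec, hO, adMat_mulVec_cvec, adMat_mulVec_cvec,
      hO, map_neg, Ad_lieBr, Ad_lieBr]
  have e1 := hmul x⁻¹ x (inv_mul_cancel x)
  have e2 := hmul x x⁻¹ (mul_inv_cancel x)
  have h3 := eta_pos_and_sq hAd X h' h1 h2
  have h4 := eta_pos_and_sq hAd X (Y := Ad x Y) (P := O x * P) (P' := P' * O x⁻¹) (l := l)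
    (by rw [← mul_assoc, hcomm, mul_assoc, h', mul_assoc])
    (by rw [mul_assoc, ← mul_assoc (O x⁻¹), e1, one_mul, h1])
    (by rw [mul_assoc, ← mul_assoc P, h2, one_mul, e2])
  refine (pow_left_inj₀ h4.1.le h3.1.le two_ne_zero).1 (h4.2.trans h3.2.symm)

theorem eta_sq_le (hAd : ∀ (x : K) (Y Z : 𝔨), ⟪Ad x Y, Ad x Z⟫_ℝ = ⟪Y, Z⟫_ℝ)
    (X : OrthonormalBasis (Fin n) ℝ 𝔨) {s s' : ℝ} (hs : 0 < s) (hs' : 0 < s') (Y : 𝔨) :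
    eta K (((s + s') / 2) • Y) ^ 2 ≤ eta K (s • Y) * eta K (s' • Y) := by
  obtain ⟨P, P', l, h1, h2, h⟩ := exists_diagonalization_adMat hAd X Y
  have e (r : ℝ) := eta_pos_and_sq hAd X (h r) h1 h2
  refine (pow_le_pow_iff_left₀ (sq_nonneg _) (mul_pos (e s).1 (e s').1).le two_ne_zero).1 ?_
  rw [mul_pow, (e _).2, (e _).2, (e _).2, ← Finset.prod_pow, ← Finset.prod_mul_distrib]
  exact Finset.prod_le_prod (fun j _ => sq_nonneg _) fun j _ => sinhc_sq_le hs hs' _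

/-- The constant `((s + s') / (2 √(s s')))^n`, the supremum of `φ(s, s', ·)`. -/
def phiMax (n : ℕ) (s s' : ℝ) : ℝ := ((s + s') / (2 * √(s * s'))) ^ n

theorem phi_le (hAd : ∀ (x : K) (Y Z : 𝔨), ⟪Ad x Y, Ad x Z⟫_ℝ = ⟪Y, Z⟫_ℝ)
    (X : OrthonormalBasis (Fin n) ℝ 𝔨) {s s' : ℝ} (hs : 0 < s) (hs' : 0 < s') (Y : 𝔨) :
    phi K n s s' Y ≤ phiMax n s s' := by
  rw [phi, phiMax]
  refine mul_le_of_le_one_right (by positivity) ?_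
  exact div_le_one_of_le₀ (eta_sq_le hAd X hs hs' Y)
    (mul_pos (eta_pos hAd X _) (eta_pos hAd X _)).le

theorem phi_zero (hAd : ∀ (x : K) (Y Z : 𝔨), ⟪Ad x Y, Ad x Z⟫_ℝ = ⟪Y, Z⟫_ℝ)
    (X : OrthonormalBasis (Fin n) ℝ 𝔨) (s s' : ℝ) : phi K n s s' (0 : 𝔨) = phiMax n s s' := by
  simp [phi, phiMax, eta_zero hAd X]

/-- Strict AM–GM. -/
theorem one_lt_phiMax {s s' : ℝ} (hs : 0 < s) (hs' : 0 < s') (hn : 0 < n) (hne : s ≠ s') :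
    1 < phiMax n s s' := by
  refine one_lt_pow₀ ?_ hn.ne'
  have h0 : 0 < √(s * s') := Real.sqrt_pos.2 (mul_pos hs hs')
  rw [one_lt_div (by positivity)]
  have h1 : √(s * s') ^ 2 = s * s' := Real.sq_sqrt (mul_pos hs hs').le
  refine lt_of_pow_lt_pow_left₀ 2 (by positivity) ?_
  rw [mul_pow, h1]
  have := sq_pos_of_ne_zero (sub_ne_zero.2 hne)
  nlinarith

theorem continuous_phi (hAd : ∀ (x : K) (Y Z : 𝔨), ⟪Ad x Y, Ad x Z⟫_ℝ = ⟪Y, Z⟫_ℝ)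
    (X : OrthonormalBasis (Fin n) ℝ 𝔨) (s s' : ℝ) : Continuous (phi K n s s' : 𝔨 → ℝ) := by
  have h := continuous_eta hAd X
  have e (Z : 𝔨) : eta K Z ≠ 0 := (eta_pos hAd X Z).ne'
  unfold phi
  refine continuous_const.mul (Continuous.div ?_ ?_ fun Y => mul_ne_zero (e _) (e _))
  · exact (h.comp (continuous_const_smul _)).pow 2
  · exact (h.comp (continuous_const_smul _)).mul (h.comp (continuous_const_smul _))

variable {𝔤 : Type*} [NormedAddCommGroup 𝔤] [NormedSpace ℂ 𝔤] [FiniteDimensional ℂ 𝔤]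
  {G : Type*} [TopologicalSpace G] [ChartedSpace 𝔤 G] [Group G] [T2Space G]
  [LieGroup 𝓘(ℂ, 𝔤) ω G] [LieGroup 𝓘(ℝ, 𝔤) ∞ G]
  {ι : K →* G}

theorem ratio_eq (hAd : ∀ (x : K) (Y Z : 𝔨), ⟪Ad x Y, Ad x Z⟫_ℝ = ⟪Y, Z⟫_ℝ)
    (hι : IsComplexification 𝔨 𝔤 ι) (X : OrthonormalBasis (Fin n) ℝ 𝔨) (s s' : ℝ) (x : K) (Y : 𝔨) :
    ratio 𝔤 ι X s s' (x, Y) =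
      ((((s + s') / 2) ^ n * eta K (((s + s') / 2) • Y) ^ 2 : ℝ) : ℂ) := by
  obtain ⟨P, P', l, h1, h2, h⟩ := exists_diagonalization_adMat hAd X Y
  have h' := h 1
  simp only [one_smul, one_mul] at h'
  rw [ratio_eq_of_diagonalization hι X (adMat_trace hAd X Y) h' h1 h2,
    (eta_pos_and_sq hAd X (h _) h1 h2).2]

theorem normOm_eq (hAd : ∀ (x : K) (Y Z : 𝔨), ⟪Ad x Y, Ad x Z⟫_ℝ = ⟪Y, Z⟫_ℝ)
    (hι : IsComplexification 𝔨 𝔤 ι) (X : OrthonormalBasis (Fin n) ℝ 𝔨) {s : ℝ} (hs : 0 < s)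
    (x : K) (Y : 𝔨) : normOm 𝔤 ι X s (x, Y) = √s ^ n * eta K (s • Y) := by
  have h : (s + s) / 2 = s := by ring
  rw [normOm, ratio_eq hAd hι, h, Complex.ofReal_re]
  have h1 : 0 ≤ √s ^ n * eta K (s • Y) := by
    have := eta_pos hAd X (s • Y)
    positivity
  have h2 : s ^ n * eta K (s • Y) ^ 2 = (√s ^ n * eta K (s • Y)) ^ 2 := by
    rw [mul_pow, ← pow_mul, mul_comm n 2, pow_mul, Real.sq_sqrt hs.le]
  rw [h2, Real.sqrt_sq h1]

end Eta

/-! ### `L²` with a positive density, and multiplication operators -/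

section WeightedL2

variable {α : Type*} [MeasurableSpace α] {ν : Measure α} {w : α → ℝ}

theorem ac_withDensity_ofReal (hw : Measurable w) (hpos : ∀ a, 0 < w a) :
    ν ≪ ν.withDensity fun a => ENNReal.ofReal (w a) :=
  withDensity_absolutelyContinuous' hw.ennreal_ofReal.aemeasurable
    (Filter.Eventually.of_forall fun a => (ENNReal.ofReal_pos.2 (hpos a)).ne')

theorem eLpNorm_withDensity (hw : Measurable w) (hpos : ∀ a, 0 < w a) {g : α → ℂ}
    (hg : AEStronglyMeasurable g ν) :
    eLpNorm g 2 (ν.withDensity fun a => ENNReal.ofReal (w a)) =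
      eLpNorm (fun a => (√(w a) : ℂ) * g a) 2 ν := by
  rw [eLpNorm_eq_lintegral_rpow_enorm_toReal two_ne_zero ENNReal.ofNat_ne_top,
    eLpNorm_eq_lintegral_rpow_enorm_toReal two_ne_zero ENNReal.ofNat_ne_top,
    lintegral_withDensity_eq_lintegral_mul₀ hw.ennreal_ofReal.aemeasurable
      (hg.enorm.pow_const _)]
  congr 1
  refine lintegral_congr fun a => ?_
  have h : ‖((√(w a) : ℝ) : ℂ)‖ₑ ^ (2 : ℝ) = ENNReal.ofReal (w a) := by
    rw [← ofReal_norm, Complex.norm_real, Real.norm_of_nonneg (Real.sqrt_nonneg _),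
      ENNReal.rpow_two, ← ENNReal.ofReal_pow (Real.sqrt_nonneg _), Real.sq_sqrt (hpos a).le]
  simp only [ENNReal.toReal_ofNat, Pi.mul_apply, enorm_mul]
  rw [ENNReal.mul_rpow_of_nonneg _ _ (by norm_num), h]

theorem memLp_div_sqrt (hw : Measurable w) (hpos : ∀ a, 0 < w a) {f : α → ℂ} (hf : MemLp f 2 ν) :
    MemLp (fun a => f a / (√(w a) : ℂ)) 2 (ν.withDensity fun a => ENNReal.ofReal (w a)) := by
  have hm : AEStronglyMeasurable (fun a => f a / (√(w a) : ℂ)) ν := by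
    simp only [div_eq_mul_inv]
    exact hf.1.mul (Complex.measurable_ofReal.comp hw.sqrt).inv.aestronglyMeasurable
  refine ⟨hm.mono_ac (withDensity_absolutelyContinuous _ _), ?_⟩
  rw [eLpNorm_withDensity hw hpos hm]
  refine lt_of_le_of_lt (le_of_eq ?_) hf.2
  congr 1
  funext a
  rw [mul_div_cancel₀]
  exact_mod_cast (Real.sqrt_pos.2 (hpos a)).ne'

/-- Division by √w is isometric, with inverse multiplication by √w. Positivity of `w` makes the two
measures mutually absolutely continuous, so a.e. identities pass between them. -/
theorem exists_isometryEquiv_withDensity (hw : Measurable w) (hpos : ∀ a, 0 < w a) :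
    ∃ T : Lp ℂ 2 ν ≃ₗᵢ[ℂ] Lp ℂ 2 (ν.withDensity fun a => ENNReal.ofReal (w a)),
      ∀ f, T f = (memLp_div_sqrt hw hpos (Lp.memLp f)).toLp := by
  have hac := ac_withDensity_ofReal (ν := ν) hw hpos
  have hac' : (ν.withDensity fun a => ENNReal.ofReal (w a)) ≪ ν :=
    withDensity_absolutelyContinuous _ _
  have h0 (a : α) : ((√(w a) : ℝ) : ℂ) ≠ 0 := by
    exact_mod_cast (Real.sqrt_pos.2 (hpos a)).ne'
  let T₀ : Lp ℂ 2 ν →ₗᵢ[ℂ] Lp ℂ 2 (ν.withDensity fun a => ENNReal.ofReal (w a)) :=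
    { toFun := fun f => (memLp_div_sqrt hw hpos (Lp.memLp f)).toLp
      map_add' := fun f g => by
        refine Lp.ext ?_
        filter_upwards [MemLp.coeFn_toLp (memLp_div_sqrt hw hpos (Lp.memLp (f + g))),
          MemLp.coeFn_toLp (memLp_div_sqrt hw hpos (Lp.memLp f)),
          MemLp.coeFn_toLp (memLp_div_sqrt hw hpos (Lp.memLp g)),
          hac'.ae_le (Lp.coeFn_add f g),
          Lp.coeFn_add (memLp_div_sqrt hw hpos (Lp.memLp f)).toLp
            (memLp_div_sqrt hw hpos (Lp.memLp g)).toLp] with a h1 h2 h3 h4 h5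
        rw [h1, h5, Pi.add_apply, h2, h3, h4, Pi.add_apply, add_div]
      map_smul' := fun c f => by
        refine Lp.ext ?_
        filter_upwards [MemLp.coeFn_toLp (memLp_div_sqrt hw hpos (Lp.memLp (c • f))),
          MemLp.coeFn_toLp (memLp_div_sqrt hw hpos (Lp.memLp f)),
          hac'.ae_le (Lp.coeFn_smul c f),
          Lp.coeFn_smul c (memLp_div_sqrt hw hpos (Lp.memLp f)).toLp] with a h1 h2 h3 h4
        rw [h1, RingHom.id_apply, h4, Pi.smul_apply, h2, h3, Pi.smul_apply, smul_eq_mul,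
          smul_eq_mul, mul_div_assoc]
      norm_map' := fun f => by
        have hm : AEStronglyMeasurable (fun a => f a / (√(w a) : ℂ)) ν :=
          (memLp_div_sqrt hw hpos (Lp.memLp f)).1.mono_ac hac
        change ‖(memLp_div_sqrt hw hpos (Lp.memLp f)).toLp‖ = _
        rw [Lp.norm_toLp, eLpNorm_withDensity hw hpos hm, Lp.norm_def]
        congr 2
        funext a
        rw [mul_div_cancel₀ _ (h0 a)] }
  have hsurj : Function.Surjective T₀ := by
    intro g
    have hg : AEStronglyMeasurable g ν := (Lp.memLp g).1.mono_ac hac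
    have hf : MemLp (fun a => (√(w a) : ℂ) * g a) 2 ν := by
      refine ⟨((Complex.measurable_ofReal.comp hw.sqrt).aestronglyMeasurable).mul hg, ?_⟩
      rw [← eLpNorm_withDensity hw hpos hg]
      exact (Lp.memLp g).2
    refine ⟨hf.toLp, Lp.ext ?_⟩
    filter_upwards [MemLp.coeFn_toLp (memLp_div_sqrt hw hpos (Lp.memLp hf.toLp)),
      hac'.ae_le (MemLp.coeFn_toLp hf)] with a h1 h2
    refine h1.trans ?_
    rw [h2, mul_div_cancel_left₀ _ (h0 a)]
  exact ⟨LinearIsometryEquiv.ofSurjective T₀ hsurj, fun f => rfl⟩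

/-- Multiplication by a bounded function on `L²`. -/
theorem exists_mul_Lp {m : α → ℝ} (hm : Measurable m) {C : ℝ} (hC : ∀ a, |m a| ≤ C) :
    ∃ M : Lp ℂ 2 ν →L[ℂ] Lp ℂ 2 ν, ∀ f : Lp ℂ 2 ν, ∀ᵐ a ∂ν, M f a = (m a : ℂ) * f a := by
  have hle (f : Lp ℂ 2 ν) : ∀ᵐ a ∂ν, ‖(m a : ℂ) * f a‖ ≤ C * ‖f a‖ := by
    refine Filter.Eventually.of_forall fun a => ?_
    rw [norm_mul, Complex.norm_real]
    exact mul_le_mul_of_nonneg_right (hC a) (norm_nonneg _)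
  have hmem (f : Lp ℂ 2 ν) : MemLp (fun a => (m a : ℂ) * f a) 2 ν :=
    MemLp.of_le_mul (Lp.memLp f)
      ((Complex.measurable_ofReal.comp hm).aestronglyMeasurable.mul (Lp.memLp f).1) (hle f)
  let M₀ : Lp ℂ 2 ν →ₗ[ℂ] Lp ℂ 2 ν :=
    { toFun := fun f => (hmem f).toLp
      map_add' := fun f g => by
        refine Lp.ext ?_
        filter_upwards [MemLp.coeFn_toLp (hmem (f + g)), MemLp.coeFn_toLp (hmem f),
          MemLp.coeFn_toLp (hmem g), Lp.coeFn_add f g,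
          Lp.coeFn_add (hmem f).toLp (hmem g).toLp] with a h1 h2 h3 h4 h5
        rw [h1, h5, Pi.add_apply, h2, h3, h4, Pi.add_apply, mul_add]
      map_smul' := fun c f => by
        refine Lp.ext ?_
        filter_upwards [MemLp.coeFn_toLp (hmem (c • f)), MemLp.coeFn_toLp (hmem f),
          Lp.coeFn_smul c f, Lp.coeFn_smul c (hmem f).toLp] with a h1 h2 h3 h4
        rw [h1, RingHom.id_apply, h4, Pi.smul_apply, h2, h3, Pi.smul_apply, smul_eq_mul,
          smul_eq_mul, mul_left_comm] }
  refine ⟨M₀.mkContinuous C fun f => ?_, fun f => MemLp.coeFn_toLp (hmem f)⟩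
  refine Lp.norm_le_mul_norm_of_ae_le_mul ?_
  filter_upwards [MemLp.coeFn_toLp (hmem f), hle f] with a h1 h2
  exact (congrArg norm h1).le.trans h2

/-- A multiplication operator whose symbol is at least `c > 1` on a set of finite positive measure
is not isometric. -/
theorem exists_norm_mul_ne {m : α → ℝ} {M : Lp ℂ 2 ν → Lp ℂ 2 ν}
    (hM : ∀ f : Lp ℂ 2 ν, ∀ᵐ a ∂ν, M f a = (m a : ℂ) * f a) {S : Set α} (hS : MeasurableSet S)
    (hS0 : ν S ≠ 0) (hS1 : ν S ≠ ⊤) {c : ℝ} (hc : 1 < c) (hm : ∀ a ∈ S, c ≤ m a) :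
    ∃ f, ‖M f‖ ≠ ‖f‖ := by
  set f := indicatorConstLp 2 hS hS1 (1 : ℂ) with hf
  refine ⟨f, fun h => ?_⟩
  have hfpos : 0 < ‖f‖ := by
    rw [hf, norm_indicatorConstLp two_ne_zero ENNReal.ofNat_ne_top, norm_one, one_mul]
    exact Real.rpow_pos_of_pos (ENNReal.toReal_pos hS0 hS1) _
  have hle : ‖f‖ ≤ c⁻¹ * ‖M f‖ := by
    refine Lp.norm_le_mul_norm_of_ae_le_mul ?_
    filter_upwards [hM f, indicatorConstLp_coeFn (p := 2) (hs := hS) (hμs := hS1) (c := (1 : ℂ))]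
      with a h1 h2
    rw [h1, hf, h2]
    by_cases ha : a ∈ S
    · rw [Set.indicator_of_mem ha, mul_one, norm_one, Complex.norm_real, inv_mul_eq_div,
        le_div_iff₀ (by linarith), one_mul]
      exact (hm a ha).trans (le_abs_self _)
    · simp [Set.indicator_of_notMem ha]
  rw [h, inv_mul_eq_div, le_div_iff₀ (by linarith)] at hle
  nlinarith

end WeightedL2

/-! ### The prequantum bundle, parallel transport and the BKS map -/

section Prequantum

variable {n : ℕ} {𝔨 : Type*} [NormedAddCommGroup 𝔨] [InnerProductSpace ℝ 𝔨] [FiniteDimensional ℝ 𝔨]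
  [MeasurableSpace 𝔨] [BorelSpace 𝔨]
  {K : Type*} [TopologicalSpace K] [ChartedSpace 𝔨 K] [Group K] [LieGroup 𝓘(ℝ, 𝔨) ∞ K]
  [MeasurableSpace K]
  {𝔤 : Type*} [NormedAddCommGroup 𝔤] [NormedSpace ℂ 𝔤] [FiniteDimensional ℂ 𝔤]
  {G : Type*} [TopologicalSpace G] [ChartedSpace 𝔤 G] [Group G] [T2Space G]
  [LieGroup 𝓘(ℂ, 𝔤) ω G] [LieGroup 𝓘(ℝ, 𝔤) ∞ G]
  {ι : K →* G} {X : OrthonormalBasis (Fin n) ℝ 𝔨} {μ : Measure K}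

section Density

theorem normOm_pos (hAd : ∀ (x : K) (Y Z : 𝔨), ⟪Ad x Y, Ad x Z⟫_ℝ = ⟪Y, Z⟫_ℝ)
    (hι : IsComplexification 𝔨 𝔤 ι) {s : ℝ} (hs : 0 < s) (p : K × 𝔨) : 0 < normOm 𝔤 ι X s p := by
  obtain ⟨x, Y⟩ := p
  rw [normOm_eq hAd hι X hs]
  have := eta_pos hAd X (s • Y)
  have := Real.sqrt_pos.2 hs
  positivity

theorem measurable_normOm (hAd : ∀ (x : K) (Y Z : 𝔨), ⟪Ad x Y, Ad x Z⟫_ℝ = ⟪Y, Z⟫_ℝ)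
    (hι : IsComplexification 𝔨 𝔤 ι) {s : ℝ} (hs : 0 < s) : Measurable (normOm 𝔤 ι X s) := by
  have h : normOm 𝔤 ι X s = fun p : K × 𝔨 => √s ^ n * eta K (s • p.2) :=
    funext fun p => normOm_eq hAd hι X hs p.1 p.2
  rw [h]
  exact (((continuous_eta hAd X).comp (continuous_const_smul s)).measurable.comp
    measurable_snd).const_mul _

theorem phi_eq_normOm (hAd : ∀ (x : K) (Y Z : 𝔨), ⟪Ad x Y, Ad x Z⟫_ℝ = ⟪Y, Z⟫_ℝ)
    (hι : IsComplexification 𝔨 𝔤 ι) {s s' : ℝ} (hs : 0 < s) (hs' : 0 < s') (x : K) (Y : 𝔨) :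
    phi K n s s' Y = normOm 𝔤 ι X ((s + s') / 2) (x, Y) ^ 2 /
      (normOm 𝔤 ι X s (x, Y) * normOm 𝔤 ι X s' (x, Y)) := by
  have h1 := (eta_pos hAd X (s • Y)).ne'
  have h2 := (eta_pos hAd X (s' • Y)).ne'
  have h3 := (Real.sqrt_pos.2 hs).ne'
  have h4 := (Real.sqrt_pos.2 hs').ne'
  have h5 : √((s + s') / 2) ^ 2 = (s + s') / 2 := Real.sq_sqrt (by positivity)
  rw [normOm_eq hAd hι X hs, normOm_eq hAd hι X hs', normOm_eq hAd hι X (by positivity), phi,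
    Real.sqrt_mul hs.le, mul_pow, ← pow_mul, mul_comm n 2, pow_mul, h5, ← div_div, div_pow, mul_pow]
  field_simp

/-- The quotient is the positive number |Ω_{(s+s')/2}|², so the principal branch is the ordinary
square root and no question of sign arises. -/
theorem ratio_cpow (hAd : ∀ (x : K) (Y Z : 𝔨), ⟪Ad x Y, Ad x Z⟫_ℝ = ⟪Y, Z⟫_ℝ)
    (hι : IsComplexification 𝔨 𝔤 ι) {s s' : ℝ} (hs : 0 < s) (hs' : 0 < s') (p : K × 𝔨) :
    ratio 𝔤 ι X s s' p ^ (1 / 2 : ℂ) =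
      ((√(phi K n s s' p.2) * (√(normOm 𝔤 ι X s p) * √(normOm 𝔤 ι X s' p)) : ℝ) : ℂ) := by
  obtain ⟨x, Y⟩ := p
  have hσ : 0 < (s + s') / 2 := by positivity
  have h1 := normOm_pos (X := X) hAd hι hs (x, Y)
  have h2 := normOm_pos (X := X) hAd hι hs' (x, Y)
  have h3 := normOm_pos (X := X) hAd hι hσ (x, Y)
  have h4 : ratio 𝔤 ι X s s' (x, Y) = ((normOm 𝔤 ι X ((s + s') / 2) (x, Y) ^ 2 : ℝ) : ℂ) := by
    rw [ratio_eq hAd hι, normOm_eq hAd hι X hσ, mul_pow, ← pow_mul, mul_comm n 2, pow_mul,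
      Real.sq_sqrt hσ.le]
  have h5 : (1 / 2 : ℂ) = ((1 / 2 : ℝ) : ℂ) := by norm_num
  rw [h4, h5, ← Complex.ofReal_cpow (sq_nonneg _), ← Real.sqrt_eq_rpow, Real.sqrt_sq h3.le,
    phi_eq_normOm (X := X) hAd hι hs hs' x, ← Real.sqrt_mul h1.le,
    ← Real.sqrt_mul (div_nonneg (sq_nonneg _) (mul_pos h1 h2).le),
    div_mul_cancel₀ _ (mul_pos h1 h2).ne', Real.sqrt_sq h3.le]

end Density

theorem exists_triv_equiv (hAd : ∀ (x : K) (Y Z : 𝔨), ⟪Ad x Y, Ad x Z⟫_ℝ = ⟪Y, Z⟫_ℝ)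
    (hι : IsComplexification 𝔨 𝔤 ι) {s : ℝ} (hs : 0 < s) :
    ∃ T : L2 𝔨 μ ≃ₗᵢ[ℂ] PrQ 𝔤 ι X μ s, ∀ f : L2 𝔨 μ, T f = triv 𝔤 ι X μ s f ∧
      ∀ᵐ p ∂(liouville μ), triv 𝔤 ι X μ s f p = f p / (√(normOm 𝔤 ι X s p) : ℂ) := by
  have hm (f : L2 𝔨 μ) : MemLp (fun p => f p / (√(normOm 𝔤 ι X s p) : ℂ)) 2
      (prqMeasure 𝔤 ι X μ s) :=
    memLp_div_sqrt (measurable_normOm hAd hι hs) (normOm_pos hAd hι hs) (Lp.memLp f)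
  obtain ⟨T, hT⟩ : ∃ T : L2 𝔨 μ ≃ₗᵢ[ℂ] PrQ 𝔤 ι X μ s, ∀ f : L2 𝔨 μ, T f = (hm f).toLp :=
    exists_isometryEquiv_withDensity (measurable_normOm hAd hι hs) (normOm_pos hAd hι hs)
  have h (f : L2 𝔨 μ) : T f = triv 𝔤 ι X μ s f := by
    rw [triv, dif_pos (hm f), hT]
  refine ⟨T, fun f => ⟨h f, ?_⟩⟩
  rw [← h, hT]
  exact (ac_withDensity_ofReal (measurable_normOm (X := X) hAd hι hs) (normOm_pos hAd hι hs)).ae_le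
    (MemLp.coeFn_toLp (hm f))

/-- The trivialization of the prequantum bundle. -/
def trivEquiv (hAd : ∀ (x : K) (Y Z : 𝔨), ⟪Ad x Y, Ad x Z⟫_ℝ = ⟪Y, Z⟫_ℝ)
    (hι : IsComplexification 𝔨 𝔤 ι) (X : OrthonormalBasis (Fin n) ℝ 𝔨) (μ : Measure K) {s : ℝ}
    (hs : 0 < s) : L2 𝔨 μ ≃ₗᵢ[ℂ] PrQ 𝔤 ι X μ s :=
  (exists_triv_equiv (X := X) (μ := μ) hAd hι hs).choose

theorem trivEquiv_apply (hAd : ∀ (x : K) (Y Z : 𝔨), ⟪Ad x Y, Ad x Z⟫_ℝ = ⟪Y, Z⟫_ℝ)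
    (hι : IsComplexification 𝔨 𝔤 ι) {s : ℝ} (hs : 0 < s) (f : L2 𝔨 μ) :
    trivEquiv hAd hι X μ hs f = triv 𝔤 ι X μ s f :=
  ((exists_triv_equiv (X := X) (μ := μ) hAd hι hs).choose_spec f).1

theorem trivEquiv_ae (hAd : ∀ (x : K) (Y Z : 𝔨), ⟪Ad x Y, Ad x Z⟫_ℝ = ⟪Y, Z⟫_ℝ)
    (hι : IsComplexification 𝔨 𝔤 ι) {s : ℝ} (hs : 0 < s) (f : L2 𝔨 μ) :
    ∀ᵐ p ∂(liouville μ), trivEquiv hAd hι X μ hs f p = f p / (√(normOm 𝔤 ι X s p) : ℂ) := by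
  rw [trivEquiv_apply]
  exact ((exists_triv_equiv (X := X) (μ := μ) hAd hι hs).choose_spec f).2

theorem exists_parallel_section (hAd : ∀ (x : K) (Y Z : 𝔨), ⟪Ad x Y, Ad x Z⟫_ℝ = ⟪Y, Z⟫_ℝ)
    (hι : IsComplexification 𝔨 𝔤 ι) (g : L2 𝔨 μ) (r : ℝ) (hr : 0 < r) :
    HasCovDerivAt 𝔤 ι X μ (fun r => triv 𝔤 ι X μ r g) r 0 :=
  ⟨fun _ => g, fun _ _ => rfl, 0, hasDerivAt_const r g, by
    rw [← trivEquiv_apply hAd hι hr, map_zero]⟩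

theorem parallel_section_eq (hAd : ∀ (x : K) (Y Z : 𝔨), ⟪Ad x Y, Ad x Z⟫_ℝ = ⟪Y, Z⟫_ℝ)
    (hι : IsComplexification 𝔨 𝔤 ι) {σ : (r : ℝ) → PrQ 𝔤 ι X μ r}
    (hσ : ∀ r, 0 < r → HasCovDerivAt 𝔤 ι X μ σ r 0) {s s' : ℝ} (hs : 0 < s) (hs' : 0 < s') :
    trivEquiv hAd hι X μ hs ((trivEquiv hAd hι X μ hs').symm (σ s')) = σ s := by
  classical
  -- The trivialized section in `HasCovDerivAt` may vary with the point; this one agrees with all of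
  -- them on r > 0, which is a neighbourhood of each such point. It has derivative zero on a
  -- connected set.
  let g : ℝ → L2 𝔨 μ := fun r =>
    if hr : 0 < r then (trivEquiv hAd hι X μ hr).symm (σ r) else 0
  have hg {r : ℝ} (hr : 0 < r) : g r = (trivEquiv hAd hι X μ hr).symm (σ r) := dif_pos hr
  have hd (r : ℝ) (hr : r ∈ Set.Ioi (0 : ℝ)) : HasDerivAt g 0 r := by
    obtain ⟨g₁, h1, g₁', h2, h3⟩ := hσ r hr
    have h4 : g₁' = 0 := by
      rw [← trivEquiv_apply hAd hι hr] at h3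
      exact (LinearIsometryEquiv.map_eq_zero_iff _).1 h3.symm
    rw [h4] at h2
    refine h2.congr_of_eventuallyEq ?_
    filter_upwards [Ioi_mem_nhds hr] with t ht
    rw [hg ht, h1 t ht, ← trivEquiv_apply hAd hι ht, LinearIsometryEquiv.symm_apply_apply]
  have hc := isOpen_Ioi.is_const_of_deriv_eq_zero isPreconnected_Ioi
    (fun r hr => (hd r hr).differentiableAt.differentiableWithinAt)
    (fun r hr => (hd r hr).deriv) (Set.mem_Ioi.2 hs') (Set.mem_Ioi.2 hs)
  rw [← hg hs', hc, hg hs, LinearIsometryEquiv.apply_symm_apply]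

theorem isParallelTransport_trivEquiv
    (hAd : ∀ (x : K) (Y Z : 𝔨), ⟪Ad x Y, Ad x Z⟫_ℝ = ⟪Y, Z⟫_ℝ)
    (hι : IsComplexification 𝔨 𝔤 ι) {s s' : ℝ} (hs : 0 < s) (hs' : 0 < s') :
    IsParallelTransport 𝔤 ι X μ s s'
      fun v => trivEquiv hAd hι X μ hs ((trivEquiv hAd hι X μ hs').symm v) :=
  fun _ hσ => parallel_section_eq hAd hι hσ hs hs'

/-- Every vector of the fibre lies on a parallel section, constant in the trivialization; this
forces uniqueness of the transport. -/
theorem IsParallelTransport.apply_trivEquiv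
    (hAd : ∀ (x : K) (Y Z : 𝔨), ⟪Ad x Y, Ad x Z⟫_ℝ = ⟪Y, Z⟫_ℝ)
    (hι : IsComplexification 𝔨 𝔤 ι) {s s' : ℝ} (hs : 0 < s) (hs' : 0 < s')
    {P : PrQ 𝔤 ι X μ s' → PrQ 𝔤 ι X μ s} (hP : IsParallelTransport 𝔤 ι X μ s s' P) (g : L2 𝔨 μ) :
    P (trivEquiv hAd hι X μ hs' g) = trivEquiv hAd hι X μ hs g := by
  rw [trivEquiv_apply, trivEquiv_apply]
  exact hP _ (exists_parallel_section hAd hι g)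

/-- Multiplication by `√φ(s, s', ·)` on `L²(T^*K)`. -/
theorem exists_mul_sqrt_phi (hAd : ∀ (x : K) (Y Z : 𝔨), ⟪Ad x Y, Ad x Z⟫_ℝ = ⟪Y, Z⟫_ℝ)
    (X : OrthonormalBasis (Fin n) ℝ 𝔨) (μ : Measure K) {s s' : ℝ} (hs : 0 < s) (hs' : 0 < s') :
    ∃ M : L2 𝔨 μ →L[ℂ] L2 𝔨 μ, ∀ f : L2 𝔨 μ, ∀ᵐ p ∂(liouville μ),
      M f p = (√(phi K n s s' p.2) : ℂ) * f p := by
  refine exists_mul_Lp (C := √(phiMax n s s')) ?_ fun p => ?_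
  · exact (Real.continuous_sqrt.comp (continuous_phi hAd X s s')).measurable.comp measurable_snd
  · rw [abs_of_nonneg (Real.sqrt_nonneg _)]
    exact Real.sqrt_le_sqrt (phi_le hAd X hs hs' _)

/-- The denominators √|Ω_s| and √|Ω_{s'}| of the trivializations cancel against `ratio_cpow`,
leaving √φ. -/
theorem bksIntegrand_ae_eq (hAd : ∀ (x : K) (Y Z : 𝔨), ⟪Ad x Y, Ad x Z⟫_ℝ = ⟪Y, Z⟫_ℝ)
    (hι : IsComplexification 𝔨 𝔤 ι) {s s' : ℝ} (hs : 0 < s) (hs' : 0 < s')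
    {M : L2 𝔨 μ →L[ℂ] L2 𝔨 μ} (hM : ∀ f : L2 𝔨 μ, ∀ᵐ p ∂(liouville μ),
      M f p = (√(phi K n s s' p.2) : ℂ) * f p) (f f' : L2 𝔨 μ) :
    bksIntegrand 𝔤 ι X s s' (trivEquiv hAd hι X μ hs f) (trivEquiv hAd hι X μ hs' f')
      =ᵐ[liouville μ] fun p => ⟪f p, M f' p⟫_ℂ := by
  filter_upwards [trivEquiv_ae (X := X) hAd hι hs f, trivEquiv_ae (X := X) hAd hι hs' f', hM f']
    with p h1 h2 h3
  have h4 : ((√(normOm 𝔤 ι X s p) : ℝ) : ℂ) ≠ 0 := by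
    exact_mod_cast (Real.sqrt_pos.2 (normOm_pos hAd hι hs p)).ne'
  have h5 : ((√(normOm 𝔤 ι X s' p) : ℝ) : ℂ) ≠ 0 := by
    exact_mod_cast (Real.sqrt_pos.2 (normOm_pos hAd hι hs' p)).ne'
  rw [bksIntegrand, ratio_cpow hAd hι hs hs', h1, h2, h3, RCLike.inner_apply, map_div₀,
    Complex.conj_ofReal]
  push_cast
  field_simp

theorem integrable_bksIntegrand (hAd : ∀ (x : K) (Y Z : 𝔨), ⟪Ad x Y, Ad x Z⟫_ℝ = ⟪Y, Z⟫_ℝ)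
    (hι : IsComplexification 𝔨 𝔤 ι) {s s' : ℝ} (hs : 0 < s) (hs' : 0 < s') (σ : PrQ 𝔤 ι X μ s)
    (σ' : PrQ 𝔤 ι X μ s') : Integrable (bksIntegrand 𝔤 ι X s s' σ σ') (liouville μ) := by
  obtain ⟨M, hM⟩ := exists_mul_sqrt_phi hAd X μ hs hs'
  obtain ⟨f, rfl⟩ := (trivEquiv hAd hι X μ hs).surjective σ
  obtain ⟨f', rfl⟩ := (trivEquiv hAd hι X μ hs').surjective σ'
  exact (L2.integrable_inner f (M f')).congr (bksIntegrand_ae_eq hAd hι hs hs' hM f f').symm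

theorem isBKSMap_of_mul (hAd : ∀ (x : K) (Y Z : 𝔨), ⟪Ad x Y, Ad x Z⟫_ℝ = ⟪Y, Z⟫_ℝ)
    (hι : IsComplexification 𝔨 𝔤 ι) {s s' : ℝ} (hs : 0 < s) (hs' : 0 < s')
    {M : L2 𝔨 μ →L[ℂ] L2 𝔨 μ} (hM : ∀ f : L2 𝔨 μ, ∀ᵐ p ∂(liouville μ),
      M f p = (√(phi K n s s' p.2) : ℂ) * f p) :
    IsBKSMap 𝔤 ι X μ s s'
      fun v => trivEquiv hAd hι X μ hs (M ((trivEquiv hAd hι X μ hs').symm v)) := by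
  intro σ σ'
  obtain ⟨f, rfl⟩ := (trivEquiv hAd hι X μ hs).surjective σ
  obtain ⟨f', rfl⟩ := (trivEquiv hAd hι X μ hs').surjective σ'
  simp only [LinearIsometryEquiv.symm_apply_apply]
  rw [integral_congr_ae (bksIntegrand_ae_eq hAd hι hs hs' hM f f'), LinearIsometryEquiv.inner_map_map, L2.inner_def]

theorem IsBKSMap.unique {s s' : ℝ} {B B' : PrQ 𝔤 ι X μ s' → PrQ 𝔤 ι X μ s}
    (h : IsBKSMap 𝔤 ι X μ s s' B) (h' : IsBKSMap 𝔤 ι X μ s s' B') : B' = B :=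
  funext fun σ' => ext_inner_left ℂ fun σ => (h' σ σ').symm.trans (h σ σ')

/-- Multiplication by `√φ(s, s', ·)` is not isometric for `s ≠ s'`. -/
theorem exists_norm_mul_sqrt_phi_ne [CompactSpace K] [BorelSpace K] [μ.IsHaarMeasure]
    (hAd : ∀ (x : K) (Y Z : 𝔨), ⟪Ad x Y, Ad x Z⟫_ℝ = ⟪Y, Z⟫_ℝ)
    (X : OrthonormalBasis (Fin n) ℝ 𝔨) {s s' : ℝ} (hs : 0 < s) (hs' : 0 < s') (hn : 0 < n)
    (hne : s ≠ s') {M : L2 𝔨 μ →L[ℂ] L2 𝔨 μ} (hM : ∀ f : L2 𝔨 μ, ∀ᵐ p ∂(liouville μ),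
      M f p = (√(phi K n s s' p.2) : ℂ) * f p) : ∃ f, ‖M f‖ ≠ ‖f‖ := by
  have h1 : 1 < √(phi K n s s' (0 : 𝔨)) := by
    rw [phi_zero hAd X]
    exact Real.lt_sqrt_of_sq_lt (by simpa using one_lt_phiMax hs hs' hn hne)
  obtain ⟨c, hc1, hc⟩ := exists_between h1
  have hcont : Continuous fun Y : 𝔨 => √(phi K n s s' Y) :=
    Real.continuous_sqrt.comp (continuous_phi hAd X s s')
  obtain ⟨δ, hδ, hball⟩ := Metric.mem_nhds_iff.1
    (hcont.continuousAt.preimage_mem_nhds (Ioi_mem_nhds hc))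
  -- √φ stays above `c > 1` on `K` times a small ball around Y = 0, which has finite measure as `K`
  -- is compact.
  refine exists_norm_mul_ne hM (S := Set.univ ×ˢ Metric.ball (0 : 𝔨) δ)
    (MeasurableSet.univ.prod measurableSet_ball) ?_ ?_ hc1 fun p hp => (hball hp.2).le
  · rw [liouville, Measure.prod_prod]
    exact mul_ne_zero (isOpen_univ.measure_pos μ ⟨1, trivial⟩).ne'
      (Metric.measure_ball_pos volume _ hδ).ne'
  · rw [liouville, Measure.prod_prod]
    exact ENNReal.mul_ne_top isCompact_univ.measure_lt_top.ne measure_ball_lt_top.ne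

end Prequantum

end BKS

end

theorem theorem2p2 {n : ℕ}
    {𝔨 : Type*} [NormedAddCommGroup 𝔨] [InnerProductSpace ℝ 𝔨] [FiniteDimensional ℝ 𝔨]
    [MeasurableSpace 𝔨] [BorelSpace 𝔨]
    {K : Type*} [TopologicalSpace K] [ChartedSpace 𝔨 K] [Group K] [LieGroup 𝓘(ℝ, 𝔨) ∞ K]
    [T2Space K] [CompactSpace K] [ConnectedSpace K] [MeasurableSpace K] [BorelSpace K]
    (hAd : ∀ (x : K) (Y Z : 𝔨), ⟪BKS.Ad x Y, BKS.Ad x Z⟫_ℝ = ⟪Y, Z⟫_ℝ)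
    {𝔤 : Type*} [NormedAddCommGroup 𝔤] [NormedSpace ℂ 𝔤] [FiniteDimensional ℂ 𝔤]
    {G : Type*} [TopologicalSpace G] [ChartedSpace 𝔤 G] [Group G] [T2Space G]
    [LieGroup 𝓘(ℂ, 𝔤) ω G] [LieGroup 𝓘(ℝ, 𝔤) ∞ G]
    (ι : K →* G) (hι : BKS.IsComplexification 𝔨 𝔤 ι)
    (X : OrthonormalBasis (Fin n) ℝ 𝔨)
    (μ : Measure K) [μ.IsHaarMeasure] :
    -- `η` is well defined and `Ad`-invariant
    (∀ (𝔱 : Submodule ℝ 𝔨) (R : Set (Module.Dual ℝ 𝔱)),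
        BKS.IsCartan K 𝔱 → BKS.IsPositiveRoots K 𝔱 R →
          R.Finite ∧ ∀ Y : 𝔱, BKS.eta K (Y : 𝔨) = BKS.etaProd 𝔱 R Y) ∧
    (∀ Y : 𝔨, ∃ (𝔱 : Submodule ℝ 𝔨) (R : Set (Module.Dual ℝ 𝔱)),
        Y ∈ 𝔱 ∧ BKS.IsCartan K 𝔱 ∧ BKS.IsPositiveRoots K 𝔱 R) ∧
    (∀ (x : K) (Y : 𝔨), BKS.eta K (BKS.Ad x Y) = BKS.eta K Y) ∧
    -- the Liouville form has density `±1` with respect to the left invariant frame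
    (∀ p : K × 𝔨, |BKS.liouvilleForm n p (BKS.frame X p)| = 1) ∧
    -- the trivialization of the prequantum bundle
    (∀ s : ℝ, 0 < s → ∃ T : BKS.L2 𝔨 μ ≃ₗᵢ[ℂ] BKS.PrQ 𝔤 ι X μ s, ∀ f : BKS.L2 𝔨 μ,
        T f = BKS.triv 𝔤 ι X μ s f ∧
        ∀ᵐ p ∂(BKS.liouville μ),
          BKS.triv 𝔤 ι X μ s f p = f p / (√(BKS.normOm 𝔤 ι X s p) : ℂ)) ∧
    ∀ s s' : ℝ, 0 < s → 0 < s' →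
      -- the two expressions for `φ`
      (∀ (x : K) (Y : 𝔨), BKS.phi K n s s' Y =
        BKS.normOm 𝔤 ι X ((s + s') / 2) (x, Y) ^ 2 /
          (BKS.normOm 𝔤 ι X s (x, Y) * BKS.normOm 𝔤 ι X s' (x, Y))) ∧
      -- the BKS pairing is defined by a convergent integral
      (∀ (σ : BKS.PrQ 𝔤 ι X μ s) (σ' : BKS.PrQ 𝔤 ι X μ s'),
        Integrable (BKS.bksIntegrand 𝔤 ι X s s' σ σ') (BKS.liouville μ)) ∧
      -- the parallel transport exists and is unique
      (∃! P : BKS.PrQ 𝔤 ι X μ s' → BKS.PrQ 𝔤 ι X μ s,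
        BKS.IsParallelTransport 𝔤 ι X μ s s' P) ∧
      -- the BKS pairing map exists, is unique and is given by `√φ`
      ∃ B : BKS.PrQ 𝔤 ι X μ s' →L[ℂ] BKS.PrQ 𝔤 ι X μ s,
        BKS.IsBKSMap 𝔤 ι X μ s s' B ∧
        (∀ B' : BKS.PrQ 𝔤 ι X μ s' → BKS.PrQ 𝔤 ι X μ s,
          BKS.IsBKSMap 𝔤 ι X μ s s' B' → B' = B) ∧
        (∀ f' : BKS.L2 𝔨 μ, ∃ g : BKS.L2 𝔨 μ,
          (∀ᵐ p ∂(BKS.liouville μ), g p = (√(BKS.phi K n s s' p.2) : ℂ) * f' p) ∧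
          B (BKS.triv 𝔤 ι X μ s' f') = BKS.triv 𝔤 ι X μ s g) ∧
        (0 < n → s ≠ s' →
          ¬ BKS.IsParallelTransport 𝔤 ι X μ s s' B ∧
          ¬ ∃ U : BKS.PrQ 𝔤 ι X μ s' ≃ₗᵢ[ℂ] BKS.PrQ 𝔤 ι X μ s, ∀ σ', U σ' = B σ') := by
  refine ⟨fun 𝔱 R hc hR => ⟨?_, fun Y => ?_⟩, BKS.exists_cartan_positiveRoots hAd X,
    BKS.eta_Ad hAd X, BKS.abs_liouvilleForm_frame X,
    fun s hs => BKS.exists_triv_equiv hAd hι hs, fun s s' hs hs' =>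
      ⟨BKS.phi_eq_normOm hAd hι hs hs', BKS.integrable_bksIntegrand hAd hι hs hs', ?_, ?_⟩⟩
  · obtain ⟨P, P', w, h1, h2, h⟩ := BKS.exists_weights hAd X hc.1
    exact hR.finite h1 h2 h
  · rw [BKS.eta_eq_sqrt hAd X, BKS.etaProd_eq_sqrt hAd X hc hR]
  · refine ⟨_, BKS.isParallelTransport_trivEquiv hAd hι hs hs', fun P hP => funext fun v => ?_⟩
    obtain ⟨g, rfl⟩ := (BKS.trivEquiv hAd hι X μ hs').surjective v
    rw [BKS.IsParallelTransport.apply_trivEquiv hAd hι hs hs' hP]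
    simp only [LinearIsometryEquiv.symm_apply_apply]
  · obtain ⟨M, hM⟩ := BKS.exists_mul_sqrt_phi hAd X μ hs hs'
    let T := BKS.trivEquiv hAd hι X μ hs
    let T' := BKS.trivEquiv hAd hι X μ hs'
    have hB := BKS.isBKSMap_of_mul (X := X) hAd hι hs hs' hM
    refine ⟨(T.toContinuousLinearEquiv.toContinuousLinearMap.comp M).comp
      T'.symm.toContinuousLinearEquiv.toContinuousLinearMap, hB,
      fun B' hB' => BKS.IsBKSMap.unique hB hB', fun f' => ⟨M f', hM f', ?_⟩, fun hn hne => ?_⟩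
    · rw [← BKS.trivEquiv_apply hAd hι hs, ← BKS.trivEquiv_apply hAd hι hs']
      change T (M (T'.symm (T' f'))) = T (M f')
      rw [T'.symm_apply_apply]
    -- One vector refutes both: parallel transport would give `M f = f`, and unitarity would give
    -- `‖M f‖ = ‖f‖`.
    · obtain ⟨f, hf⟩ := BKS.exists_norm_mul_sqrt_phi_ne hAd X hs hs' hn hne hM
      refine ⟨fun hP => hf ?_, fun ⟨U, hU⟩ => hf ?_⟩
      · have h1 : T (M (T'.symm (T' f))) = T f :=
          BKS.IsParallelTransport.apply_trivEquiv hAd hι hs hs' hP f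
        rw [T'.symm_apply_apply] at h1
        rw [T.injective h1]
      · have h1 : U (T' f) = T (M (T'.symm (T' f))) := hU (T' f)
        rw [T'.symm_apply_apply] at h1
        rw [← T.norm_map, ← h1, U.norm_map, T'.norm_map]
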